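/- Let $p\in\mathbb N$ and consider a multi-type general (Crump--Mode--Jagers) branching process with types $1,\dots,p$: the individuals $u$ carry i.i.d. copies $\xi_u=(\xi_u^{i,j})_{i,j\le p}$ of a $p\times p$ matrix $\xi$ of point processes on $[0,\infty)$ (random locally finite point measures, with arbitrary dependence between the entries); an individual $u$ of type $i$ born at time $S(u)$ gives birth to its children of type $j$ at the times $S(u)+x$, $x$ running through the points of $\xi_u^{i,j}$. The children of each individual are numbered in order of birth (children born simultaneously in order of their types), and the process starts with one ancestor, born at time $0$. Let $\mu^{i,j}(B)=\mathbf E[\xi^{i,j}(B)]$, $\mu=(\mu^{i,j})$, and let $M(t)=(\mathbf E^i[N_t^j])_{i,j}$, where $\mathbf E^i[N^j_t]$ is the expected number of individuals of type $j$ (including the ancestor) born up to and including time $t$ when the ancestor has type $i$. Let $U(t)=\sum_{n\ge0}\mu^{*n}([0,t])$. Let $\mathcal L\mu(z)=\big(\int e^{-zx}\,\mu^{i,j}(dx)\big)_{i,j}$ on $\mathcal D=\{z\in\mathbb C:\int e^{-\mathrm{Re}(z)x}\,\mu^{i,j}(dx)<\infty\text{ for all }i,j\}$, let $\Lambda=\{\lambda\in\mathcal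 D:\det(I_p-\mathcal L\mu(\lambda))=0\}$, and $\Lambda_\vartheta=\{\lambda\in\Lambda:\mathrm{Re}\,\lambda>\vartheta\}$. For $\lambda\in\Lambda$ let $k(\lambda)$ be the smallest natural number such that all entries of $(z-\lambda)^{k(\lambda)}(I_p-\mathcal L\mu(z))^{-1}$ extend holomorphically to a neighbourhood of $\lambda$, and let $k(z)=0$ for $z\notin\Lambda$. Suppose that $\vartheta\in\mathbb R$ lies in the interior of $\mathcal D$, that the matrix $\mu(\{0\})$ has spectral radius less than $1$, that $I_p-\mathcal L\mu(\vartheta+i\eta)$ is invertible for every $\eta\in\mathbb R$ with $\sup_{\eta\in\mathbb R}\|(I_p-\mathcal L\mu(\vartheta+i\eta))^{-1}\|<\infty$, and that $\Lambda_\vartheta$ is finite. Then $M(t)$ is finite and $M(t)=U(t)$ for all $t\ge0$, and there exist matrices $C_{\lambda,k}\in\mathbb C^{p\times p}$ ($\lambda\in\Lambda_\vartheta$, $0\le k<k(\lambda)$) and $C_{0,k(0)}$, with $C_{\bar\lambda,k}=\overline{C_{\lambda,k}}$ (so that they are real if $\lambda$ is real), such that, entrywise, $$M(t)=\sum_{\lambda\in\Lambda_\vartheta}e^{\lambda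 t}\sum_{k=0}^{k(\lambda)-1}t^kC_{\lambda,k}+t^{k(0)}C_{0,k(0)}+O(te^{\vartheta t})\qquad(t\to\infty).$$ -/

import Mathlib

open MeasureTheory ProbabilityTheory Filter Asymptotics Topology
open scoped NNReal ENNReal

noncomputable section

namespace CMJ

/-! ### Matrices of measures on `[0, ∞)` -/

/-- A `p × p` matrix of measures on `[0, ∞)`. -/
abbrev MeasureMatrix (p : ℕ) : Type := Fin p → Fin p → Measure ℝ≥0

variable {p : ℕ}

/-- Convolution of matrices of measures, `(μ * ν)^{i,j} = ∑ₖ μ^{i,k} * ν^{k,j}`. -/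
def matConv (μ ν : MeasureMatrix p) : MeasureMatrix p :=
  fun i j => ∑ k, Measure.conv (μ i k) (ν k j)

/-- Convolution powers; the `0`-th power has unit masses at `0` on the diagonal and zero measures
off the diagonal. -/
def convPow (μ : MeasureMatrix p) : ℕ → MeasureMatrix p
  | 0 => fun i j => if i = j then Measure.dirac 0 else 0
  | n + 1 => matConv μ (convPow μ n)

/-- The Markov renewal measure, evaluated on `[0, t]`:
`U^{i,j}(t) = ∑ₙ (μ^{*n})^{i,j}([0, t])`. -/
def renewalFunction (μ : MeasureMatrix p) (t : ℝ≥0) (i j : Fin p) : ℝ≥0∞ :=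
  ∑' n : ℕ, convPow μ n i j (Set.Iic t)

/-- The domain of the Laplace transform of `μ`: all `z` for which
`∫ e^{- Re(z) x} μ^{i,j}(dx)` is finite for all `i, j`. -/
def laplaceDomain (μ : MeasureMatrix p) : Set ℂ :=
  {z | ∀ i j, Integrable (fun x : ℝ≥0 => Real.exp (-(z.re * (x : ℝ)))) (μ i j)}

/-- The entrywise Laplace transform. -/
def laplace (μ : MeasureMatrix p) (z : ℂ) : Matrix (Fin p) (Fin p) ℂ :=
  Matrix.of fun i j => ∫ x : ℝ≥0, Complex.exp (-(z * ((x : ℝ) : ℂ))) ∂(μ i j)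

/-- The matrix `μ(0) = (μ^{i,j}({0}))`, with its entries read as complex numbers. -/
def massAtZero (μ : MeasureMatrix p) : Matrix (Fin p) (Fin p) ℂ :=
  Matrix.of fun i j => (((μ i j).real {0} : ℝ) : ℂ)

/-- The roots in the domain of the characteristic equation `det (I - Lμ(z)) = 0`. -/
def roots (μ : MeasureMatrix p) : Set ℂ :=
  {z | z ∈ laplaceDomain μ ∧ (1 - laplace μ z).det = 0}

/-- The roots with real part larger than `θ`. -/
def rootsRight (μ : MeasureMatrix p) (θ : ℝ) : Set ℂ :=
  {z | z ∈ roots μ ∧ θ < z.re}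

open Classical in
/-- The maximal multiplicity `k(a)` of the pole at a root `a` of the entries of
`(I - Lμ(z))⁻¹`: the smallest `k` for which all entries of `(z - a)^k (I - Lμ(z))⁻¹` are
holomorphic near `a` (after filling in the value at `a`). It is `0` if `a` is not a root. -/
def poleOrder (μ : MeasureMatrix p) (a : ℂ) : ℕ :=
  if a ∈ roots μ then
    sInf {k : ℕ | ∀ i j, ∃ h : ℂ → ℂ, AnalyticAt ℂ h a ∧
      ∀ᶠ z in 𝓝[≠] a, (z - a) ^ k * (1 - laplace μ z)⁻¹ i j = h z}
  else 0

section Norm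

attribute [local instance] Matrix.linftyOpNormedAddCommGroup

/-- `I - Lμ(z)` is invertible on the line `Re z = θ` and the norm of its inverse is
bounded on that line. (All norms on matrices are equivalent; the one used here is the maximal
absolute row sum.) -/
def ResolventBoundedOn (μ : MeasureMatrix p) (θ : ℝ) : Prop :=
  (∀ η : ℝ, IsUnit (1 - laplace μ (θ + η * Complex.I)).det) ∧
    BddAbove (Set.range fun η : ℝ => ‖(1 - laplace μ (θ + η * Complex.I))⁻¹‖)

end Norm

/-! ### Point measures and the enumeration of children -/

/-- A locally finite point measure on `[0, ∞)`: a countable sum of unit point masses that is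
finite on bounded sets. -/
def IsPointMeasure (m : Measure ℝ≥0) : Prop :=
  IsLocallyFiniteMeasure m ∧
    ∃ (I : Set ℕ) (x : ℕ → ℝ≥0), m = Measure.sum fun k : I => Measure.dirac (x k)

/-- An individual whose children of type `j` are born at the points of `ν j` has its children
numbered `0, 1, 2, …` in the order of their births. This is the age of the
parent at the birth of child number `k`, namely the smallest `t` such that at least `k + 1`
children are born in `[0, t]`, and `∞` if there is no such `t` (the child is never born). -/
def childTime (ν : Fin p → Measure ℝ≥0) (k : ℕ) : ℝ≥0∞ :=
  ⨅ (t : ℝ≥0) (_ : ((k + 1 : ℕ) : ℝ≥0∞) ≤ ∑ j, ν j (Set.Iic t)), (t : ℝ≥0∞)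

open Classical in
/-- The type of child number `k`. Children born at the same time are numbered in
the order of their types, so if `x` is the time of birth of child number `k`, then its
type is the smallest `j` such that the number of children born before `x` plus the number of
children born at `x` with type at most `j` is at least `k + 1`. The value `i₀` is a placeholder
for children that are never born. -/
def childType (ν : Fin p → Measure ℝ≥0) (i₀ : Fin p) (k : ℕ) : Fin p :=
  if h : (Finset.univ.filter fun j : Fin p =>
      ((k + 1 : ℕ) : ℝ≥0∞) ≤ ∑ l, ν l (Set.Iio (childTime ν k).toNNReal) +
        ∑ l ∈ Finset.Iic j, ν l {(childTime ν k).toNNReal}).Nonempty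
  then Finset.min' _ h else i₀

/-! ### The multi-type general branching process

Individuals are finite words of natural numbers. The list `k :: u` stands for child number `k` of
the individual `u` (the latest generation comes first) and `[]` is the ancestor. If the
individual `u` has type `i`, its children of type `j` are born when its age is a point of
`ξ u i j`. -/

/-- The type of the individual `u` if the ancestor has type `i`. -/
def indType (ξ : List ℕ → MeasureMatrix p) (i : Fin p) : List ℕ → Fin p
  | [] => i
  | k :: u => childType (ξ u (indType ξ i u)) (indType ξ i u) k

/-- The time of birth of the individual `u` if the ancestor has type `i`; it is `∞` if `u` is
never born. -/
def birthTime (ξ : List ℕ → MeasureMatrix p) (i : Fin p) : List ℕ → ℝ≥0∞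
  | [] => 0
  | k :: u => birthTime ξ i u + childTime (ξ u (indType ξ i u)) k

open Classical in
/-- The number of individuals of type `j` born up to and including time `t` if the
ancestor has type `i`. -/
def numBorn (ξ : List ℕ → MeasureMatrix p) (i j : Fin p) (t : ℝ≥0) : ℝ≥0∞ :=
  ∑' u : List ℕ, if birthTime ξ i u ≤ t ∧ indType ξ i u = j then 1 else 0

variable {Ω : Type*} [MeasurableSpace Ω]

/-- The reproduction matrices `ξ u` of the individuals `u` are independent and identically
distributed random `p × p` matrices of point processes on `[0, ∞)`. No assumption is made on the
joint distribution of the entries of a single matrix. -/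
structure IsReproduction (P : Measure Ω) (ξ : List ℕ → Ω → MeasureMatrix p) : Prop where
  measurable : ∀ u, Measurable (ξ u)
  isPointMeasure : ∀ u ω i j, IsPointMeasure (ξ u ω i j)
  indep : iIndepFun ξ P
  identDistrib : ∀ u, IdentDistrib (ξ u) (ξ []) P P

/-- The matrix of intensity measures, `μ^{i,j}(B) = E[ξ^{i,j}(B)]`. -/
def intensity (P : Measure Ω) (ξ : List ℕ → Ω → MeasureMatrix p) : MeasureMatrix p :=
  fun i j => P.bind fun ω => ξ [] ω i j

/-- `m_{i,j}(t)`, the expected number of individuals of type `j` born up to and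
including time `t` if the ancestor has type `i`. -/
def meanBorn (P : Measure Ω) (ξ : List ℕ → Ω → MeasureMatrix p) (t : ℝ≥0) (i j : Fin p) : ℝ≥0∞ :=
  ∫⁻ ω, numBorn (fun u => ξ u ω) i j t ∂P

end CMJ

end

noncomputable section

namespace CMJ


/-! The identity M = U is a first-moment computation over the family tree. The individual `k :: u`
is born at the birth time of `u`, which depends only on the reproduction of shorter words, plus a
time read off from `ξ u`. Independence makes its law a convolution (`birthLaw_cons`). The
enumeration of children meets every point of the reproduction process exactly once
(`tsum_childTime_childType`), so the child laws add up to the intensity (`sum_childLaw`), generation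
n contributes the n-th convolution power (`sum_birthLaw`), and summing over n gives the claim
(`meanBorn_eq`).

For the expansion, the condition on the mass at 0 makes the Neumann series of Lμ(B) converge for
large real B, so the renewal measure has transform (I - Lμ)⁻¹ for Re z ≥ B
(`laplace_renewalMeasure`) and its distribution function has transform (I - Lμ(z))⁻¹ / z. In Re z ≥
θ the only poles are the roots and, if θ ≤ 0, the point 0. The factor 1/z raises the order at 0 by
one, which is the source of the term t^{k(0)}. Subtracting the principal parts leaves a holomorphic
function (`exists_principalPart`) of size O(1/|Im z|) in a vertical strip. This decay needs |det(I -
Lμ)| bounded below: on the line by the bounded resolvent, far to the right by the limit det(I -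
μ(0)) ≠ 0, and between them, above the heights of all roots, by a Harnack inequality
(`exists_lower_bound_ball`, `exists_lower_bound_halfPlane`).

Decay 1/|Im z| is not integrable, so Fourier inversion is applied to averages over windows of length
ε. Averaging contributes a factor 1/(1 + ε|Im z|), and moving the contour to Re z = θ bounds the
averages by a multiple of e^{θt} log(1/ε) (`norm_average_le`). By monotonicity the distribution
function at t lies between its averages over [t - ε, t] and [t, t + ε], while the exponential
polynomial varies by O(e^{Bt} ε) there. The choice ε = e^{-(B-θ)t} turns the second error into
O(e^{θt}) and the logarithm into (B - θ)t, whence the factor t in the remainder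
(`isBigO_sub_expPoly`). Averaging the coefficients with their conjugates finally gives the symmetry
in λ (`leadingTerm_symm`). -/

/-! ### Contour shift and the logarithmic integral -/

/-- Integrals of a holomorphic function with quadratic decay along two vertical lines agree. -/
theorem integral_vertical_eq {Φ : ℂ → ℂ} {a b C : ℝ} (hab : a ≤ b)
    (hd : ∀ z : ℂ, a ≤ z.re → z.re ≤ b → DifferentiableAt ℂ Φ z)
    (hb : ∀ z : ℂ, a ≤ z.re → z.re ≤ b → ‖Φ z‖ ≤ C / (1 + z.im ^ 2)) :
    ∫ y : ℝ, Φ (a + y * Complex.I) = ∫ y : ℝ, Φ (b + y * Complex.I) := by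
  have hint : ∀ x : ℝ, a ≤ x → x ≤ b → Integrable fun y : ℝ => Φ (x + y * Complex.I) := by
    intro x h1 h2
    refine Integrable.mono' ((integrable_inv_one_add_sq).const_mul C) ?_ ?_
    · refine Continuous.aestronglyMeasurable ?_
      rw [continuous_iff_continuousAt]
      intro y
      have h := (hd (x + y * Complex.I) (by simpa using h1) (by simpa using h2)).continuousAt
      exact ContinuousAt.comp (f := fun y : ℝ => (x + y * Complex.I : ℂ)) h (by fun_prop)
    · refine ae_of_all _ fun y => ?_
      have := hb (x + y * Complex.I) (by simpa using h1) (by simpa using h2)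
      simpa [div_eq_mul_inv] using this
  have hC : Tendsto (fun T : ℝ => (b - a) * (C / (1 + T ^ 2))) atTop (𝓝 0) := by
    have : Tendsto (fun T : ℝ => C / (1 + T ^ 2)) atTop (𝓝 0) :=
      Tendsto.div_atTop tendsto_const_nhds
        (tendsto_atTop_add_const_left _ _ (tendsto_pow_atTop two_ne_zero))
    simpa using this.const_mul (b - a)
  have hseg : ∀ T : ℝ, ‖∫ x in a..b, Φ (x + T * Complex.I)‖ ≤ (b - a) * (C / (1 + T ^ 2)) := by
    intro T
    have := intervalIntegral.norm_integral_le_of_norm_le_const (a := a) (b := b)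
      (f := fun x : ℝ => Φ (x + T * Complex.I)) (C := C / (1 + T ^ 2)) ?_
    · rwa [abs_of_nonneg (sub_nonneg.2 hab), mul_comm _ (b - a)] at this
    · intro x hx
      rw [Set.uIoc_of_le hab] at hx
      simpa using hb (x + T * Complex.I) (by simpa using hx.1.le) (by simpa using hx.2)
  have hrect : ∀ T : ℝ, 0 ≤ T →
      (∫ y in (-T)..T, Φ (b + y * Complex.I)) - ∫ y in (-T)..T, Φ (a + y * Complex.I)
      = Complex.I * ((∫ x in a..b, Φ (x + (-T : ℝ) * Complex.I))
          - ∫ x in a..b, Φ (x + T * Complex.I)) := by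
    intro T hT
    have h := Complex.integral_boundary_rect_eq_zero_of_differentiableOn Φ
      (a + (-T : ℝ) * Complex.I) (b + T * Complex.I) (by
        intro z hz
        have h1 := hz.1
        simp only [Complex.add_re, Complex.ofReal_re, Complex.mul_re, Complex.I_re, mul_zero,
          Complex.ofReal_im, Complex.I_im, mul_one, sub_self, add_zero, Set.mem_preimage,
          Set.uIcc_of_le hab] at h1
        exact (hd z h1.1 h1.2).differentiableWithinAt)
    simp only [Complex.add_re, Complex.ofReal_re, Complex.mul_re, Complex.I_re, mul_zero,
      Complex.ofReal_im, Complex.I_im, mul_one, sub_self, add_zero, Complex.add_im,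
      Complex.mul_im, zero_add, smul_eq_mul] at h
    -- Cauchy's identity carries a factor i on the vertical sides; multiplying by -i and using i² =
    -- -1 isolates them.
    linear_combination (-Complex.I) * h +
      ((∫ y in (-T)..T, Φ (b + y * Complex.I)) - ∫ y in (-T)..T, Φ (a + y * Complex.I))
        * Complex.I_mul_I
  have hlim : ∀ x : ℝ, a ≤ x → x ≤ b →
      Tendsto (fun T : ℝ => ∫ y in (-T)..T, Φ (x + y * Complex.I)) atTop
        (𝓝 (∫ y : ℝ, Φ (x + y * Complex.I))) := fun x h1 h2 =>
    intervalIntegral_tendsto_integral (hint x h1 h2) tendsto_neg_atTop_atBot tendsto_id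
  have h1 := (hlim b hab le_rfl).sub (hlim a le_rfl hab)
  have h2 : Tendsto (fun T : ℝ => (∫ y in (-T)..T, Φ (b + y * Complex.I)) -
      ∫ y in (-T)..T, Φ (a + y * Complex.I)) atTop (𝓝 0) := by
    refine squeeze_zero_norm' ?_ (by simpa using hC.add hC)
    filter_upwards [eventually_ge_atTop 0] with T hT
    rw [hrect T hT, norm_mul, Complex.norm_I, one_mul]
    refine (norm_sub_le _ _).trans (add_le_add ?_ (hseg T))
    simpa using hseg (-T)
  exact (sub_eq_zero.1 (tendsto_nhds_unique h1 h2)).symm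

/-- `∫₀^∞ dy / ((1 + y)(1 + ε y)) = log (1/ε) / (1 - ε)`. -/
theorem integral_inv_mul_inv {ε : ℝ} (h0 : 0 < ε) (h1 : ε < 1) :
    IntegrableOn (fun y : ℝ => ((1 + y) * (1 + ε * y))⁻¹) (Set.Ioi 0) ∧
    ∫ y in Set.Ioi (0 : ℝ), ((1 + y) * (1 + ε * y))⁻¹ = (1 - ε)⁻¹ * Real.log ε⁻¹ := by
  -- An antiderivative by partial fractions, vanishing at 0.
  let A : ℝ → ℝ := fun y => (1 - ε)⁻¹ * (Real.log (1 + y) - Real.log (1 + ε * y))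
  have hd : ∀ y ∈ Set.Ici (0 : ℝ), HasDerivAt A (((1 + y) * (1 + ε * y))⁻¹) y := by
    intro y hy
    have hy : 0 ≤ y := hy
    have p1 : 0 < 1 + y := by positivity
    have p2 : 0 < 1 + ε * y := by positivity
    have p3 : 0 < 1 - ε := by linarith
    have d1 : HasDerivAt (fun y : ℝ => 1 + y) 1 y := (hasDerivAt_id y).const_add 1
    have d2 : HasDerivAt (fun y : ℝ => 1 + ε * y) (ε * 1) y :=
      ((hasDerivAt_id y).const_mul ε).const_add 1
    have d := ((d1.log p1.ne').sub (d2.log p2.ne')).const_mul (1 - ε)⁻¹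
    refine d.congr_deriv ?_
    field_simp
    ring
  have hl : Tendsto A atTop (𝓝 ((1 - ε)⁻¹ * Real.log ε⁻¹)) := by
    refine Tendsto.const_mul _ ?_
    have h2 : Tendsto (fun y : ℝ => Real.log ((1 + y) / (1 + ε * y))) atTop
        (𝓝 (Real.log ε⁻¹)) := by
      refine Tendsto.log ?_ (inv_pos.2 h0).ne'
      have : Tendsto (fun y : ℝ => (y⁻¹ + 1) / (y⁻¹ + ε)) atTop (𝓝 ((0 + 1) / (0 + ε))) :=
        (tendsto_inv_atTop_zero.add_const 1).div (tendsto_inv_atTop_zero.add_const ε)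
          (by simpa using h0.ne')
      simp only [zero_add, one_div] at this
      refine this.congr' ?_
      filter_upwards [eventually_gt_atTop 0] with y hy
      have p2 : 0 < 1 + ε * y := by positivity
      have p3 : y⁻¹ + ε = (1 + ε * y) / y := by field_simp
      have p4 : y⁻¹ + 1 = (1 + y) / y := by field_simp
      rw [p3, p4, div_div_div_cancel_right₀ hy.ne']
    refine h2.congr' ?_
    filter_upwards [eventually_gt_atTop 0] with y hy
    rw [Real.log_div (by positivity) (by positivity)]
  have hpos : ∀ y ∈ Set.Ioi (0 : ℝ), 0 ≤ ((1 + y) * (1 + ε * y))⁻¹ := by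
    intro y hy
    have hy : 0 < y := hy
    positivity
  refine ⟨integrableOn_Ioi_deriv_of_nonneg' hd hpos hl, ?_⟩
  rw [integral_Ioi_of_hasDerivAt_of_nonneg' hd hpos hl]
  simp [A]

/-- The same integral over the whole line. -/
theorem integral_inv_abs_mul_inv_abs {ε : ℝ} (h0 : 0 < ε) (h1 : ε < 1) :
    Integrable (fun y : ℝ => ((1 + |y|) * (1 + ε * |y|))⁻¹) ∧
    ∫ y : ℝ, ((1 + |y|) * (1 + ε * |y|))⁻¹ = 2 * ((1 - ε)⁻¹ * Real.log ε⁻¹) := by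
  have h : ∫ y : ℝ, ((1 + |y|) * (1 + ε * |y|))⁻¹ = 2 * ((1 - ε)⁻¹ * Real.log ε⁻¹) := by
    rw [← (integral_inv_mul_inv h0 h1).2,
      ← integral_comp_abs (f := fun y => ((1 + y) * (1 + ε * y))⁻¹)]
  -- A non-integrable function would have integral 0 by convention, so the positive value just found
  -- forces integrability.
  refine ⟨not_imp_comm.1 integral_undef ?_, h⟩
  rw [h]
  have h2 : 0 < Real.log ε⁻¹ := Real.log_pos ((one_lt_inv₀ h0).2 h1)
  have h3 : 0 < 1 - ε := by linarith
  positivity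


/-! ### Averages over short windows by Fourier inversion -/

/-- The transform `ε⁻¹ ∫₀^ε e^{zs} ds` of the uniform distribution on `[0, ε]`. -/
def unifTransform (ε : ℝ) (z : ℂ) : ℂ := dslope Complex.exp 0 (ε * z)

/-- The divided slope of exp at 0 has its removable singularity already filled in, so no case
distinction at z = 0 is needed. -/
theorem differentiable_unifTransform (ε : ℝ) : Differentiable ℂ (unifTransform ε) := by
  have h : Differentiable ℂ (dslope Complex.exp 0) := by
    rw [← differentiableOn_univ, Complex.differentiableOn_dslope univ_mem]
    exact Complex.differentiable_exp.differentiableOn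
  exact h.comp (differentiable_id.const_mul (ε : ℂ))

theorem mul_unifTransform (ε : ℝ) (z : ℂ) :
    (ε * z) * unifTransform ε z = Complex.exp (ε * z) - 1 := by
  have := sub_smul_dslope Complex.exp 0 (ε * z)
  simpa [unifTransform] using this

theorem unifTransform_eq_integral {ε : ℝ} (hε : 0 < ε) (z : ℂ) :
    unifTransform ε z = (ε : ℂ)⁻¹ * ∫ s in (0 : ℝ)..ε, Complex.exp (z * s) := by
  have hε' : (ε : ℂ) ≠ 0 := by exact_mod_cast hε.ne'
  rcases eq_or_ne z 0 with rfl | hz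
  · simp [unifTransform, hε']
  · rw [integral_exp_mul_complex hz]
    have := mul_unifTransform ε z
    simp only [Complex.ofReal_zero, mul_zero, Complex.exp_zero]
    field_simp
    linear_combination this

/-- The integral form gives the bound e^M, the closed form (e^{εz} - 1)/(εz) gives 2e^M/(ε|Im z|);
adding the two yields decay at scale 1/ε, which is what makes the inversion integral absolutely
convergent. -/
theorem norm_unifTransform_le {ε M : ℝ} (hε : 0 < ε) (hε1 : ε ≤ 1) {z : ℂ} (hz : |z.re| ≤ M) :
    ‖unifTransform ε z‖ ≤ 3 * Real.exp M / (1 + ε * |z.im|) := by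
  have hM : 0 ≤ M := (abs_nonneg _).trans hz
  have hexp : ∀ s : ℝ, 0 ≤ s → s ≤ ε → ‖Complex.exp (z * s)‖ ≤ Real.exp M := by
    intro s h0 h1
    rw [Complex.norm_exp]
    refine Real.exp_le_exp.2 ?_
    simp only [Complex.mul_re, Complex.ofReal_re, Complex.ofReal_im, mul_zero, sub_zero]
    calc z.re * s ≤ |z.re| * s := by gcongr; exact le_abs_self _
      _ ≤ M * 1 := by gcongr; linarith
      _ = M := mul_one _
  have h1 : ‖unifTransform ε z‖ ≤ Real.exp M := by
    rw [unifTransform_eq_integral hε, norm_mul, norm_inv, Complex.norm_real, Real.norm_eq_abs,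
      abs_of_pos hε]
    have := intervalIntegral.norm_integral_le_of_norm_le_const (a := 0) (b := ε)
      (f := fun s : ℝ => Complex.exp (z * s)) (C := Real.exp M) (by
        intro s hs
        rw [Set.uIoc_of_le hε.le] at hs
        exact hexp s hs.1.le hs.2)
    rw [sub_zero, abs_of_pos hε] at this
    rw [inv_mul_le_iff₀ hε, mul_comm]
    exact this
  have h2 : (ε * |z.im|) * ‖unifTransform ε z‖ ≤ 2 * Real.exp M := by
    calc (ε * |z.im|) * ‖unifTransform ε z‖ ≤ (ε * ‖z‖) * ‖unifTransform ε z‖ := by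
          gcongr; exact Complex.abs_im_le_norm z
      _ = ‖Complex.exp (z * ε) - 1‖ := by
          rw [mul_comm z, ← mul_unifTransform, norm_mul, norm_mul, Complex.norm_real,
            Real.norm_eq_abs, abs_of_pos hε]
      _ ≤ Real.exp M + 1 := (norm_sub_le _ _).trans
          (add_le_add (hexp ε hε.le le_rfl) (by simp))
      _ ≤ 2 * Real.exp M := by linarith [Real.one_le_exp hM]
  rw [le_div_iff₀ (by positivity)]
  linarith

/-- Bound for the averages over short intervals of a function whose bilateral Laplace transform on
`Re z = B` continues holomorphically to the strip `θ ≤ Re z ≤ B` with linear decay. -/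
theorem norm_average_le {G : ℝ → ℂ} {H : ℂ → ℂ} {θ B K : ℝ} (hθB : θ ≤ B)
    (hG : Integrable fun t : ℝ => Complex.exp (-(B * t)) * G t)
    (hGl : ∀ a b, IntervalIntegrable G volume a b)
    (hd : ∀ z : ℂ, θ ≤ z.re → z.re ≤ B → DifferentiableAt ℂ H z)
    (hb : ∀ z : ℂ, θ ≤ z.re → z.re ≤ B → ‖H z‖ ≤ K / (1 + |z.im|))
    (hL : ∀ z : ℂ, z.re = B → ∫ t : ℝ, Complex.exp (-(z * t)) * G t = H z) :
    ∃ K' : ℝ, ∀ ε t : ℝ, 0 < ε → ε ≤ 1 / 2 →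
      ‖(ε : ℂ)⁻¹ * ∫ x in t..(t + ε), G x‖ ≤ K' * Real.exp (θ * t) * Real.log ε⁻¹ := by
  set M := max |θ| |B| with hM
  have hK : 0 ≤ K := by
    have := (norm_nonneg _).trans (hb (θ : ℂ) (by simp) (by simpa using hθB))
    simpa using this
  -- The factor (2π)⁻¹ comes from Fourier inversion, K · 3e^M from the pointwise bound on the
  -- integrand, one 2 from the two half-lines and the other from (1 - ε)⁻¹ ≤ 2.
  refine ⟨(2 * Real.pi)⁻¹ * (K * (3 * Real.exp M)) * (2 * 2), fun ε t hε hε2 => ?_⟩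
  have hε1 : ε < 1 := by linarith
  set Φ : ℂ → ℂ := fun z => Complex.exp (z * t) * (unifTransform ε z * H z) with hΦ
  have hMz : ∀ z : ℂ, θ ≤ z.re → z.re ≤ B → |z.re| ≤ M := fun z h1 h2 => abs_le_max_abs_abs h1 h2
  have hd' : ∀ z : ℂ, θ ≤ z.re → z.re ≤ B → DifferentiableAt ℂ (fun z => unifTransform ε z * H z) z :=
    fun z h1 h2 => (differentiable_unifTransform ε z).mul (hd z h1 h2)
  have hdΦ : ∀ z : ℂ, θ ≤ z.re → z.re ≤ B → DifferentiableAt ℂ Φ z := fun z h1 h2 =>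
    DifferentiableAt.mul (by fun_prop) (hd' z h1 h2)
  have hEH : ∀ z : ℂ, θ ≤ z.re → z.re ≤ B →
      ‖unifTransform ε z * H z‖ ≤ K * (3 * Real.exp M) * ((1 + |z.im|) * (1 + ε * |z.im|))⁻¹ := by
    intro z h1 h2
    rw [norm_mul]
    refine (mul_le_mul (norm_unifTransform_le hε hε1.le (hMz z h1 h2)) (hb z h1 h2)
      (norm_nonneg _) (by positivity)).trans (le_of_eq ?_)
    field_simp
  -- A crude bound, bad in ε, that only serves to justify integrability and the contour shift; the
  -- final estimate uses `hEH`.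
  have hEH2 : ∀ z : ℂ, θ ≤ z.re → z.re ≤ B →
      ‖unifTransform ε z * H z‖ ≤ (K * (3 * Real.exp M) * ε⁻¹) / (1 + z.im ^ 2) := by
    intro z h1 h2
    refine (hEH z h1 h2).trans ?_
    rw [mul_div_assoc (K * (3 * Real.exp M))]
    gcongr
    rw [div_eq_mul_inv, ← mul_inv]
    refine inv_anti₀ (by positivity) ?_
    have := sq_abs z.im
    nlinarith [abs_nonneg z.im, mul_nonneg hε.le (abs_nonneg z.im)]
  have hΦb : ∀ z : ℂ, θ ≤ z.re → z.re ≤ B →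
      ‖Φ z‖ ≤ (Real.exp (M * |t|) * (K * (3 * Real.exp M) * ε⁻¹)) / (1 + z.im ^ 2) := by
    intro z h1 h2
    rw [hΦ, norm_mul, mul_div_assoc]
    gcongr
    · rw [Complex.norm_exp]
      refine Real.exp_le_exp.2 ?_
      simp only [Complex.mul_re, Complex.ofReal_re, Complex.ofReal_im, mul_zero, sub_zero]
      calc z.re * t ≤ |z.re * t| := le_abs_self _
        _ = |z.re| * |t| := abs_mul _ _
        _ ≤ M * |t| := by gcongr; exact hMz z h1 h2
    · exact hEH2 z h1 h2
  have hshift := integral_vertical_eq hθB hdΦ hΦb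
  -- the average is a convolution
  set g₀ : ℝ → ℂ := fun t => Complex.exp (-(B * t)) * G t with hg₀
  -- The kernel sits on (-ε, 0] because convolution evaluates at t - u, and the window is to lie
  -- ahead of t; its exponential tilt matches that of `g₀`.
  set w : ℝ → ℂ := Set.indicator (Set.Ioc (-ε) 0)
    (fun u : ℝ => (ε : ℂ)⁻¹ * Complex.exp (-(B * u))) with hw
  have hwi : Integrable w := by
    rw [hw, integrable_indicator_iff measurableSet_Ioc]
    exact (Continuous.integrableOn_Icc (by fun_prop)).mono_set Set.Ioc_subset_Icc_self
  have hconv : ∀ t : ℝ, (convolution w g₀ (ContinuousLinearMap.mul ℂ ℂ) volume) t =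
      Complex.exp (-(B * t)) * ((ε : ℂ)⁻¹ * ∫ x in t..(t + ε), G x) := by
    intro t
    have e1 : ∀ u : ℝ, (ContinuousLinearMap.mul ℂ ℂ) (w u) (g₀ (t - u)) =
        Set.indicator (Set.Ioc (-ε) 0)
          (fun u : ℝ => (Complex.exp (-(B * t)) * (ε : ℂ)⁻¹) * G (t - u)) u := by
      intro u
      by_cases hu : u ∈ Set.Ioc (-ε) 0
      · simp only [hw, hg₀, Set.indicator_of_mem hu, ContinuousLinearMap.mul_apply']
        have : Complex.exp (-(B * t)) = Complex.exp (-(B * u)) *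
            Complex.exp (-(B * ((t - u : ℝ) : ℂ))) := by
          rw [← Complex.exp_add]; congr 1; push_cast; ring
        rw [this]; ring
      · simp [hw, Set.indicator_of_notMem hu]
    rw [convolution_def]
    simp_rw [e1]
    rw [integral_indicator measurableSet_Ioc, integral_const_mul,
      ← intervalIntegral.integral_of_le (by linarith),
      intervalIntegral.integral_comp_sub_left (fun x => G x)]
    simp [mul_assoc]
  set g : ℝ → ℂ := convolution w g₀ (ContinuousLinearMap.mul ℂ ℂ) volume with hg
  have hgi : Integrable g := hwi.integrable_convolution _ hG
  -- Inversion is needed at the given point t and not merely almost everywhere, hence continuity.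
  have hgc : Continuous g := by
    have : g = fun t : ℝ => Complex.exp (-(B * t)) * ((ε : ℂ)⁻¹ *
        ((∫ x in (0 : ℝ)..(t + ε), G x) - ∫ x in (0 : ℝ)..t, G x)) := by
      funext t
      rw [hconv t, intervalIntegral.integral_interval_sub_left (hGl _ _) (hGl _ _)]
    rw [this]
    have hp : Continuous fun t : ℝ => ∫ x in (0 : ℝ)..t, G x :=
      intervalIntegral.continuous_primitive hGl 0
    have hp' : Continuous fun t : ℝ => ∫ x in (0 : ℝ)..(t + ε), G x := hp.comp (by fun_prop)
    fun_prop
  have hF₀ : ∀ ξ : ℝ, FourierTransform.fourier g₀ ξ = H (B + (2 * Real.pi * ξ : ℝ) * Complex.I) := by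
    intro ξ
    rw [Real.fourier_real_eq_integral_exp_smul, ← hL _ (by simp)]
    refine integral_congr_ae (ae_of_all _ fun v => ?_)
    simp only [hg₀, smul_eq_mul]
    rw [← mul_assoc, ← Complex.exp_add]
    congr 2
    push_cast; ring
  have hFw : ∀ ξ : ℝ, FourierTransform.fourier w ξ =
      unifTransform ε (B + (2 * Real.pi * ξ : ℝ) * Complex.I) := by
    intro ξ
    rw [Real.fourier_real_eq_integral_exp_smul, unifTransform_eq_integral hε]
    have e1 : ∀ v : ℝ, Complex.exp (↑(-2 * Real.pi * v * ξ) * Complex.I) • w v =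
        Set.indicator (Set.Ioc (-ε) 0) (fun v : ℝ => (ε : ℂ)⁻¹ *
          Complex.exp ((B + (2 * Real.pi * ξ : ℝ) * Complex.I) * ((0 - v : ℝ) : ℂ))) v := by
      intro v
      by_cases hu : v ∈ Set.Ioc (-ε) 0
      · simp only [hw, Set.indicator_of_mem hu, smul_eq_mul]
        rw [mul_left_comm, ← Complex.exp_add]
        congr 2
        push_cast; ring
      · simp [hw, Set.indicator_of_notMem hu]
    simp_rw [e1]
    rw [integral_indicator measurableSet_Ioc, integral_const_mul,
      ← intervalIntegral.integral_of_le (by linarith),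
      intervalIntegral.integral_comp_sub_left
        (fun x : ℝ => Complex.exp ((B + (2 * Real.pi * ξ : ℝ) * Complex.I) * (x : ℂ)))]
    simp
  have hFg : ∀ ξ : ℝ, FourierTransform.fourier g ξ =
      unifTransform ε (B + (2 * Real.pi * ξ : ℝ) * Complex.I) *
        H (B + (2 * Real.pi * ξ : ℝ) * Complex.I) := by
    intro ξ
    rw [hg, Real.fourier_mul_convolution_eq hwi hG, hF₀, hFw]
  have hline : ∀ x : ℝ, θ ≤ x → x ≤ B → ∀ f : ℂ → ℂ,
      (∀ z : ℂ, θ ≤ z.re → z.re ≤ B → DifferentiableAt ℂ f z) →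
      Continuous fun y : ℝ => f (x + y * Complex.I) := by
    intro x h1 h2 f hf
    rw [continuous_iff_continuousAt]
    intro y
    exact ContinuousAt.comp (f := fun y : ℝ => (x + y * Complex.I : ℂ))
      (hf (x + y * Complex.I) (by simpa using h1) (by simpa using h2)).continuousAt (by fun_prop)
  have hFgi : Integrable (FourierTransform.fourier g) := by
    have : Integrable fun y : ℝ => unifTransform ε (B + y * Complex.I) * H (B + y * Complex.I) := by
      refine Integrable.mono' ((integrable_inv_one_add_sq).const_mul (K * (3 * Real.exp M) * ε⁻¹))
        (hline B hθB le_rfl _ hd').aestronglyMeasurable (ae_of_all _ fun y => ?_)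
      have := hEH2 (B + y * Complex.I) (by simpa using hθB) (by simp)
      simpa [div_eq_mul_inv] using this
    have h2 := this.comp_mul_left' (R := 2 * Real.pi) (by positivity)
    refine h2.congr (ae_of_all _ fun ξ => ?_)
    simp only [hFg]
  have hinv := hgi.fourierInv_fourier_eq hFgi (v := t) hgc.continuousAt
  have hval : (ε : ℂ)⁻¹ * ∫ x in t..(t + ε), G x =
      ((2 * Real.pi)⁻¹ : ℝ) • ∫ y : ℝ, Φ (B + y * Complex.I) := by
    have e2 : ∫ ξ : ℝ, Φ (B + (2 * Real.pi * ξ : ℝ) * Complex.I) =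
        ((2 * Real.pi)⁻¹ : ℝ) • ∫ y : ℝ, Φ (B + y * Complex.I) := by
      rw [Measure.integral_comp_mul_left (fun y : ℝ => Φ (B + y * Complex.I)) (2 * Real.pi),
        abs_of_pos (by positivity)]
    rw [← e2]
    have e3 : (ε : ℂ)⁻¹ * ∫ x in t..(t + ε), G x = Complex.exp (B * t) * g t := by
      rw [hconv t, ← mul_assoc, ← Complex.exp_add]
      simp
    rw [e3, ← hinv, Real.fourierInv_eq', ← integral_const_mul]
    refine integral_congr_ae (ae_of_all _ fun ξ => ?_)
    simp only [hFg, hΦ, smul_eq_mul]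
    rw [← mul_assoc, ← Complex.exp_add]
    congr 2
    simp
    ring
  -- On the line Re z = θ the factor e^{zt} has modulus e^{θt}.
  rw [hval, ← hshift, norm_smul, Real.norm_eq_abs, abs_of_pos (by positivity)]
  obtain ⟨i1, i2⟩ := integral_inv_abs_mul_inv_abs hε hε1
  have hfin : ‖∫ y : ℝ, Φ (θ + y * Complex.I)‖ ≤
      ∫ y : ℝ, (Real.exp (θ * t) * (K * (3 * Real.exp M))) *
        ((1 + |y|) * (1 + ε * |y|))⁻¹ := by
    refine norm_integral_le_of_norm_le (i1.const_mul _) (ae_of_all _ fun y => ?_)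
    have := hEH (θ + y * Complex.I) (by simp) (by simpa using hθB)
    rw [hΦ, norm_mul, Complex.norm_exp, mul_assoc (Real.exp (θ * t))]
    refine mul_le_mul (by simp) (by simpa using this) (norm_nonneg _) (by positivity)
  rw [integral_const_mul, i2] at hfin
  have hlog : 0 ≤ Real.log ε⁻¹ := Real.log_nonneg ((one_le_inv₀ hε).2 hε1.le)
  have hinv2 : (1 - ε)⁻¹ ≤ 2 := by
    rw [inv_le_comm₀ (by linarith) (by norm_num)]; linarith
  calc (2 * Real.pi)⁻¹ * ‖∫ y : ℝ, Φ (θ + y * Complex.I)‖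
      ≤ (2 * Real.pi)⁻¹ * (Real.exp (θ * t) * (K * (3 * Real.exp M)) *
        (2 * (2 * Real.log ε⁻¹))) := by
          gcongr
          refine hfin.trans ?_
          gcongr
    _ = _ := by ring


/-! ### Exponential polynomials and their Laplace transforms -/

/-- This is y^k/k! ≤ e^y at y = (B - σ)x: any gap between the exponents absorbs a power of x. -/
theorem pow_mul_exp_le {σ B x : ℝ} (hσ : σ < B) (hx : 0 ≤ x) (k : ℕ) :
    x ^ k * Real.exp (σ * x) ≤ (k.factorial / (B - σ) ^ k) * Real.exp (B * x) := by
  have hδ : 0 < B - σ := sub_pos.2 hσ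
  have h := Real.pow_div_factorial_le_exp ((B - σ) * x) (by positivity) k
  have e : Real.exp (B * x) = Real.exp ((B - σ) * x) * Real.exp (σ * x) := by
    rw [← Real.exp_add]; congr 1; ring
  rw [e, ← mul_assoc]
  gcongr
  rw [div_le_iff₀ (by positivity), mul_pow] at h
  rw [div_mul_eq_mul_div, le_div_iff₀ (by positivity)]
  linarith

theorem norm_pow_mul_exp_neg_le {w : ℂ} (hw : 0 < w.re) (k : ℕ) {t : ℝ} (ht : 0 ≤ t) :
    ‖(t : ℂ) ^ k * Complex.exp (-w * t)‖ ≤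
      (k.factorial / (w.re / 2) ^ k) * Real.exp (-(w.re / 2) * t) := by
  have := pow_mul_exp_le (σ := -w.re) (B := -(w.re / 2)) (by linarith) ht k
  rw [norm_mul, norm_pow, Complex.norm_real, Real.norm_eq_abs, abs_of_nonneg ht, Complex.norm_exp]
  convert this using 2
  · simp
  · congr 2; ring

theorem integrableOn_pow_mul_exp_neg {w : ℂ} (hw : 0 < w.re) (k : ℕ) :
    IntegrableOn (fun t : ℝ => (t : ℂ) ^ k * Complex.exp (-w * t)) (Set.Ioi 0) := by
  refine Integrable.mono' ((exp_neg_integrableOn_Ioi 0 (half_pos hw)).const_mul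
    (k.factorial / (w.re / 2) ^ k)) (by fun_prop) ?_
  filter_upwards [ae_restrict_mem measurableSet_Ioi] with t ht
  exact norm_pow_mul_exp_neg_le hw k (le_of_lt ht)

/-- The derivative of t^{k+1} e^{-wt} integrates to 0 over (0, ∞), which gives the recursion with
factor (k + 1)/w. -/
theorem integral_pow_mul_exp_neg {w : ℂ} (hw : 0 < w.re) (k : ℕ) :
    ∫ t : ℝ in Set.Ioi 0, (t : ℂ) ^ k * Complex.exp (-w * t) = k.factorial / w ^ (k + 1) := by
  have hw0 : w ≠ 0 := fun h => by simp [h] at hw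
  induction k with
  | zero =>
    have := integral_exp_mul_complex_Ioi (a := -w) (by simpa using hw) 0
    simp only [pow_zero, one_mul]
    rw [this]
    simp
  | succ k ih =>
    have hder : ∀ t ∈ Set.Ici (0 : ℝ), HasDerivAt
        (fun t : ℝ => (t : ℂ) ^ (k + 1) * Complex.exp (-w * t))
        ((k + 1 : ℂ) * ((t : ℂ) ^ k * Complex.exp (-w * t)) -
          w * ((t : ℂ) ^ (k + 1) * Complex.exp (-w * t))) t := by
      intro t _
      have h1 : HasDerivAt (fun z : ℂ => z ^ (k + 1) * Complex.exp (-w * z))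
        ((((k + 1 : ℕ) : ℂ) * (t : ℂ) ^ k) * Complex.exp (-w * t) +
          (t : ℂ) ^ (k + 1) * (Complex.exp (-w * t) * (-w * 1))) (t : ℂ) :=
        (hasDerivAt_pow (k + 1) (t : ℂ)).mul (((hasDerivAt_id (t : ℂ)).const_mul (-w)).cexp)
      refine h1.comp_ofReal.congr_deriv ?_
      push_cast
      ring
    have hint : IntegrableOn (fun t : ℝ => (k + 1 : ℂ) * ((t : ℂ) ^ k * Complex.exp (-w * t)) -
          w * ((t : ℂ) ^ (k + 1) * Complex.exp (-w * t))) (Set.Ioi 0) :=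
      ((integrableOn_pow_mul_exp_neg hw k).const_mul _).sub
        ((integrableOn_pow_mul_exp_neg hw (k + 1)).const_mul _)
    have hlim : Tendsto (fun t : ℝ => (t : ℂ) ^ (k + 1) * Complex.exp (-w * t)) atTop (𝓝 0) := by
      refine squeeze_zero_norm' (a := fun t : ℝ => ((k + 1).factorial / (w.re / 2) ^ (k + 1)) *
        Real.exp (-(w.re / 2) * t)) ?_ ?_
      · filter_upwards [eventually_ge_atTop 0] with t ht
        exact norm_pow_mul_exp_neg_le hw (k + 1) ht
      · have : Tendsto (fun t : ℝ => Real.exp (-(w.re / 2) * t)) atTop (𝓝 0) :=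
          Real.tendsto_exp_atBot.comp
            (tendsto_id.const_mul_atTop_of_neg (by linarith))
        simpa using this.const_mul (((k + 1).factorial : ℝ) / (w.re / 2) ^ (k + 1))
    have h := integral_Ioi_of_hasDerivAt_of_tendsto' hder hint hlim
    rw [integral_sub ((integrableOn_pow_mul_exp_neg hw k).const_mul _)
        ((integrableOn_pow_mul_exp_neg hw (k + 1)).const_mul _),
      integral_const_mul, integral_const_mul, ih] at h
    simp only [Complex.ofReal_zero, ne_eq, Nat.add_eq_zero_iff, one_ne_zero, and_false,
      not_false_eq_true, zero_pow, zero_mul, sub_zero] at h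
    rw [sub_eq_zero] at h
    rw [← mul_right_inj' hw0, ← h, Nat.factorial_succ]
    push_cast
    field_simp
    ring

theorem integral_pow_mul_exp_Ioi {z s : ℂ} (h : s.re < z.re) (k : ℕ) :
    IntegrableOn (fun t : ℝ => Complex.exp (-(z * t)) * ((t : ℂ) ^ k * Complex.exp (s * t)))
      (Set.Ioi 0) ∧
    ∫ t : ℝ in Set.Ioi 0, Complex.exp (-(z * t)) * ((t : ℂ) ^ k * Complex.exp (s * t)) =
      k.factorial / (z - s) ^ (k + 1) := by
  have hr : 0 < (z - s).re := by simpa using h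
  have e : ∀ t : ℝ, Complex.exp (-(z * t)) * ((t : ℂ) ^ k * Complex.exp (s * t)) =
      (t : ℂ) ^ k * Complex.exp (-(z - s) * t) := by
    intro t
    rw [mul_left_comm, ← Complex.exp_add]
    congr 2; ring
  simp_rw [e]
  exact ⟨integrableOn_pow_mul_exp_neg hr k, integral_pow_mul_exp_neg hr k⟩

/-- Lipschitz bound for exponential polynomials on intervals of length at most one. -/
theorem exists_lipschitz_pow_mul_exp {s : ℂ} {B : ℝ} (hs : s.re < B) (k : ℕ) :
    ∃ C : ℝ, ∀ x y : ℝ, 0 ≤ x → x ≤ y → y ≤ x + 1 →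
      ‖(y : ℂ) ^ k * Complex.exp (s * y) - (x : ℂ) ^ k * Complex.exp (s * x)‖
        ≤ C * Real.exp (B * y) * (y - x) := by
  -- The two summands bound the two terms of the derivative of u^k e^{su}. At k = 0 the truncated
  -- exponent k - 1 is harmless because of the leading factor k.
  set D : ℝ := k * ((k - 1).factorial / (B - s.re) ^ (k - 1)) +
    ‖s‖ * (k.factorial / (B - s.re) ^ k) with hD
  have hδ : 0 < B - s.re := sub_pos.2 hs
  have hD0 : 0 ≤ D := by positivity
  refine ⟨D * Real.exp |B|, fun x y hx hxy hy1 => ?_⟩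
  have hder : ∀ u ∈ Set.Icc x y, HasDerivWithinAt
      (fun u : ℝ => (u : ℂ) ^ k * Complex.exp (s * u))
      ((k * (u : ℂ) ^ (k - 1)) * Complex.exp (s * u) +
        (u : ℂ) ^ k * (Complex.exp (s * u) * s)) (Set.Icc x y) u := by
    intro u _
    have h1 : HasDerivAt (fun z : ℂ => z ^ k * Complex.exp (s * z))
      ((k * (u : ℂ) ^ (k - 1)) * Complex.exp (s * u) +
        (u : ℂ) ^ k * (Complex.exp (s * u) * s)) (u : ℂ) := by
      have := (hasDerivAt_pow k (u : ℂ)).mul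
        (((hasDerivAt_id (u : ℂ)).const_mul s).cexp)
      refine this.congr_deriv ?_
      simp
    exact h1.comp_ofReal.hasDerivWithinAt
  have hbd : ∀ u ∈ Set.Icc x y, ‖(k * (u : ℂ) ^ (k - 1)) * Complex.exp (s * u) +
        (u : ℂ) ^ k * (Complex.exp (s * u) * s)‖ ≤ D * Real.exp |B| * Real.exp (B * y) := by
    intro u hu
    have hu0 : 0 ≤ u := hx.trans hu.1
    have hn : ‖Complex.exp (s * u)‖ = Real.exp (s.re * u) := by simp [Complex.norm_exp]
    have hun : ‖(u : ℂ)‖ = u := by simp [abs_of_nonneg hu0]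
    have hB : Real.exp (B * u) ≤ Real.exp |B| * Real.exp (B * y) := by
      rw [← Real.exp_add]
      refine Real.exp_le_exp.2 ?_
      have : B * (u - y) ≤ |B| * 1 := by
        refine (le_abs_self _).trans ?_
        rw [abs_mul]
        gcongr
        rw [abs_le]; constructor <;> linarith [hu.1, hu.2]
      linarith
    calc _ ≤ k * (u ^ (k - 1) * Real.exp (s.re * u)) +
          ‖s‖ * (u ^ k * Real.exp (s.re * u)) := by
          refine (norm_add_le _ _).trans (le_of_eq ?_)
          simp only [norm_mul, norm_pow, hn, hun, Complex.norm_natCast]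
          ring
      _ ≤ k * (((k - 1).factorial / (B - s.re) ^ (k - 1)) * Real.exp (B * u)) +
          ‖s‖ * ((k.factorial / (B - s.re) ^ k) * Real.exp (B * u)) := by
          exact add_le_add
            (mul_le_mul_of_nonneg_left (pow_mul_exp_le hs hu0 _) (by positivity))
            (mul_le_mul_of_nonneg_left (pow_mul_exp_le hs hu0 _) (by positivity))
      _ = D * Real.exp (B * u) := by rw [hD]; ring
      _ ≤ D * (Real.exp |B| * Real.exp (B * y)) := by gcongr
      _ = _ := by ring
  have := (convex_Icc x y).norm_image_sub_le_of_norm_hasDerivWithin_le hder hbd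
    (Set.left_mem_Icc.2 hxy) (Set.right_mem_Icc.2 hxy)
  rwa [Real.norm_eq_abs, abs_of_nonneg (sub_nonneg.2 hxy)] at this

/-- The exponential polynomial `∑ₛ ∑ₖ c_{s,k} t^k e^{st} / k!`. -/
def expPoly (S : Finset ℂ) (n : ℂ → ℕ) (c : ℂ → ℕ → ℂ) (t : ℝ) : ℂ :=
  ∑ s ∈ S, ∑ k ∈ Finset.range (n s), (c s k / k.factorial) * ((t : ℂ) ^ k * Complex.exp (s * t))

theorem continuous_expPoly (S : Finset ℂ) (n : ℂ → ℕ) (c : ℂ → ℕ → ℂ) :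
    Continuous (expPoly S n c) := by
  unfold expPoly
  fun_prop

/-- The factor 1/k! in `expPoly` cancels the k! of the Gamma integral, so the coefficients of
principal parts in z are directly the coefficients `c`. -/
theorem integral_expPoly {S : Finset ℂ} {n : ℂ → ℕ} {c : ℂ → ℕ → ℂ} {z : ℂ}
    (hS : ∀ s ∈ S, s.re < z.re) :
    IntegrableOn (fun t : ℝ => Complex.exp (-(z * t)) * expPoly S n c t) (Set.Ioi 0) ∧
    ∫ t : ℝ in Set.Ioi 0, Complex.exp (-(z * t)) * expPoly S n c t =
      ∑ s ∈ S, ∑ k ∈ Finset.range (n s), c s k / (z - s) ^ (k + 1) := by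
  have e : ∀ t : ℝ, Complex.exp (-(z * t)) * expPoly S n c t = ∑ s ∈ S,
      ∑ k ∈ Finset.range (n s), (c s k / k.factorial) *
        (Complex.exp (-(z * t)) * ((t : ℂ) ^ k * Complex.exp (s * t))) := by
    intro t
    simp only [expPoly, Finset.mul_sum]
    refine Finset.sum_congr rfl fun s _ => Finset.sum_congr rfl fun k _ => ?_
    ring
  simp_rw [e]
  have hi : ∀ s ∈ S, ∀ k ∈ Finset.range (n s), IntegrableOn (fun t : ℝ => (c s k / k.factorial) *
        (Complex.exp (-(z * t)) * ((t : ℂ) ^ k * Complex.exp (s * t)))) (Set.Ioi 0) :=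
    fun s hs k _ => (integral_pow_mul_exp_Ioi (hS s hs) k).1.const_mul _
  refine ⟨integrable_finsetSum _ fun s hs => integrable_finsetSum _ (hi s hs), ?_⟩
  rw [integral_finsetSum _ fun s hs => integrable_finsetSum _ (hi s hs)]
  refine Finset.sum_congr rfl fun s hs => ?_
  rw [integral_finsetSum _ (hi s hs)]
  refine Finset.sum_congr rfl fun k _ => ?_
  rw [integral_const_mul, (integral_pow_mul_exp_Ioi (hS s hs) k).2]
  have : (k.factorial : ℂ) ≠ 0 := by exact_mod_cast Nat.factorial_ne_zero k
  field_simp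

theorem exists_lipschitz_expPoly {S : Finset ℂ} {n : ℂ → ℕ} {c : ℂ → ℕ → ℂ} {B : ℝ}
    (hS : ∀ s ∈ S, s.re < B) :
    ∃ C : ℝ, 0 ≤ C ∧ ∀ x y : ℝ, 0 ≤ x → x ≤ y → y ≤ x + 1 →
      ‖expPoly S n c y - expPoly S n c x‖ ≤ C * Real.exp (B * y) * (y - x) := by
  have h : ∀ s : ℂ, ∀ k : ℕ, ∃ C : ℝ, s ∈ S → ∀ x y : ℝ, 0 ≤ x → x ≤ y → y ≤ x + 1 →
      ‖(y : ℂ) ^ k * Complex.exp (s * y) - (x : ℂ) ^ k * Complex.exp (s * x)‖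
        ≤ C * Real.exp (B * y) * (y - x) := by
    intro s k
    by_cases hs : s ∈ S
    · obtain ⟨C, hC⟩ := exists_lipschitz_pow_mul_exp (hS s hs) k
      exact ⟨C, fun _ => hC⟩
    · exact ⟨0, fun h => absurd h hs⟩
  choose C hC using h
  refine ⟨∑ s ∈ S, ∑ k ∈ Finset.range (n s), ‖c s k / k.factorial‖ * |C s k|,
    by positivity, fun x y hx hxy hy => ?_⟩
  simp only [expPoly, ← Finset.sum_sub_distrib, ← mul_sub, Finset.sum_mul]
  refine (norm_sum_le _ _).trans (Finset.sum_le_sum fun s hs => (norm_sum_le _ _).trans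
    (Finset.sum_le_sum fun k _ => ?_))
  rw [norm_mul, mul_assoc, mul_assoc]
  gcongr
  refine (hC s k hs x y hx hxy hy).trans ?_
  rw [mul_assoc]
  have : 0 ≤ y - x := sub_nonneg.2 hxy
  gcongr
  exact le_abs_self _


/-- The average of `expPoly` over a short interval. -/
theorem norm_average_expPoly_sub_le {S : Finset ℂ} {n : ℂ → ℕ} {c : ℂ → ℕ → ℂ} {t ε D : ℝ}
    {a : ℝ} (hε : 0 < ε)
    (h : ∀ x ∈ Set.Icc a (a + ε), ‖expPoly S n c x - expPoly S n c t‖ ≤ D) :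
    ‖(ε : ℂ)⁻¹ * (∫ x in a..(a + ε), expPoly S n c x) - expPoly S n c t‖ ≤ D := by
  have e : (ε : ℂ)⁻¹ * (∫ x in a..(a + ε), expPoly S n c x) - expPoly S n c t =
      (ε : ℂ)⁻¹ * ∫ x in a..(a + ε), (expPoly S n c x - expPoly S n c t) := by
    rw [intervalIntegral.integral_sub ((continuous_expPoly S n c).intervalIntegrable _ _)
      (by simp), intervalIntegral.integral_const]
    have : (ε : ℂ) ≠ 0 := by exact_mod_cast hε.ne'
    simp only [add_sub_cancel_left, Complex.real_smul]
    field_simp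
  rw [e, norm_mul, norm_inv, Complex.norm_real, Real.norm_eq_abs, abs_of_pos hε,
    inv_mul_le_iff₀ hε, mul_comm]
  have := intervalIntegral.norm_integral_le_of_norm_le_const (a := a) (b := a + ε)
    (f := fun x => expPoly S n c x - expPoly S n c t) (C := D) (by
      intro x hx
      rw [Set.uIoc_of_le (by linarith)] at hx
      exact h x ⟨hx.1.le, hx.2⟩)
  simpa [abs_of_pos hε] using this

/-! ### The Tauberian theorem -/

/-- A Tauberian theorem: if the Laplace transform of a monotone function `f` on `[0, ∞)`, minus
finitely many principal parts, continues holomorphically to the strip `θ ≤ Re z ≤ B` with linear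
decay, then `f` is an exponential polynomial up to `O(t e^{θ t})`. -/
theorem isBigO_sub_expPoly {f : ℝ → ℝ} (hf0 : ∀ t < 0, f t = 0) (hfm : Monotone f)
    {S : Finset ℂ} {n : ℂ → ℕ} {c : ℂ → ℕ → ℂ} {H : ℂ → ℂ} {θ B K : ℝ} (hθB : θ < B)
    (hS : ∀ s ∈ S, s.re < B)
    (hfi : Integrable fun t : ℝ => Real.exp (-(B * t)) * f t)
    (hd : ∀ z : ℂ, θ ≤ z.re → z.re ≤ B → DifferentiableAt ℂ H z)
    (hb : ∀ z : ℂ, θ ≤ z.re → z.re ≤ B → ‖H z‖ ≤ K / (1 + |z.im|))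
    (hL : ∀ z : ℂ, z.re = B → ∫ t : ℝ, Complex.exp (-(z * t)) * f t =
      H z + ∑ s ∈ S, ∑ k ∈ Finset.range (n s), c s k / (z - s) ^ (k + 1)) :
    (fun t : ℝ => (f t : ℂ) - expPoly S n c t) =O[atTop] fun t : ℝ => t * Real.exp (θ * t) := by
  set m := expPoly S n c with hm
  -- The exponential polynomial is cut off to (0, ∞) so that its bilateral transform is the sum of
  -- principal parts; what remains has transform `H`.
  set G : ℝ → ℂ := fun t => (f t : ℂ) - Set.indicator (Set.Ioi 0) m t with hGdef
  have hind : ∀ z : ℂ, ∀ t : ℝ, Complex.exp (-(z * t)) * Set.indicator (Set.Ioi 0) m t =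
      Set.indicator (Set.Ioi 0) (fun t : ℝ => Complex.exp (-(z * t)) * m t) t := by
    intro z t
    by_cases ht : t ∈ Set.Ioi (0 : ℝ)
    · simp [Set.indicator_of_mem ht]
    · simp [Set.indicator_of_notMem ht]
  have hzi : ∀ z : ℂ, z.re = B → Integrable fun t : ℝ => Complex.exp (-(z * t)) * f t := by
    intro z hz
    refine hfi.mono' ?_ (ae_of_all _ fun t => ?_)
    · have : AEStronglyMeasurable (fun t => (f t : ℂ)) volume :=
        (Complex.measurable_ofReal.comp hfm.measurable).aestronglyMeasurable
      exact (Continuous.aestronglyMeasurable (by fun_prop)).mul this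
    · have hfn : 0 ≤ f t := by
        by_cases ht : t < 0
        · rw [hf0 t ht]
        · have := hfm (show (-1 : ℝ) ≤ t by linarith)
          rwa [hf0 (-1) (by norm_num)] at this
      rw [norm_mul, Complex.norm_exp, Complex.norm_real, Real.norm_eq_abs, abs_of_nonneg hfn]
      simp [hz]
  have hzm : ∀ z : ℂ, z.re = B →
      Integrable fun t : ℝ => Complex.exp (-(z * t)) * Set.indicator (Set.Ioi 0) m t := by
    intro z hz
    simp_rw [hind]
    rw [integrable_indicator_iff measurableSet_Ioi]
    exact (integral_expPoly fun s hs => by rw [hz]; exact hS s hs).1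
  have hGl : ∀ a b, IntervalIntegrable G volume a b := by
    intro a b
    have h1 : IntervalIntegrable (fun t => (f t : ℂ)) volume a b :=
      ⟨(hfm.intervalIntegrable (a := a) (b := b)).1.ofReal,
        (hfm.intervalIntegrable (a := a) (b := b)).2.ofReal⟩
    refine h1.sub ?_
    rw [intervalIntegrable_iff]
    exact ((intervalIntegrable_iff.1
      ((continuous_expPoly S n c).intervalIntegrable a b))).indicator measurableSet_Ioi
  obtain ⟨K', hK'⟩ := norm_average_le (G := G) (H := H) hθB.le
    (((hzi B (by simp)).sub (hzm B (by simp))).congr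
      (ae_of_all _ fun t => by simp [hGdef, mul_sub])) hGl hd hb (by
      intro z hz
      have : ∀ t : ℝ, Complex.exp (-(z * t)) * G t = Complex.exp (-(z * t)) * f t -
          Complex.exp (-(z * t)) * Set.indicator (Set.Ioi 0) m t := fun t => mul_sub _ _ _
      simp_rw [this]
      rw [integral_sub (hzi z hz) (hzm z hz), hL z hz]
      simp_rw [hind]
      rw [integral_indicator measurableSet_Ioi,
        (integral_expPoly fun s hs => by rw [hz]; exact hS s hs).2]
      ring)
  obtain ⟨C, hC0, hC⟩ := exists_lipschitz_expPoly (n := n) (c := c) hS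
  -- The window length will be e^{-κt}: then log(1/ε) = κt and e^{Bt} ε = e^{θt}, so both errors
  -- stay within t e^{θt}.
  set κ := B - θ with hκ
  have hκ0 : 0 < κ := sub_pos.2 hθB
  set D := |K'| * Real.exp |θ| * κ + C * Real.exp |B| with hDdef
  -- averages over intervals adjacent to `t`
  have key : ∀ t ε a : ℝ, 1 ≤ t → ε = Real.exp (-(κ * t)) → ε ≤ 1 / 2 → a ≤ t → t ≤ a + ε →
      ‖(((ε⁻¹ * ∫ x in a..(a + ε), f x : ℝ)) : ℂ) - m t‖ ≤ D * (t * Real.exp (θ * t)) := by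
    intro t ε a ht hεdef hε2 ha1 ha2
    have hε : 0 < ε := by rw [hεdef]; exact Real.exp_pos _
    -- From t ≥ 1 and ε ≤ 1/2: the window stays in the region where the cut-off is inactive.
    have ha0 : 0 < a := by linarith
    have hlog : Real.log ε⁻¹ = κ * t := by rw [hεdef, Real.log_inv, Real.log_exp, neg_neg]
    have e1 : (((ε⁻¹ * ∫ x in a..(a + ε), f x : ℝ)) : ℂ) = (ε : ℂ)⁻¹ * (∫ x in a..(a + ε), G x) +
        (ε : ℂ)⁻¹ * (∫ x in a..(a + ε), m x) := by
      rw [← mul_add, ← intervalIntegral.integral_add (hGl _ _)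
        ((continuous_expPoly S n c).intervalIntegrable _ _)]
      push_cast
      rw [← intervalIntegral.integral_ofReal]
      congr 1
      refine intervalIntegral.integral_congr fun x hx => ?_
      rw [Set.uIcc_of_le (by linarith)] at hx
      have : x ∈ Set.Ioi (0 : ℝ) := lt_of_lt_of_le ha0 hx.1
      simp [hGdef, Set.indicator_of_mem this, ← hm]
    have b1 : ‖(ε : ℂ)⁻¹ * (∫ x in a..(a + ε), G x)‖ ≤
        |K'| * Real.exp |θ| * κ * (t * Real.exp (θ * t)) := by
      refine (hK' ε a hε hε2).trans ?_
      rw [hlog]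
      have h3 : Real.exp (θ * a) ≤ Real.exp |θ| * Real.exp (θ * t) := by
        rw [← Real.exp_add]
        refine Real.exp_le_exp.2 ?_
        have : θ * (a - t) ≤ |θ| * 1 := by
          refine (le_abs_self _).trans ?_
          rw [abs_mul]
          gcongr
          rw [abs_le]; constructor <;> linarith
        linarith
      calc K' * Real.exp (θ * a) * (κ * t)
          ≤ |K'| * (Real.exp |θ| * Real.exp (θ * t)) * (κ * t) := by
            gcongr
            exact le_abs_self _
        _ = _ := by ring
    have b2 : ‖(ε : ℂ)⁻¹ * (∫ x in a..(a + ε), m x) - m t‖ ≤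
        C * Real.exp |B| * (t * Real.exp (θ * t)) := by
      refine norm_average_expPoly_sub_le hε fun x hx => ?_
      have h4 : Real.exp (B * t) * ε = Real.exp (θ * t) := by
        rw [hεdef, ← Real.exp_add]; congr 1; rw [hκ]; ring
      have h5 : ∀ y : ℝ, y ≤ t + ε → t ≤ y → Real.exp (B * y) * ε ≤
          Real.exp |B| * Real.exp (θ * t) := by
        intro y hy1 hy2
        rw [← h4, ← mul_assoc, ← Real.exp_add]
        gcongr
        have : B * (y - t) ≤ |B| * 1 := by
          refine (le_abs_self _).trans ?_
          rw [abs_mul]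
          gcongr
          rw [abs_le]; constructor <;> linarith
        linarith
      have h6 : ∀ x y : ℝ, 0 ≤ x → x ≤ y → y ≤ x + ε → y ≤ t + ε → t ≤ y →
          ‖m y - m x‖ ≤ C * Real.exp |B| * (t * Real.exp (θ * t)) := by
        intro x y h1 h2 h3 h4' h5'
        refine (hC x y h1 h2 (by linarith)).trans ?_
        calc C * Real.exp (B * y) * (y - x) ≤ C * Real.exp (B * y) * ε := by
              gcongr; linarith
          _ = C * (Real.exp (B * y) * ε) := by ring
          _ ≤ C * (Real.exp |B| * Real.exp (θ * t)) := 
              mul_le_mul_of_nonneg_left (h5 y h4' h5') hC0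
          _ = C * Real.exp |B| * (1 * Real.exp (θ * t)) := by ring
          _ ≤ _ := by gcongr
      rcases le_total x t with hxt | hxt
      · rw [norm_sub_rev]
        exact h6 x t (by linarith [hx.1]) hxt (by linarith [hx.1]) (by linarith) le_rfl
      · exact h6 t x (by linarith) hxt (by linarith [hx.2]) (by linarith [hx.2]) hxt
    rw [e1, add_sub_assoc]
    refine (norm_add_le _ _).trans ((add_le_add b1 b2).trans (le_of_eq ?_))
    rw [hDdef]; ring
  -- The two averages differ by at most 2D t e^{θt} and enclose f(t); the distance of the lower one
  -- from the exponential polynomial costs another D.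
  refine IsBigO.of_bound (3 * D) ?_
  filter_upwards [eventually_ge_atTop (1 : ℝ), eventually_ge_atTop (Real.log 2 / κ)] with t ht ht2
  set ε := Real.exp (-(κ * t)) with hεdef
  have hε : 0 < ε := Real.exp_pos _
  have hε2 : ε ≤ 1 / 2 := by
    rw [div_le_iff₀ hκ0] at ht2
    rw [hεdef, Real.exp_neg, one_div]
    refine inv_anti₀ (by norm_num) ?_
    rw [← Real.log_le_iff_le_exp (by norm_num)]
    linarith
  have k1 := key t ε t ht rfl hε2 le_rfl (by linarith)
  have k2 := key t ε (t - ε) ht rfl hε2 (by linarith) (by linarith)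
  rw [sub_add_cancel] at k2
  set A₁ := ε⁻¹ * ∫ x in t..(t + ε), f x
  set A₂ := ε⁻¹ * ∫ x in (t - ε)..t, f x
  have u1 : f t ≤ A₁ := by
    change f t ≤ ε⁻¹ * _
    rw [← div_eq_inv_mul, le_div_iff₀ hε]
    have := intervalIntegral.integral_mono_on (f := fun _ => f t) (g := f) (a := t) (b := t + ε)
      (μ := volume) (by linarith) (by simp) hfm.intervalIntegrable (fun x hx => hfm hx.1)
    simpa [mul_comm] using this
  have u2 : A₂ ≤ f t := by
    change ε⁻¹ * _ ≤ f t
    rw [← div_eq_inv_mul, div_le_iff₀ hε]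
    have := intervalIntegral.integral_mono_on (f := f) (g := fun _ => f t) (a := t - ε) (b := t)
      (μ := volume) (by linarith) hfm.intervalIntegrable (by simp) (fun x hx => hfm hx.2)
    simpa [mul_comm] using this
  have u3 : A₁ - A₂ ≤ 2 * (D * (t * Real.exp (θ * t))) := by
    calc A₁ - A₂ ≤ ‖((A₁ : ℂ) - m t) - ((A₂ : ℂ) - m t)‖ := by
          rw [sub_sub_sub_cancel_right, ← Complex.ofReal_sub, Complex.norm_real]
          exact le_abs_self _
      _ ≤ _ := by
          refine (norm_sub_le _ _).trans ?_
          linarith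
  have hnn : 0 ≤ t * Real.exp (θ * t) := by positivity
  rw [Real.norm_eq_abs (t * _), abs_of_nonneg hnn]
  calc ‖(f t : ℂ) - m t‖ = ‖((f t - A₂ : ℝ) : ℂ) + ((A₂ : ℂ) - m t)‖ := by
        congr 1; push_cast; ring
    _ ≤ (f t - A₂) + D * (t * Real.exp (θ * t)) := by
        refine (norm_add_le _ _).trans (add_le_add ?_ k2)
        rw [Complex.norm_real, Real.norm_eq_abs, abs_of_nonneg (by linarith)]
    _ ≤ 3 * D * (t * Real.exp (θ * t)) := by linarith


/-! ### Principal parts -/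

theorem analyticAt_dslope {h : ℂ → ℂ} {s : ℂ} (hh : AnalyticAt ℂ h s) :
    AnalyticAt ℂ (dslope h s) s := by
  obtain ⟨q, hq⟩ := hh
  exact ⟨_, hq.has_fpower_series_dslope_fslope⟩

/-- The principal part at a single pole. -/
theorem exists_principalPart_at {s : ℂ} (n : ℕ) : ∀ {F h : ℂ → ℂ}, AnalyticAt ℂ h s →
    (∀ᶠ z in 𝓝[≠] s, (z - s) ^ n * F z = h z) →
    ∃ (c : ℕ → ℂ) (g : ℂ → ℂ), AnalyticAt ℂ g s ∧
      ∀ᶠ z in 𝓝[≠] s, F z - ∑ k ∈ Finset.range n, c k / (z - s) ^ (k + 1) = g z := by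
  induction n with
  | zero =>
    intro F h hh hF
    exact ⟨0, h, hh, by simpa using hF⟩
  | succ n ih =>
    intro F h hh hF
    -- The term of top order, with coefficient h(s), is removed first; (z - s)^n times the rest is
    -- the divided slope of h at s, again analytic.
    obtain ⟨c, g, hg, hc⟩ := ih (F := fun z => F z - h s / (z - s) ^ (n + 1))
      (analyticAt_dslope hh) (by
        filter_upwards [hF, self_mem_nhdsWithin] with z hz hzs
        have hzs' : z - s ≠ 0 := sub_ne_zero.2 hzs
        rw [dslope_of_ne _ hzs, slope_def_field, ← hz]
        field_simp
        ring)
    refine ⟨fun k => if k < n then c k else h s, g, hg, ?_⟩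
    filter_upwards [hc] with z hz
    rw [← hz, Finset.sum_range_succ, if_neg (lt_irrefl n)]
    have : ∑ k ∈ Finset.range n, (if k < n then c k else h s) / (z - s) ^ (k + 1) =
        ∑ k ∈ Finset.range n, c k / (z - s) ^ (k + 1) :=
      Finset.sum_congr rfl fun k hk => by rw [if_pos (Finset.mem_range.1 hk)]
    rw [this]
    ring

/-- Subtracting the principal parts at finitely many poles leaves a holomorphic function. -/
theorem exists_principalPart {F : ℂ → ℂ} {S : Finset ℂ} {U : Set ℂ} {n : ℂ → ℕ}
    (hF : ∀ z ∈ U, z ∉ S → DifferentiableAt ℂ F z)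
    (hp : ∀ s ∈ S, ∃ h : ℂ → ℂ, AnalyticAt ℂ h s ∧ ∀ᶠ z in 𝓝[≠] s, (z - s) ^ n s * F z = h z) :
    ∃ (c : ℂ → ℕ → ℂ) (H : ℂ → ℂ), (∀ z ∈ U, DifferentiableAt ℂ H z) ∧ ∀ z ∉ S,
      H z = F z - ∑ s ∈ S, ∑ k ∈ Finset.range (n s), c s k / (z - s) ^ (k + 1) := by
  classical
  have h1 : ∀ s : ℂ, ∃ (c : ℕ → ℂ) (g : ℂ → ℂ), s ∈ S → AnalyticAt ℂ g s ∧
      ∀ᶠ z in 𝓝[≠] s, F z - ∑ k ∈ Finset.range (n s), c k / (z - s) ^ (k + 1) = g z := by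
    intro s
    by_cases hs : s ∈ S
    · obtain ⟨h, hh, hF⟩ := hp s hs
      obtain ⟨c, g, hcg⟩ := exists_principalPart_at (n s) hh hF
      exact ⟨c, g, fun _ => hcg⟩
    · exact ⟨0, 0, fun h => absurd h hs⟩
  choose c g hcg using h1
  let P : ℂ → ℂ → ℂ := fun s z => ∑ k ∈ Finset.range (n s), c s k / (z - s) ^ (k + 1)
  have hP : ∀ s z : ℂ, z ≠ s → AnalyticAt ℂ (P s) z := by
    intro s z hz
    have hz' : z - s ≠ 0 := sub_ne_zero.2 hz
    refine Finset.analyticAt_fun_sum _ fun k _ => ?_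
    exact analyticAt_const.div ((analyticAt_id.sub analyticAt_const).pow _) (pow_ne_zero _ hz')
  -- The correct value at a pole s: the local analytic remainder minus the principal parts at the
  -- other poles.
  let Q : ℂ → ℂ → ℂ := fun s z => g s z - ∑ r ∈ S.erase s, P r z
  let H : ℂ → ℂ := fun z => if z ∈ S then Q z z else F z - ∑ s ∈ S, P s z
  have hQ : ∀ s ∈ S, AnalyticAt ℂ (Q s) s := fun s hs =>
    (hcg s hs).1.sub (Finset.analyticAt_fun_sum _ fun r hr => hP r s (Finset.ne_of_mem_erase hr).symm)
  refine ⟨c, H, fun z hz => ?_, fun z hz => if_neg hz⟩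
  have hcl : ∀ T : Finset ℂ, z ∉ T → ∀ᶠ w in 𝓝 z, w ∉ T := fun T hT =>
    T.finite_toSet.isClosed.isOpen_compl.mem_nhds hT
  by_cases hzS : z ∈ S
  · refine (hQ z hzS).differentiableAt.congr_of_eventuallyEq ?_
    have e1 : ∀ᶠ w in 𝓝[≠] z, H w = Q z w := by
      filter_upwards [(hcg z hzS).2, self_mem_nhdsWithin,
        nhdsWithin_le_nhds (hcl (S.erase z) (Finset.notMem_erase z S))] with w hw hwz hwS
      have hwS' : w ∉ S := fun h => hwS (Finset.mem_erase.2 ⟨hwz, h⟩)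
      simp only [H, if_neg hwS', Q, ← hw, P]
      rw [← Finset.add_sum_erase S _ hzS]
      ring
    exact eventuallyEq_nhds_of_eventuallyEq_nhdsNE e1 (if_pos hzS)
  · have e1 : H =ᶠ[𝓝 z] fun w => F w - ∑ s ∈ S, P s w := by
      filter_upwards [hcl S hzS] with w hw
      exact if_neg hw
    refine DifferentiableAt.congr_of_eventuallyEq ?_ e1
    refine (hF z hz hzS).sub (Finset.analyticAt_fun_sum _ fun s hs => hP s z ?_).differentiableAt
    rintro rfl
    exact hzS hs

/-! ### Lower bounds for zero-free holomorphic functions -/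

/-- A Harnack type inequality for zero-free bounded holomorphic functions on a disk. -/
theorem exists_lower_bound_ball {M c R r : ℝ} (hc : 0 < c) (hcM : c ≤ M) (hr : 0 ≤ r) (hrR : r < R) :
    ∃ c' : ℝ, 0 < c' ∧ ∀ (h : ℂ → ℂ) (p : ℂ), (∀ z ∈ Metric.ball p R, DifferentiableAt ℂ h z) →
      (∀ z ∈ Metric.ball p R, h z ≠ 0) → (∀ z ∈ Metric.ball p R, ‖h z‖ ≤ M) → c ≤ ‖h p‖ →
      ∀ z ∈ Metric.closedBall p r, c' ≤ ‖h z‖ := by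
  have hR : 0 < R := hr.trans_lt hrR
  have hM0 : 0 < M := hc.trans_le hcM
  -- The summand 1 keeps L positive when M = c, as Borel–Carathéodory requires.
  set L := Real.log (M / c) + 1 with hL
  have hL0 : 0 < L := by
    have := Real.log_nonneg ((one_le_div hc).2 hcM)
    linarith
  refine ⟨c * Real.exp (-(2 * L * r / (R - r))), by positivity, fun h p hd h0 hM hcp z hz => ?_⟩
  set f : ℂ → ℂ := fun w => h (p + w) with hf
  have hmem : ∀ w ∈ Metric.ball (0 : ℂ) R, p + w ∈ Metric.ball p R := by
    intro w hw; simpa using hw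
  have hfd : ∀ w ∈ Metric.ball (0 : ℂ) R, DifferentiableAt ℂ f w := fun w hw =>
    (hd _ (hmem w hw)).comp w (by fun_prop)
  have hf0 : ∀ w ∈ Metric.ball (0 : ℂ) R, f w ≠ 0 := fun w hw => h0 _ (hmem w hw)
  have hfo : DifferentiableOn ℂ f (Metric.ball 0 R) := fun w hw =>
    (hfd w hw).differentiableWithinAt
  -- A zero-free function on a disk has a holomorphic logarithm: with ψ a primitive of f'/f and ψ(0)
  -- = 0, one has f = f(0) e^ψ.
  have hq : DifferentiableOn ℂ (fun w => deriv f w / f w) (Metric.ball 0 R) :=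
    (hfo.deriv Metric.isOpen_ball).div hfo hf0
  obtain ⟨ψ, hψ0, hψ⟩ := hq.isExactOn_ball.with_val_at 0 0
  have hconst : ∀ w ∈ Metric.ball (0 : ℂ) R, f w * Complex.exp (-ψ w) = f 0 := by
    intro w hw
    have hder : ∀ x ∈ Metric.ball (0 : ℂ) R,
        HasDerivAt (fun w => f w * Complex.exp (-ψ w)) 0 x := by
      intro x hx
      have := (hfd x hx).hasDerivAt.mul ((hψ x hx).neg.cexp)
      refine this.congr_deriv ?_
      have := hf0 x hx
      field_simp
      simp
    have := (convex_ball (0 : ℂ) R).is_const_of_fderivWithin_eq_zero (𝕜 := ℂ)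
      (fun x hx => (hder x hx).differentiableAt.differentiableWithinAt)
      (fun x hx => by
        rw [fderivWithin_of_isOpen Metric.isOpen_ball hx]
        ext
        simp [(hder x hx).deriv]) hw (Metric.mem_ball_self hR)
    simpa [hψ0] using this
  have hexp : ∀ w ∈ Metric.ball (0 : ℂ) R, f w = f 0 * Complex.exp (ψ w) := by
    intro w hw
    rw [← hconst w hw, mul_assoc, ← Complex.exp_add]
    simp
  have hcp' : c ≤ ‖f 0‖ := by simpa [hf] using hcp
  -- The upper bound on |f| bounds Re ψ from above. Borel–Carathéodory turns this one-sided bound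
  -- into a bound on |ψ|, hence a lower bound on |f|.
  have hmaps : Set.MapsTo ψ (Metric.ball 0 R) {z | z.re ≤ L} := by
    intro w hw
    have h1 : ‖f w‖ ≤ M := hM _ (hmem w hw)
    rw [hexp w hw, norm_mul, Complex.norm_exp] at h1
    have h2 : Real.exp (ψ w).re ≤ M / c := by
      rw [le_div_iff₀ hc, mul_comm]
      exact (mul_le_mul_of_nonneg_right hcp' (Real.exp_pos _).le).trans h1
    have h3 := (Real.le_log_iff_exp_le (by positivity)).2 h2
    change (ψ w).re ≤ L
    linarith
  have hzb : z - p ∈ Metric.ball (0 : ℂ) R := by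
    rw [mem_ball_zero_iff]
    exact (mem_closedBall_iff_norm.1 hz).trans_lt hrR
  have hzr : ‖z - p‖ ≤ r := mem_closedBall_iff_norm.1 hz
  have hbc := Complex.borelCaratheodory_zero hL0
    (fun w hw => (hψ w hw).differentiableAt.differentiableWithinAt) hmaps hR hzb hψ0
  have h5 : ‖ψ (z - p)‖ ≤ 2 * L * r / (R - r) := hbc.trans (by
    have : 0 < R - r := by linarith
    gcongr)
  have h6 : h z = f 0 * Complex.exp (ψ (z - p)) := by
    rw [← hexp _ hzb]; simp [hf]
  rw [h6, norm_mul, Complex.norm_exp]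
  gcongr
  have := (abs_le.1 (Complex.abs_re_le_norm (ψ (z - p)))).1
  linarith

/-- A bounded holomorphic function on a right half-plane, bounded away from zero on the line
`Re z = θ` and far to the right, and without zeros between for large `|Im z|`, is bounded away from
zero near that line and for large `|Im z|`. -/
theorem exists_lower_bound_halfPlane {h : ℂ → ℂ} {θ δ M c B T : ℝ} (hδ : 0 < δ) (hc : 0 < c)
    (hd : ∀ z : ℂ, θ - δ < z.re → DifferentiableAt ℂ h z)
    (hM : ∀ z : ℂ, θ - δ < z.re → ‖h z‖ ≤ M)
    (hline : ∀ η : ℝ, c ≤ ‖h (θ + η * Complex.I)‖)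
    (hright : ∀ z : ℂ, B ≤ z.re → c ≤ ‖h z‖)
    (hzero : ∀ z : ℂ, θ < z.re → T < |z.im| → h z ≠ 0) :
    ∃ c' δ' T' : ℝ, 0 < c' ∧ 0 < δ' ∧ δ' ≤ δ ∧ (∀ z : ℂ, |z.re - θ| < δ' → c' ≤ ‖h z‖) ∧
      ∀ z : ℂ, θ ≤ z.re → T' < |z.im| → c' ≤ ‖h z‖ := by
  have hcM : c ≤ M := (hline 0).trans (hM _ (by simpa using hδ))
  have hM0 : 0 < M := hc.trans_le hcM
  -- By the Schwarz lemma on a disk of radius δ the function changes at rate at most 2M/δ, so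
  -- distance δ' costs at most c/2.
  set δ' := c * δ / (4 * M) with hδ'
  have hδ'0 : 0 < δ' := by positivity
  have hδ'δ : δ' < δ := by
    rw [hδ', div_lt_iff₀ (by positivity)]
    nlinarith
  have hnear : ∀ z : ℂ, |z.re - θ| < δ' → c / 2 ≤ ‖h z‖ := by
    intro z hz
    set p : ℂ := θ + z.im * Complex.I with hp
    have hzp : dist z p = |z.re - θ| := by
      have : z - p = ((z.re - θ : ℝ) : ℂ) := by
        apply Complex.ext <;> simp [hp]
      rw [dist_eq_norm, this, Complex.norm_real, Real.norm_eq_abs]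
    have hball : ∀ w ∈ Metric.ball p δ, θ - δ < w.re := by
      intro w hw
      have h1 := (Complex.abs_re_le_norm (w - p)).trans_lt (mem_ball_iff_norm.1 hw)
      have h2 : (w - p).re = w.re - θ := by simp [hp]
      rw [h2] at h1
      linarith [(abs_lt.1 h1).1]
    have h1 := Complex.dist_le_div_mul_dist_of_mapsTo_ball (f := h) (c := p) (R₁ := δ)
      (R₂ := 2 * M) (z := z) (fun w hw => (hd w (hball w hw)).differentiableWithinAt)
      (fun w hw => by
        rw [mem_closedBall_iff_norm]
        refine (norm_sub_le _ _).trans ?_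
        have := hM w (hball w hw)
        have := hM p (hball p (Metric.mem_ball_self hδ))
        linarith)
      (by rw [Metric.mem_ball, hzp]; linarith)
    have h2 : 2 * M / δ * dist z p ≤ c / 2 := by
      rw [hzp]
      calc 2 * M / δ * |z.re - θ| ≤ 2 * M / δ * δ' := by gcongr
        _ = c / 2 := by rw [hδ']; field_simp; ring
    have h3 := hline z.im
    have h4 : ‖h p‖ ≤ ‖h z‖ + dist (h z) (h p) := by
      rw [dist_eq_norm]
      have := norm_sub_norm_le (h p) (h z)
      rw [norm_sub_rev] at this
      linarith
    linarith
  -- The disk of radius B' - θ about B' + i Im z lies in Re > θ, and shrinking its radius by δ'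
  -- still reaches Re = θ + δ', where the estimate near the line takes over. Adding B' - θ to T
  -- keeps the disk above or below all zeros.
  set B' := max B (θ + δ + 1) with hB'
  have hB'1 : B ≤ B' := le_max_left _ _
  have hB'2 : θ + δ + 1 ≤ B' := le_max_right _ _
  obtain ⟨c₁, hc₁, hharn⟩ := exists_lower_bound_ball (M := M) (c := c) (R := B' - θ)
    (r := B' - θ - δ') hc hcM (by linarith) (by linarith)
  refine ⟨min (c / 2) c₁, δ', T + (B' - θ), by positivity, hδ'0, hδ'δ.le,
    fun z hz => (min_le_left _ _).trans (hnear z hz), fun z hz hT => ?_⟩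
  by_cases h1 : z.re < θ + δ'
  · exact (min_le_left _ _).trans (hnear z (by rw [abs_of_nonneg (by linarith)]; linarith))
  by_cases h2 : B' ≤ z.re
  · refine (min_le_left _ _).trans ?_
    linarith [hright z (hB'1.trans h2)]
  push Not at h1 h2
  refine (min_le_right _ _).trans ?_
  set p : ℂ := B' + z.im * Complex.I with hp
  have hball : ∀ w ∈ Metric.ball p (B' - θ), θ < w.re ∧ T < |w.im| := by
    intro w hw
    have h1 := (Complex.abs_re_le_norm (w - p)).trans_lt (mem_ball_iff_norm.1 hw)
    have h2 := (Complex.abs_im_le_norm (w - p)).trans_lt (mem_ball_iff_norm.1 hw)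
    have h3 : (w - p).re = w.re - B' := by simp [hp]
    have h4 : (w - p).im = w.im - z.im := by simp [hp]
    rw [h3] at h1
    rw [h4] at h2
    refine ⟨by linarith [(abs_lt.1 h1).1], ?_⟩
    have := abs_sub_abs_le_abs_sub z.im w.im
    rw [abs_sub_comm] at this
    linarith
  refine hharn h p (fun w hw => hd w (by linarith [(hball w hw).1]))
    (fun w hw => hzero w (hball w hw).1 (hball w hw).2)
    (fun w hw => hM w (by linarith [(hball w hw).1])) (hright p (by simpa [hp] using hB'1)) z ?_
  have : z - p = ((z.re - B' : ℝ) : ℂ) := by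
    apply Complex.ext <;> simp [hp]
  rw [mem_closedBall_iff_norm, this, Complex.norm_real, Real.norm_eq_abs, abs_of_neg (by linarith)]
  linarith


variable {p : ℕ}

/-! ### Laplace transforms of measures on `[0, ∞)` -/

theorem integrable_exp_mono {m : Measure ℝ≥0} {σ σ' : ℝ} (h : σ ≤ σ')
    (hm : Integrable (fun x : ℝ≥0 => Real.exp (-(σ * (x : ℝ)))) m) :
    Integrable (fun x : ℝ≥0 => Real.exp (-(σ' * (x : ℝ)))) m := by
  refine hm.mono' (by fun_prop) (ae_of_all _ fun x => ?_)
  rw [Real.norm_eq_abs, abs_of_pos (Real.exp_pos _)]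
  gcongr

theorem integrable_cexp {m : Measure ℝ≥0} {σ : ℝ} {z : ℂ} (h : σ ≤ z.re)
    (hm : Integrable (fun x : ℝ≥0 => Real.exp (-(σ * (x : ℝ)))) m) :
    Integrable (fun x : ℝ≥0 => Complex.exp (-(z * ((x : ℝ) : ℂ)))) m := by
  refine (integrable_exp_mono h hm).mono' (by fun_prop) (ae_of_all _ fun x => ?_)
  rw [Complex.norm_exp]
  simp

theorem norm_integral_cexp_le {m : Measure ℝ≥0} {σ : ℝ} {z : ℂ} (h : σ ≤ z.re)
    (hm : Integrable (fun x : ℝ≥0 => Real.exp (-(σ * (x : ℝ)))) m) :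
    ‖∫ x : ℝ≥0, Complex.exp (-(z * ((x : ℝ) : ℂ))) ∂m‖ ≤
      ∫ x : ℝ≥0, Real.exp (-(σ * (x : ℝ))) ∂m := by
  refine norm_integral_le_of_norm_le hm (ae_of_all _ fun x => ?_)
  rw [Complex.norm_exp]
  simp only [Complex.neg_re, Complex.mul_re, Complex.ofReal_re, Complex.ofReal_im, mul_zero,
    sub_zero]
  gcongr

/-- The transform is a complex moment generating function evaluated at -z, holomorphic where Re(-z)
is interior to the set of integrable exponents. -/
theorem differentiableAt_integral_cexp {m : Measure ℝ≥0} {σ : ℝ} {z : ℂ} (h : σ < z.re)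
    (hm : Integrable (fun x : ℝ≥0 => Real.exp (-(σ * (x : ℝ)))) m) :
    DifferentiableAt ℂ (fun z : ℂ => ∫ x : ℝ≥0, Complex.exp (-(z * ((x : ℝ) : ℂ))) ∂m) z := by
  have hint : (-z).re ∈ interior (integrableExpSet (fun x : ℝ≥0 => (x : ℝ)) m) := by
    rw [mem_interior]
    refine ⟨Set.Iio (-σ), fun u hu => ?_, isOpen_Iio, by simpa using h⟩
    have := integrable_exp_mono (σ' := -u) (by linarith [Set.mem_Iio.1 hu]) hm
    simpa [integrableExpSet] using this
  have h1 := (hasDerivAt_complexMGF hint).differentiableAt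
  have h2 : (fun z : ℂ => ∫ x : ℝ≥0, Complex.exp (-(z * ((x : ℝ) : ℂ))) ∂m) =
      fun z => complexMGF (fun x : ℝ≥0 => (x : ℝ)) m (-z) := by
    funext z
    simp [complexMGF]
  rw [h2]
  exact DifferentiableAt.comp z (g := complexMGF (fun x : ℝ≥0 => (x : ℝ)) m) h1 (by fun_prop)

/-- By dominated convergence only the atom at 0 survives as Re z → ∞. The filter leaves Im z free,
so the limit is uniform in it. -/
theorem tendsto_integral_cexp {m : Measure ℝ≥0} {σ : ℝ}
    (hm : Integrable (fun x : ℝ≥0 => Real.exp (-(σ * (x : ℝ)))) m) :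
    Tendsto (fun z : ℂ => ∫ x : ℝ≥0, Complex.exp (-(z * ((x : ℝ) : ℂ))) ∂m)
      (comap Complex.re atTop) (𝓝 ((m.real {0} : ℝ) : ℂ)) := by
  have h := tendsto_integral_filter_of_dominated_convergence (μ := m)
    (l := comap Complex.re atTop) (F := fun (z : ℂ) (x : ℝ≥0) => Complex.exp (-(z * ((x : ℝ) : ℂ))))
    (f := Set.indicator {0} fun _ => (1 : ℂ)) (fun x : ℝ≥0 => Real.exp (-(σ * (x : ℝ))))
    (Eventually.of_forall fun z => by fun_prop)
    (by
      filter_upwards [tendsto_comap.eventually (eventually_ge_atTop σ)] with z hz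
      refine ae_of_all _ fun x => ?_
      rw [Complex.norm_exp]
      simp only [Complex.neg_re, Complex.mul_re, Complex.ofReal_re, Complex.ofReal_im, mul_zero,
        sub_zero]
      gcongr) hm
    (ae_of_all _ fun x => by
      by_cases hx : x = 0
      · simp [hx, tendsto_const_nhds]
      · rw [Set.indicator_of_notMem (by simpa using hx), tendsto_zero_iff_norm_tendsto_zero]
        have hx' : (0 : ℝ) < x := by exact_mod_cast pos_iff_ne_zero.2 hx
        have : ∀ z : ℂ, ‖Complex.exp (-(z * ((x : ℝ) : ℂ)))‖ = Real.exp (-(z.re * x)) := by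
          intro z; rw [Complex.norm_exp]; simp
        simp_rw [this]
        exact Real.tendsto_exp_neg_atTop_nhds_zero.comp (tendsto_comap.atTop_mul_const hx'))
  rw [integral_indicator (measurableSet_singleton 0)] at h
  simpa [Measure.real] using h

/-! ### The matrix of Laplace transforms -/

theorem exists_integrable_of_mem_interior {μ : MeasureMatrix p} {θ : ℝ}
    (h : (θ : ℂ) ∈ interior (laplaceDomain μ)) :
    ∃ δ : ℝ, 0 < δ ∧ ∀ i j, Integrable (fun x : ℝ≥0 => Real.exp (-((θ - δ) * (x : ℝ)))) (μ i j) := by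
  rw [mem_interior_iff_mem_nhds, Metric.mem_nhds_iff] at h
  obtain ⟨ε, hε, hb⟩ := h
  refine ⟨ε / 2, half_pos hε, fun i j => ?_⟩
  have : ((θ - ε / 2 : ℝ) : ℂ) ∈ laplaceDomain μ := hb (by
    rw [mem_ball_iff_norm, ← Complex.ofReal_sub, Complex.norm_real, Real.norm_eq_abs,
      sub_sub_cancel_left, abs_neg, abs_of_pos (half_pos hε)]
    exact half_lt_self hε)
  simpa using this i j

theorem mem_laplaceDomain {μ : MeasureMatrix p} {σ : ℝ}
    (hσ : ∀ i j, Integrable (fun x : ℝ≥0 => Real.exp (-(σ * (x : ℝ)))) (μ i j))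
    {z : ℂ} (hz : σ ≤ z.re) : z ∈ laplaceDomain μ :=
  fun i j => integrable_exp_mono hz (hσ i j)

theorem differentiableAt_det {M : ℂ → Matrix (Fin p) (Fin p) ℂ} {z : ℂ}
    (hM : ∀ i j, DifferentiableAt ℂ (fun z => M z i j) z) :
    DifferentiableAt ℂ (fun z => (M z).det) z := by
  simp only [Matrix.det_apply]
  refine DifferentiableAt.fun_sum fun τ _ => DifferentiableAt.const_smul ?_ _
  exact DifferentiableAt.fun_finsetProd fun i _ => hM _ _

theorem differentiableAt_adjugate {M : ℂ → Matrix (Fin p) (Fin p) ℂ} {z : ℂ}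
    (hM : ∀ i j, DifferentiableAt ℂ (fun z => M z i j) z) (i j : Fin p) :
    DifferentiableAt ℂ (fun z => (M z).adjugate i j) z := by
  simp only [Matrix.adjugate_apply]
  refine differentiableAt_det fun k l => ?_
  by_cases hk : k = j
  · subst hk
    simp only [Matrix.updateRow_self]
    exact differentiableAt_const _
  · simp only [Matrix.updateRow_ne hk]
    exact hM k l

/-- Matrices with bounded entries form a compact set; this spares explicit estimates of determinants
and adjugates. -/
theorem exists_bound_of_entries {f : Matrix (Fin p) (Fin p) ℂ → ℂ} (hf : Continuous f) (K : ℝ) :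
    ∃ M : ℝ, ∀ A : Matrix (Fin p) (Fin p) ℂ, (∀ i j, ‖A i j‖ ≤ K) → ‖f A‖ ≤ M := by
  have hc : IsCompact (Set.pi Set.univ fun _ : Fin p => Set.pi Set.univ fun _ : Fin p =>
      Metric.closedBall (0 : ℂ) K) :=
    isCompact_univ_pi fun _ => isCompact_univ_pi fun _ => isCompact_closedBall _ _
  obtain ⟨M, hM⟩ := hc.exists_bound_of_continuousOn (f := f) hf.continuousOn
  exact ⟨M, fun A hA => hM A fun i _ j _ => mem_closedBall_zero_iff.2 (hA i j)⟩

/-- No invertibility is needed: for singular matrices both sides are 0 by convention. -/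
theorem inv_apply_eq (A : Matrix (Fin p) (Fin p) ℂ) (i j : Fin p) :
    A⁻¹ i j = A.det⁻¹ * A.adjugate i j := by
  rw [Matrix.inv_def, Ring.inverse_eq_inv', Matrix.smul_apply, smul_eq_mul]

/-- The characteristic matrix `I - Lμ(z)` on a half-plane where the transforms converge. -/
theorem differentiableAt_one_sub_laplace {μ : MeasureMatrix p} {σ : ℝ}
    (hσ : ∀ i j, Integrable (fun x : ℝ≥0 => Real.exp (-(σ * (x : ℝ)))) (μ i j))
    {z : ℂ} (hz : σ < z.re) (i j : Fin p) :
    DifferentiableAt ℂ (fun z => (1 - laplace μ z) i j) z := by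
  simp only [Matrix.sub_apply]
  exact (differentiableAt_const _).sub (differentiableAt_integral_cexp hz (hσ i j))

theorem exists_norm_one_sub_laplace_le {μ : MeasureMatrix p} {σ : ℝ}
    (hσ : ∀ i j, Integrable (fun x : ℝ≥0 => Real.exp (-(σ * (x : ℝ)))) (μ i j)) :
    ∃ K : ℝ, ∀ z : ℂ, σ ≤ z.re → ∀ i j, ‖(1 - laplace μ z) i j‖ ≤ K := by
  refine ⟨1 + ∑ i, ∑ j, ∫ x : ℝ≥0, Real.exp (-(σ * (x : ℝ))) ∂(μ i j), fun z hz i j => ?_⟩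
  rw [Matrix.sub_apply]
  refine (norm_sub_le _ _).trans (add_le_add ?_ ((norm_integral_cexp_le hz (hσ i j)).trans ?_))
  · rw [Matrix.one_apply]; split_ifs <;> simp
  · have hnn : ∀ i j, 0 ≤ ∫ x : ℝ≥0, Real.exp (-(σ * (x : ℝ))) ∂(μ i j) := fun i j =>
      integral_nonneg fun x => (Real.exp_pos _).le
    refine (Finset.single_le_sum (f := fun j => ∫ x : ℝ≥0, Real.exp (-(σ * (x : ℝ))) ∂(μ i j))
      (fun j _ => hnn i j) (Finset.mem_univ j)).trans ?_
    exact Finset.single_le_sum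
      (f := fun i => ∑ j, ∫ x : ℝ≥0, Real.exp (-(σ * (x : ℝ))) ∂(μ i j))
      (fun i _ => Finset.sum_nonneg fun j _ => hnn i j) (Finset.mem_univ i)

theorem tendsto_laplace {μ : MeasureMatrix p} {σ : ℝ}
    (hσ : ∀ i j, Integrable (fun x : ℝ≥0 => Real.exp (-(σ * (x : ℝ)))) (μ i j)) :
    Tendsto (laplace μ) (comap Complex.re atTop) (𝓝 (massAtZero μ)) := by
  refine tendsto_pi_nhds.2 fun i => tendsto_pi_nhds.2 fun j => ?_
  exact tendsto_integral_cexp (hσ i j)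

theorem isUnit_det_one_sub_massAtZero {μ : MeasureMatrix p}
    (h : spectralRadius ℂ (massAtZero μ) < 1) : (1 - massAtZero μ).det ≠ 0 := by
  have h1 : (1 : ℂ) ∈ resolventSet ℂ (massAtZero μ) :=
    spectrum.mem_resolventSet_of_spectralRadius_lt (by simpa using h)
  rw [spectrum.mem_resolventSet_iff, map_one, Matrix.isUnit_iff_isUnit_det] at h1
  exact h1.ne_zero

section Norm

attribute [local instance] Matrix.linftyOpNormedAddCommGroup Matrix.linftyOpNormedRing
  Matrix.linftyOpNormedAlgebra

theorem norm_entry_le_linfty (A : Matrix (Fin p) (Fin p) ℂ) (i j : Fin p) : ‖A i j‖ ≤ ‖A‖ := by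
  rw [Matrix.linfty_opNorm_def]
  have h1 : ‖A i j‖₊ ≤ ∑ l, ‖A i l‖₊ :=
    Finset.single_le_sum (f := fun l => ‖A i l‖₊) (fun _ _ => zero_le) (Finset.mem_univ j)
  have h2 := Finset.le_sup (f := fun i => ∑ l, ‖A i l‖₊) (Finset.mem_univ i)
  exact_mod_cast h1.trans h2

/-- Boundedness of the resolvent on the line keeps the characteristic determinant away from `0`. -/
theorem exists_le_norm_det_of_resolventBoundedOn {μ : MeasureMatrix p} {θ : ℝ}
    (h : ResolventBoundedOn μ θ) :
    ∃ c : ℝ, 0 < c ∧ ∀ η : ℝ, c ≤ ‖(1 - laplace μ (θ + η * Complex.I)).det‖ := by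
  obtain ⟨hu, K, hK⟩ := h
  obtain ⟨M, hM⟩ := exists_bound_of_entries (p := p) (f := fun A => A.det) (by fun_prop) K
  -- The reciprocal of the determinant is the determinant of the resolvent, whose entries are
  -- bounded on the line.
  have hM' : ∀ η : ℝ, ‖(1 - laplace μ (θ + η * Complex.I)).det‖⁻¹ ≤ M := by
    intro η
    have h1 := hM (1 - laplace μ (θ + η * Complex.I))⁻¹ fun i j =>
      (norm_entry_le_linfty _ i j).trans (hK ⟨η, rfl⟩)
    rwa [Matrix.det_nonsing_inv, Ring.inverse_eq_inv', norm_inv] at h1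
  have hpos : ∀ η : ℝ, 0 < ‖(1 - laplace μ (θ + η * Complex.I)).det‖ := fun η =>
    norm_pos_iff.2 (hu η).ne_zero
  have hM0 : 0 < M := (inv_pos.2 (hpos 0)).trans_le (hM' 0)
  exact ⟨M⁻¹, inv_pos.2 hM0, fun η => (inv_le_comm₀ (hpos η) hM0).1 (hM' η)⟩

/-- If some power of `A` has norm less than one, the partial sums of `∑ Aⁿ` are bounded. -/
theorem exists_bound_sum_pow {A : Matrix (Fin p) (Fin p) ℂ} {N : ℕ} (hN : 0 < N)
    (hA : ‖A ^ N‖ < 1) (hu : (1 - A).det ≠ 0) :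
    ∃ K : ℝ, ∀ m : ℕ, ∀ i j, ‖(∑ n ∈ Finset.range m, A ^ n) i j‖ ≤ K := by
  -- Division of n by N with remainder. The norm of the identity stays symbolic, since it is 0 for
  -- matrices of size 0.
  have hpow : ∀ n : ℕ, ‖A ^ n‖ ≤ ∑ r ∈ Finset.range N, ‖A ^ r‖ + ‖(1 : Matrix (Fin p) (Fin p) ℂ)‖ *
      ∑ r ∈ Finset.range N, ‖A ^ r‖ := by
    intro n
    have hr : ‖A ^ (n % N)‖ ≤ ∑ r ∈ Finset.range N, ‖A ^ r‖ :=
      Finset.single_le_sum (f := fun r => ‖A ^ r‖) (fun _ _ => norm_nonneg _)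
        (Finset.mem_range.2 (Nat.mod_lt n hN))
    have hq : ‖(A ^ N) ^ (n / N)‖ ≤ 1 + ‖(1 : Matrix (Fin p) (Fin p) ℂ)‖ := by
      rcases Nat.eq_zero_or_pos (n / N) with h | h
      · rw [h, pow_zero]; linarith
      · refine (norm_pow_le' _ h).trans ((pow_le_one₀ (norm_nonneg _) hA.le).trans ?_)
        linarith [norm_nonneg (1 : Matrix (Fin p) (Fin p) ℂ)]
    calc ‖A ^ n‖ = ‖(A ^ N) ^ (n / N) * A ^ (n % N)‖ := by
          rw [← pow_mul, ← pow_add, Nat.div_add_mod]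
      _ ≤ (1 + ‖(1 : Matrix (Fin p) (Fin p) ℂ)‖) * ∑ r ∈ Finset.range N, ‖A ^ r‖ :=
          (norm_mul_le _ _).trans (mul_le_mul hq hr (norm_nonneg _) (by positivity))
      _ = _ := by ring
  set D := ∑ r ∈ Finset.range N, ‖A ^ r‖ + ‖(1 : Matrix (Fin p) (Fin p) ℂ)‖ *
      ∑ r ∈ Finset.range N, ‖A ^ r‖ with hD
  refine ⟨‖(1 - A)⁻¹‖ * (‖(1 : Matrix (Fin p) (Fin p) ℂ)‖ + D), fun m i j => ?_⟩
  have hsum : ∑ n ∈ Finset.range m, A ^ n = (1 - A)⁻¹ * (1 - A ^ m) := by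
    rw [← mul_neg_geom_sum A m, ← mul_assoc, Matrix.nonsing_inv_mul _ (isUnit_iff_ne_zero.2 hu),
      one_mul]
  refine (norm_entry_le_linfty _ i j).trans ?_
  rw [hsum]
  refine (norm_mul_le _ _).trans ?_
  gcongr
  exact (norm_sub_le _ _).trans (add_le_add le_rfl (hpow m))

/-- The partial sums of the powers of `Lμ(B)` are bounded for large `B`. -/
theorem eventually_exists_bound_sum_pow_laplace {μ : MeasureMatrix p} {σ : ℝ}
    (hσ : ∀ i j, Integrable (fun x : ℝ≥0 => Real.exp (-(σ * (x : ℝ)))) (μ i j))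
    (h : spectralRadius ℂ (massAtZero μ) < 1) :
    ∀ᶠ z in comap Complex.re atTop, ∃ K : ℝ, ∀ m : ℕ, ∀ i j,
      ‖(∑ n ∈ Finset.range m, laplace μ z ^ n) i j‖ ≤ K := by
  -- Gelfand's formula gives one power of the mass at zero with norm below 1; this strict inequality
  -- passes to the same power of Lμ(z) for large Re z.
  have hg := spectrum.pow_nnnorm_pow_one_div_tendsto_nhds_spectralRadius (massAtZero μ)
  obtain ⟨N, hN0, hN⟩ := ((eventually_gt_atTop 0).and (hg.eventually_lt_const h)).exists
  have hN1 : ‖massAtZero μ ^ N‖ < 1 := by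
    by_contra hcon
    push Not at hcon
    have : (1 : ℝ≥0∞) ≤ ((‖massAtZero μ ^ N‖₊ : ℝ≥0) : ℝ≥0∞) := by exact_mod_cast hcon
    exact absurd (ENNReal.one_le_rpow this (by positivity)) (not_le.2 hN)
  have ht := tendsto_laplace hσ
  have h1 : Tendsto (fun z => ‖laplace μ z ^ N‖) (comap Complex.re atTop)
      (𝓝 ‖massAtZero μ ^ N‖) := (ht.pow N).norm
  have h2 : Tendsto (fun z => (1 - laplace μ z).det) (comap Complex.re atTop)
      (𝓝 (1 - massAtZero μ).det) :=
    ((continuous_id.matrix_det).tendsto _).comp (tendsto_const_nhds.sub ht)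
  filter_upwards [h1.eventually_lt_const hN1,
    h2.eventually_ne (isUnit_det_one_sub_massAtZero h)] with z hz1 hz2
  exact exists_bound_sum_pow hN0 hz1 hz2

end Norm


/-! ### Convolution powers and the renewal measure -/

/-- On a bounded interval the exponential weight is at least a positive constant, so Markov's
inequality applies. -/
theorem isLocallyFiniteMeasure_of_integrable {m : Measure ℝ≥0} {σ : ℝ}
    (hm : Integrable (fun x : ℝ≥0 => Real.exp (-(σ * (x : ℝ)))) m) :
    IsLocallyFiniteMeasure m := by
  refine ⟨fun x => ⟨Set.Iic (x + 1), Iic_mem_nhds (lt_add_one x), ?_⟩⟩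
  refine lt_of_le_of_lt (measure_mono ?_)
    (hm.measure_ge_lt_top (Real.exp_pos (-(|σ| * ((x + 1 : ℝ≥0) : ℝ)))))
  intro y hy
  have hy' : (y : ℝ) ≤ ((x + 1 : ℝ≥0) : ℝ) := by exact_mod_cast hy
  refine Real.exp_le_exp.2 (neg_le_neg ?_)
  calc σ * (y : ℝ) ≤ |σ| * y := by gcongr; exact le_abs_self _
    _ ≤ _ := by gcongr

theorem sFinite_finsetSum {ι : Type*} [Fintype ι] (m : ι → Measure ℝ≥0) [∀ i, SFinite (m i)] :
    SFinite (∑ i, m i) := by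
  rw [← Measure.sum_fintype]
  infer_instance

theorem sFinite_convPow {μ : MeasureMatrix p} (h : ∀ i j, SFinite (μ i j)) (n : ℕ) :
    ∀ i j, SFinite (convPow μ n i j) := by
  induction n with
  | zero =>
    intro i j
    simp only [convPow]
    split_ifs <;> infer_instance
  | succ n ih =>
    intro i j
    have := fun k => ih k j
    have := h i
    exact sFinite_finsetSum fun k => Measure.conv (μ i k) (convPow μ n k j)

theorem conv_sum_right {ι : Type*} [Countable ι] (m : Measure ℝ≥0) (ν : ι → Measure ℝ≥0)
    [∀ n, SFinite (ν n)] :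
    Measure.conv m (Measure.sum ν) = Measure.sum fun n => Measure.conv m (ν n) := by
  unfold Measure.conv
  rw [Measure.prod_sum_right, Measure.map_sum (by fun_prop)]

/-- The Markov renewal measure. -/
def renewalMeasure (μ : MeasureMatrix p) : MeasureMatrix p :=
  fun i j => Measure.sum fun n => convPow μ n i j

theorem renewalFunction_eq (μ : MeasureMatrix p) (t : ℝ≥0) (i j : Fin p) :
    renewalFunction μ t i j = renewalMeasure μ i j (Set.Iic t) := by
  rw [renewalMeasure, Measure.sum_apply _ measurableSet_Iic]
  rfl

/-- The renewal equation: separate n = 0 and pull one factor μ out of all later powers. -/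
theorem renewalMeasure_eq_add {μ : MeasureMatrix p} (h : ∀ i j, SFinite (μ i j)) (i j : Fin p) :
    renewalMeasure μ i j = convPow μ 0 i j + matConv μ (renewalMeasure μ) i j := by
  have := fun n i j => sFinite_convPow h n i j
  have h1 : matConv μ (renewalMeasure μ) i j = Measure.sum fun n => convPow μ (n + 1) i j := by
    simp only [matConv, renewalMeasure, conv_sum_right, convPow]
    ext s hs
    rw [Measure.finsetSum_apply, Measure.sum_apply _ hs]
    simp_rw [Measure.sum_apply _ hs, Measure.finsetSum_apply]
    rw [← Summable.tsum_finsetSum fun _ _ => ENNReal.summable]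
  rw [h1, renewalMeasure]
  ext s hs
  rw [Measure.add_apply, Measure.sum_apply _ hs, Measure.sum_apply _ hs]
  exact tsum_eq_zero_add' ENNReal.summable

/-- The exponential moment `∫ e^{-Bx} m(dx)` in `[0, ∞]`. -/
def expMoment (B : ℝ) (m : Measure ℝ≥0) : ℝ≥0∞ := ∫⁻ x, ENNReal.ofReal (Real.exp (-(B * (x : ℝ)))) ∂m

theorem expMoment_conv (B : ℝ) (m ν : Measure ℝ≥0) [SFinite ν] :
    expMoment B (Measure.conv m ν) = expMoment B m * expMoment B ν := by
  unfold expMoment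
  rw [Measure.lintegral_conv (by fun_prop), ← lintegral_mul_const _ (by fun_prop)]
  refine lintegral_congr fun x => ?_
  rw [← lintegral_const_mul _ (by fun_prop)]
  refine lintegral_congr fun y => ?_
  rw [← ENNReal.ofReal_mul (Real.exp_pos _).le, ← Real.exp_add]
  congr 2
  push_cast
  ring

theorem integrable_iff_expMoment {B : ℝ} {m : Measure ℝ≥0} :
    Integrable (fun x : ℝ≥0 => Real.exp (-(B * (x : ℝ)))) m ↔ expMoment B m < ⊤ := by
  unfold expMoment
  rw [← hasFiniteIntegral_iff_ofReal (ae_of_all _ fun x => (Real.exp_pos _).le)]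
  exact ⟨fun h => h.2, fun h => ⟨by fun_prop, h⟩⟩

/-- The real matrix of exponential moments. -/
def momentMatrix (μ : MeasureMatrix p) (B : ℝ) : Matrix (Fin p) (Fin p) ℝ :=
  Matrix.of fun i j => ∫ x : ℝ≥0, Real.exp (-(B * (x : ℝ))) ∂(μ i j)

theorem momentMatrix_nonneg (μ : MeasureMatrix p) (B : ℝ) (i j : Fin p) :
    0 ≤ momentMatrix μ B i j := integral_nonneg fun _ => (Real.exp_pos _).le

theorem momentMatrix_pow_nonneg (μ : MeasureMatrix p) (B : ℝ) (n : ℕ) :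
    ∀ i j : Fin p, 0 ≤ (momentMatrix μ B ^ n) i j := by
  induction n with
  | zero => intro i j; rw [pow_zero, Matrix.one_apply]; split_ifs <;> simp
  | succ n ih =>
    intro i j
    rw [pow_succ', Matrix.mul_apply]
    exact Finset.sum_nonneg fun k _ => mul_nonneg (momentMatrix_nonneg μ B i k) (ih k j)

theorem laplace_ofReal (μ : MeasureMatrix p) (B : ℝ) :
    laplace μ (B : ℂ) = Complex.ofRealHom.mapMatrix (momentMatrix μ B) := by
  ext i j
  simp only [laplace, momentMatrix, Matrix.of_apply, RingHom.mapMatrix_apply, Matrix.map_apply,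
    Complex.ofRealHom_eq_coe]
  rw [← integral_complex_ofReal]
  refine integral_congr_ae (ae_of_all _ fun x => ?_)
  simp

/-- Exponential moments are multiplicative under convolution, so convolution powers become matrix
powers. -/
theorem expMoment_convPow {μ : MeasureMatrix p} {B : ℝ}
    (hB : ∀ i j, Integrable (fun x : ℝ≥0 => Real.exp (-(B * (x : ℝ)))) (μ i j)) (n : ℕ) :
    ∀ i j, expMoment B (convPow μ n i j) = ENNReal.ofReal ((momentMatrix μ B ^ n) i j) := by
  have := fun i j => isLocallyFiniteMeasure_of_integrable (hB i j)
  have := fun n i j => sFinite_convPow (μ := μ) (fun i j => inferInstance) n i j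
  induction n with
  | zero =>
    intro i j
    simp only [convPow, pow_zero, Matrix.one_apply]
    split_ifs
    · unfold expMoment
      rw [lintegral_dirac' _ (by fun_prop)]
      simp
    · simp [expMoment]
  | succ n ih =>
    intro i j
    simp only [convPow, matConv]
    rw [expMoment, lintegral_finsetSum_measure, pow_succ', Matrix.mul_apply,
      ENNReal.ofReal_sum_of_nonneg fun k _ => mul_nonneg (momentMatrix_nonneg μ B i k)
        (momentMatrix_pow_nonneg μ B n k j)]
    refine Finset.sum_congr rfl fun k _ => ?_
    have h1 := expMoment_conv B (μ i k) (convPow μ n k j)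
    rw [ih] at h1
    rw [expMoment] at h1
    rw [h1, ENNReal.ofReal_mul (momentMatrix_nonneg μ B i k)]
    congr 1
    exact (ofReal_integral_eq_lintegral_ofReal (hB i k)
      (ae_of_all _ fun x => (Real.exp_pos _).le)).symm

/-- The moment is an entry of the Neumann series of Lμ(B). Its terms are nonnegative, so bounded
partial sums suffice for finiteness. -/
theorem integrable_renewalMeasure {μ : MeasureMatrix p} {B : ℝ}
    (hB : ∀ i j, Integrable (fun x : ℝ≥0 => Real.exp (-(B * (x : ℝ)))) (μ i j))
    (hK : ∃ K : ℝ, ∀ m : ℕ, ∀ i j, ‖(∑ n ∈ Finset.range m, laplace μ (B : ℂ) ^ n) i j‖ ≤ K)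
    (i j : Fin p) :
    Integrable (fun x : ℝ≥0 => Real.exp (-(B * (x : ℝ)))) (renewalMeasure μ i j) := by
  obtain ⟨K, hK⟩ := hK
  rw [integrable_iff_expMoment, expMoment, renewalMeasure, lintegral_sum_measure]
  refine lt_of_le_of_lt ?_ (ENNReal.ofReal_lt_top (r := K))
  rw [ENNReal.tsum_eq_iSup_nat]
  refine iSup_le fun m => ?_
  have h1 : ∀ n ∈ Finset.range m,
      ∫⁻ x, ENNReal.ofReal (Real.exp (-(B * (x : ℝ)))) ∂(convPow μ n i j) =
      ENNReal.ofReal ((momentMatrix μ B ^ n) i j) := fun n _ => expMoment_convPow hB n i j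
  rw [Finset.sum_congr rfl h1,
    ← ENNReal.ofReal_sum_of_nonneg fun n _ => momentMatrix_pow_nonneg μ B n i j]
  refine ENNReal.ofReal_le_ofReal ?_
  have h2 := hK m i j
  have h3 : (∑ n ∈ Finset.range m, laplace μ (B : ℂ) ^ n) i j =
      ((∑ n ∈ Finset.range m, (momentMatrix μ B ^ n) i j : ℝ) : ℂ) := by
    rw [laplace_ofReal, Matrix.sum_apply]
    simp only [← map_pow]
    simp
  rw [h3, Complex.norm_real, Real.norm_eq_abs] at h2
  exact (le_abs_self _).trans h2

theorem integral_cexp_conv {m ν : Measure ℝ≥0} [SFinite m] [SFinite ν] {B : ℝ} {z : ℂ} (hz : B ≤ z.re)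
    (hm : Integrable (fun x : ℝ≥0 => Real.exp (-(B * (x : ℝ)))) m)
    (hν : Integrable (fun x : ℝ≥0 => Real.exp (-(B * (x : ℝ)))) ν) :
    ∫ x : ℝ≥0, Complex.exp (-(z * ((x : ℝ) : ℂ))) ∂(Measure.conv m ν) =
      (∫ x : ℝ≥0, Complex.exp (-(z * ((x : ℝ) : ℂ))) ∂m) *
        ∫ x : ℝ≥0, Complex.exp (-(z * ((x : ℝ) : ℂ))) ∂ν := by
  have hconv : Integrable (fun x : ℝ≥0 => Real.exp (-(B * (x : ℝ)))) (Measure.conv m ν) := by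
    rw [integrable_iff_expMoment, expMoment_conv]
    exact ENNReal.mul_lt_top (integrable_iff_expMoment.1 hm) (integrable_iff_expMoment.1 hν)
  rw [integral_conv (integrable_cexp hz hconv), ← integral_mul_const]
  refine integral_congr_ae (ae_of_all _ fun x => ?_)
  simp only
  rw [← integral_const_mul]
  refine integral_congr_ae (ae_of_all _ fun y => ?_)
  simp only
  rw [← Complex.exp_add]
  congr 1
  push_cast
  ring

/-- The Laplace transform of the renewal measure is the resolvent `(I - Lμ)⁻¹`. -/
theorem laplace_renewalMeasure {μ : MeasureMatrix p} {B : ℝ}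
    (hB : ∀ i j, Integrable (fun x : ℝ≥0 => Real.exp (-(B * (x : ℝ)))) (μ i j))
    (hU : ∀ i j, Integrable (fun x : ℝ≥0 => Real.exp (-(B * (x : ℝ)))) (renewalMeasure μ i j))
    {z : ℂ} (hz : B ≤ z.re) :
    laplace (renewalMeasure μ) z = (1 - laplace μ z)⁻¹ := by
  have := fun i j => isLocallyFiniteMeasure_of_integrable (hB i j)
  have := fun i j => isLocallyFiniteMeasure_of_integrable (hU i j)
  -- The renewal equation after transformation; all moments are finite, so it can be solved for the
  -- transform.
  have h1 : laplace (renewalMeasure μ) z = 1 + laplace μ z * laplace (renewalMeasure μ) z := by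
    ext i j
    rw [Matrix.add_apply, Matrix.mul_apply]
    simp only [laplace, Matrix.of_apply]
    have hc : ∀ k, Integrable (fun x : ℝ≥0 => Complex.exp (-(z * ((x : ℝ) : ℂ))))
        (Measure.conv (μ i k) (renewalMeasure μ k j)) := by
      intro k
      refine integrable_cexp hz ?_
      rw [integrable_iff_expMoment, expMoment_conv]
      exact ENNReal.mul_lt_top (integrable_iff_expMoment.1 (hB i k))
        (integrable_iff_expMoment.1 (hU k j))
    have h0 : Integrable (fun x : ℝ≥0 => Complex.exp (-(z * ((x : ℝ) : ℂ)))) (convPow μ 0 i j) := by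
      simp only [convPow]
      split_ifs
      · exact integrable_dirac (by simp)
      · exact integrable_zero_measure
    rw [renewalMeasure_eq_add (fun i j => inferInstance) i j, integral_add_measure h0
      (by rw [matConv]; exact integrable_finsetSum_measure.2 fun k _ => hc k)]
    congr 1
    · simp only [convPow, Matrix.one_apply]
      split_ifs
      · rw [integral_dirac]; simp
      · simp
    · rw [matConv, integral_finsetSum_measure fun k _ => hc k]
      exact Finset.sum_congr rfl fun k _ => integral_cexp_conv hz (hB i k) (hU k j)
  have h2 : (1 - laplace μ z) * laplace (renewalMeasure μ) z = 1 := by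
    rw [sub_mul, one_mul, sub_eq_iff_eq_add]
    exact h1
  exact (Matrix.inv_eq_right_inv h2).symm


/-! ### The distribution function of a measure on `[0, ∞)` -/

/-- The distribution function of a measure on `[0, ∞)`, as a function on the real line. -/
def distFun (m : Measure ℝ≥0) (t : ℝ) : ℝ := m.real {x : ℝ≥0 | (x : ℝ) ≤ t}

theorem distFun_of_neg (m : Measure ℝ≥0) {t : ℝ} (ht : t < 0) : distFun m t = 0 := by
  have : {x : ℝ≥0 | (x : ℝ) ≤ t} = ∅ := by
    ext x
    simpa using ht.trans_le x.coe_nonneg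
  simp [distFun, this]

theorem distFun_coe (m : Measure ℝ≥0) (t : ℝ≥0) : distFun m t = m.real (Set.Iic t) := by
  have : {x : ℝ≥0 | (x : ℝ) ≤ t} = Set.Iic t := by
    ext x
    simp
  rw [distFun, this]

theorem measure_Iic_lt_top {m : Measure ℝ≥0} [IsLocallyFiniteMeasure m] (t : ℝ≥0) :
    m (Set.Iic t) < ⊤ := by
  rw [← Set.Icc_bot]
  exact isCompact_Icc.measure_lt_top

theorem monotone_distFun (m : Measure ℝ≥0) [IsLocallyFiniteMeasure m] : Monotone (distFun m) := by
  intro s t hst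
  refine measureReal_mono (fun x hx => le_trans hx hst) (ne_of_lt ?_)
  refine lt_of_le_of_lt (measure_mono fun x hx => ?_) (measure_Iic_lt_top (m := m) t.toNNReal)
  exact NNReal.le_toNNReal_of_coe_le hx

/-- Fubini on {x ≤ t}, with ∫_x^∞ e^{-zt} dt = e^{-zx}/z. The resulting 1/z is the only source of
decay along vertical lines. -/
theorem integral_cexp_mul_distFun {m : Measure ℝ≥0} {B : ℝ} (hB0 : 0 < B)
    (hm : Integrable (fun x : ℝ≥0 => Real.exp (-(B * (x : ℝ)))) m) {z : ℂ} (hz : z.re = B) :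
    Integrable (fun t : ℝ => Complex.exp (-(z * t)) * distFun m t) ∧
    ∫ t : ℝ, Complex.exp (-(z * t)) * distFun m t =
      (∫ x : ℝ≥0, Complex.exp (-(z * ((x : ℝ) : ℂ))) ∂m) / z := by
  have := isLocallyFiniteMeasure_of_integrable hm
  set A : Set (ℝ × ℝ≥0) := {q | (q.2 : ℝ) ≤ q.1} with hA
  have hAm : MeasurableSet A := measurableSet_le (by fun_prop) (by fun_prop)
  set F : ℝ → ℝ≥0 → ℂ := fun t x => A.indicator (fun q => Complex.exp (-(z * q.1))) (t, x) with hF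
  have hsec : ∀ x : ℝ≥0, ∀ t : ℝ, F t x =
      (Set.Ici (x : ℝ)).indicator (fun t : ℝ => Complex.exp (-(z * t))) t := by
    intro x t
    by_cases h : (x : ℝ) ≤ t
    · simp [hF, hA, Set.indicator, h]
    · simp [hF, hA, Set.indicator, h]
  have hz' : (-z).re < 0 := by simpa [hz] using hB0
  have hexpi : ∀ x : ℝ, IntegrableOn (fun t : ℝ => Complex.exp (-(z * t))) (Set.Ici x) := by
    intro x
    rw [integrableOn_Ici_iff_integrableOn_Ioi]
    simpa [neg_mul] using integrableOn_exp_mul_complex_Ioi hz' x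
  have hnorm : ∀ x : ℝ≥0, ∫ t : ℝ, ‖F t x‖ = Real.exp (-(B * (x : ℝ))) / B := by
    intro x
    have e : ∀ t : ℝ, ‖F t x‖ = (Set.Ici (x : ℝ)).indicator (fun t : ℝ => Real.exp (-B * t)) t := by
      intro t
      rw [hsec, norm_indicator_eq_indicator_norm]
      congr 1
      funext t
      rw [Complex.norm_exp]
      simp [hz]
    simp_rw [e]
    rw [integral_indicator measurableSet_Ici, integral_Ici_eq_integral_Ioi,
      integral_exp_mul_Ioi (by linarith)]
    rw [neg_div_neg_eq, neg_mul]
  have hFm : AEStronglyMeasurable (Function.uncurry F) (volume.prod m) := by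
    have : Measurable (Function.uncurry F) := by
      refine Measurable.indicator ?_ hAm
      fun_prop
    exact this.aestronglyMeasurable
  have hFi : Integrable (Function.uncurry F) (volume.prod m) := by
    rw [integrable_prod_iff' hFm]
    refine ⟨ae_of_all _ fun x => ?_, ?_⟩
    · change Integrable (fun t => F t x)
      simp_rw [hsec]
      exact (integrable_indicator_iff measurableSet_Ici).2 (hexpi x)
    · change Integrable (fun x : ℝ≥0 => ∫ t : ℝ, ‖F t x‖) m
      simp_rw [hnorm]
      exact hm.div_const B
  have hx : ∀ t : ℝ, ∫ x, F t x ∂m = Complex.exp (-(z * t)) * distFun m t := by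
    intro t
    have e : ∀ x : ℝ≥0, F t x = {x : ℝ≥0 | (x : ℝ) ≤ t}.indicator
        (fun _ => Complex.exp (-(z * t))) x := by
      intro x
      by_cases h : (x : ℝ) ≤ t
      · simp [hF, hA, Set.indicator, h]
      · simp [hF, hA, Set.indicator, h]
    simp_rw [e]
    rw [integral_indicator_const _ (measurableSet_le (by fun_prop) (by fun_prop))]
    simp [distFun, mul_comm]
  have hi := hFi.integral_prod_left
  simp only [Function.uncurry_apply_pair, hx] at hi
  refine ⟨hi, ?_⟩
  have hsw := integral_integral_swap hFi
  simp only [hx] at hsw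
  rw [hsw, ← integral_div]
  refine integral_congr_ae (ae_of_all _ fun x => ?_)
  simp only
  simp_rw [hsec]
  rw [integral_indicator measurableSet_Ici, integral_Ici_eq_integral_Ioi]
  have := integral_exp_mul_complex_Ioi hz' x
  simp only [neg_mul] at this
  rw [this, neg_div_neg_eq]

/-! ### Pole orders -/

theorem conj_laplace (μ : MeasureMatrix p) (z : ℂ) :
    laplace μ (starRingEnd ℂ z) = (laplace μ z).map (starRingEnd ℂ) := by
  ext i j
  simp only [laplace, Matrix.of_apply, Matrix.map_apply]
  rw [← integral_conj]
  refine integral_congr_ae (ae_of_all _ fun x => ?_)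
  simp only
  rw [← Complex.exp_conj]
  simp

theorem conj_one_sub_laplace (μ : MeasureMatrix p) (z : ℂ) :
    1 - laplace μ (starRingEnd ℂ z) = (starRingEnd ℂ).mapMatrix (1 - laplace μ z) := by
  rw [map_sub, map_one, conj_laplace]
  rfl

theorem conj_mem_roots {μ : MeasureMatrix p} {z : ℂ} (h : z ∈ roots μ) :
    starRingEnd ℂ z ∈ roots μ := by
  refine ⟨fun i j => by simpa using h.1 i j, ?_⟩
  rw [conj_one_sub_laplace, ← RingHom.map_det, h.2, map_zero]

theorem conj_inv_one_sub_laplace (μ : MeasureMatrix p) (z : ℂ) (i j : Fin p) :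
    (1 - laplace μ (starRingEnd ℂ z))⁻¹ i j = starRingEnd ℂ ((1 - laplace μ z)⁻¹ i j) := by
  rw [inv_apply_eq, inv_apply_eq, conj_one_sub_laplace, ← RingHom.map_det, ← RingHom.map_adjugate,
    map_mul, map_inv₀]
  rfl

theorem analyticAt_conj_conj {h : ℂ → ℂ} {a : ℂ} (hh : AnalyticAt ℂ h a) :
    AnalyticAt ℂ (fun z => starRingEnd ℂ (h (starRingEnd ℂ z))) (starRingEnd ℂ a) := by
  rw [Complex.analyticAt_iff_eventually_differentiableAt] at hh ⊢
  have : Tendsto (starRingEnd ℂ) (𝓝 (starRingEnd ℂ a)) (𝓝 a) := by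
    have := (Complex.continuous_conj.tendsto (starRingEnd ℂ a))
    simpa using this
  filter_upwards [this.eventually hh] with z hz
  have := hz.conj_conj
  simpa [Function.comp_def] using this

theorem poleSet_conj {μ : MeasureMatrix p} {a : ℂ} {k : ℕ}
    (h : ∀ i j, ∃ h : ℂ → ℂ, AnalyticAt ℂ h a ∧
      ∀ᶠ z in 𝓝[≠] a, (z - a) ^ k * (1 - laplace μ z)⁻¹ i j = h z) :
    ∀ i j, ∃ h : ℂ → ℂ, AnalyticAt ℂ h (starRingEnd ℂ a) ∧
      ∀ᶠ z in 𝓝[≠] (starRingEnd ℂ a),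
        (z - starRingEnd ℂ a) ^ k * (1 - laplace μ z)⁻¹ i j = h z := by
  intro i j
  obtain ⟨g, hg, he⟩ := h i j
  refine ⟨_, analyticAt_conj_conj hg, ?_⟩
  have ht : Tendsto (starRingEnd ℂ) (𝓝[≠] (starRingEnd ℂ a)) (𝓝[≠] a) := by
    refine tendsto_nhdsWithin_iff.2 ⟨?_, ?_⟩
    · have := (Complex.continuous_conj.tendsto (starRingEnd ℂ a))
      simp only [Complex.conj_conj] at this
      exact this.mono_left nhdsWithin_le_nhds
    · filter_upwards [self_mem_nhdsWithin] with z hz hza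
      exact hz (by rw [Set.mem_singleton_iff] at hza ⊢; rw [← hza, Complex.conj_conj])
  filter_upwards [ht.eventually he] with z hz
  rw [← hz, conj_inv_one_sub_laplace]
  simp

theorem poleOrder_conj (μ : MeasureMatrix p) (a : ℂ) :
    poleOrder μ (starRingEnd ℂ a) = poleOrder μ a := by
  unfold poleOrder
  by_cases h : a ∈ roots μ
  · rw [if_pos h, if_pos (conj_mem_roots h)]
    congr 1
    ext k
    refine ⟨fun hk => ?_, fun hk => poleSet_conj hk⟩
    have := poleSet_conj hk
    simp only [Complex.conj_conj] at this
    exact this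
  · rw [if_neg h, if_neg]
    intro h'
    have := conj_mem_roots h'
    rw [Complex.conj_conj] at this
    exact h this

/-- At an isolated root, the resolvent has a pole whose order is `poleOrder`. -/
theorem poleOrder_spec {μ : MeasureMatrix p} {σ : ℝ}
    (hσ : ∀ i j, Integrable (fun x : ℝ≥0 => Real.exp (-(σ * (x : ℝ)))) (μ i j))
    {a : ℂ} (ha : a ∈ roots μ) (hre : σ < a.re)
    (hiso : ∀ᶠ z in 𝓝[≠] a, (1 - laplace μ z).det ≠ 0) (i j : Fin p) :
    ∃ h : ℂ → ℂ, AnalyticAt ℂ h a ∧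
      ∀ᶠ z in 𝓝[≠] a, (z - a) ^ poleOrder μ a * (1 - laplace μ z)⁻¹ i j = h z := by
  have hnear : ∀ᶠ z : ℂ in 𝓝 a, σ < z.re :=
    Complex.continuous_re.continuousAt.eventually (lt_mem_nhds hre)
  have hdet : AnalyticAt ℂ (fun z => (1 - laplace μ z).det) a := by
    rw [Complex.analyticAt_iff_eventually_differentiableAt]
    filter_upwards [hnear] with z hz
    exact differentiableAt_det fun i j => differentiableAt_one_sub_laplace hσ hz i j
  have hadj : ∀ i j, AnalyticAt ℂ (fun z => (1 - laplace μ z).adjugate i j) a := by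
    intro i j
    rw [Complex.analyticAt_iff_eventually_differentiableAt]
    filter_upwards [hnear] with z hz
    exact differentiableAt_adjugate (fun i j => differentiableAt_one_sub_laplace hσ hz i j) i j
  have hne : ¬ ∀ᶠ z in 𝓝 a, (1 - laplace μ z).det = 0 := by
    intro h
    obtain ⟨z, h1, h2⟩ := ((h.filter_mono nhdsWithin_le_nhds).and hiso).exists
    exact h2 h1
  obtain ⟨k, g, hg, hg0, hgk⟩ := hdet.exists_eventuallyEq_pow_smul_nonzero_iff.2 hne
  -- The finite order of vanishing of the determinant is admissible, as the inverse is adjugate over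
  -- determinant. Nonemptiness matters: the infimum of an empty set would be 0 by convention.
  have hmem : {k : ℕ | ∀ i j, ∃ h : ℂ → ℂ, AnalyticAt ℂ h a ∧
      ∀ᶠ z in 𝓝[≠] a, (z - a) ^ k * (1 - laplace μ z)⁻¹ i j = h z}.Nonempty := by
    refine ⟨k, fun i j => ⟨fun z => (g z)⁻¹ * (1 - laplace μ z).adjugate i j,
      (hg.inv hg0).mul (hadj i j), ?_⟩⟩
    filter_upwards [hgk.filter_mono nhdsWithin_le_nhds, self_mem_nhdsWithin] with z hz hza
    have hza' : (z - a) ^ k ≠ 0 := pow_ne_zero _ (sub_ne_zero.2 hza)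
    rw [inv_apply_eq, hz, smul_eq_mul, mul_inv]
    field_simp
  have := Nat.sInf_mem hmem
  rw [poleOrder, if_pos ha]
  exact this i j


/-! ### Expansion of the renewal measure -/

/-- Subtracting principal parts preserves linear decay in a vertical strip. -/
theorem exists_strip_bound {F H : ℂ → ℂ} {S : Finset ℂ} {n : ℂ → ℕ} {c : ℂ → ℕ → ℂ} {θ B T A : ℝ}
    (hd : ∀ z : ℂ, θ ≤ z.re → z.re ≤ B → DifferentiableAt ℂ H z)
    (hH : ∀ z ∉ S, H z = F z - ∑ s ∈ S, ∑ k ∈ Finset.range (n s), c s k / (z - s) ^ (k + 1))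
    (hF : ∀ z : ℂ, θ ≤ z.re → z.re ≤ B → T < |z.im| → ‖F z‖ ≤ A / |z.im|) :
    ∃ K : ℝ, ∀ z : ℂ, θ ≤ z.re → z.re ≤ B → ‖H z‖ ≤ K / (1 + |z.im|) := by
  set D := ∑ s ∈ S, ∑ k ∈ Finset.range (n s), ‖c s k‖ with hD
  -- Above height R every pole is at distance at least |Im z|/2 ≥ 1, so each term of a principal
  -- part is at most 2/|Im z| times its coefficient.
  set R := 2 + 2 * ∑ s ∈ S, |s.im| with hR
  set T₁ := max T R with hT₁
  have hR2 : 2 ≤ R := by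
    have : 0 ≤ ∑ s ∈ S, |s.im| := Finset.sum_nonneg fun _ _ => abs_nonneg _
    linarith
  have hD0 : 0 ≤ D := Finset.sum_nonneg fun _ _ => Finset.sum_nonneg fun _ _ => norm_nonneg _
  have hcomp : IsCompact (Set.Icc θ B ×ℂ Set.Icc (-T₁) T₁) := isCompact_Icc.reProdIm isCompact_Icc
  obtain ⟨K₀, hK₀⟩ := hcomp.exists_bound_of_continuousOn (f := H) fun z hz =>
    (hd z hz.1.1 hz.1.2).continuousAt.continuousWithinAt
  refine ⟨max (|K₀| * (1 + T₁)) (2 * (|A| + 2 * D)), fun z h1 h2 => ?_⟩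
  rw [le_div_iff₀ (by positivity)]
  by_cases hz : |z.im| ≤ T₁
  · refine le_trans ?_ (le_max_left _ _)
    have := hK₀ z ⟨⟨h1, h2⟩, abs_le.1 hz⟩
    gcongr
    exact this.trans (le_abs_self _)
  · refine le_trans ?_ (le_max_right _ _)
    push Not at hz
    have hzT : T < |z.im| := (le_max_left _ _).trans_lt hz
    have hzR : R < |z.im| := (le_max_right _ _).trans_lt hz
    have hz0 : 0 < |z.im| := by linarith
    have hsim : ∀ s ∈ S, 2 * |s.im| + 2 < |z.im| := fun s hs => by
      have := Finset.single_le_sum (f := fun s : ℂ => |s.im|) (fun _ _ => abs_nonneg _) hs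
      linarith
    have hzS : z ∉ S := fun h => by
      have := hsim z h
      linarith
    have hdist : ∀ s ∈ S, |z.im| / 2 ≤ ‖z - s‖ := fun s hs => by
      have e1 := Complex.abs_im_le_norm (z - s)
      rw [Complex.sub_im] at e1
      have := abs_sub_abs_le_abs_sub z.im s.im
      linarith [hsim s hs, abs_nonneg s.im]
    have hP : ‖∑ s ∈ S, ∑ k ∈ Finset.range (n s), c s k / (z - s) ^ (k + 1)‖ ≤
        D * (2 / |z.im|) := by
      rw [hD, Finset.sum_mul]
      refine (norm_sum_le _ _).trans (Finset.sum_le_sum fun s hs => ?_)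
      rw [Finset.sum_mul]
      refine (norm_sum_le _ _).trans (Finset.sum_le_sum fun k _ => ?_)
      rw [norm_div, norm_pow, div_eq_mul_inv]
      gcongr
      rw [← inv_div]
      refine inv_anti₀ (by positivity) ?_
      have e2 := hdist s hs
      have e3 : 1 ≤ ‖z - s‖ := by linarith
      calc |z.im| / 2 ≤ ‖z - s‖ := e2
        _ = ‖z - s‖ ^ 1 := (pow_one _).symm
        _ ≤ _ := pow_le_pow_right₀ e3 (by omega)
    have hHz : ‖H z‖ ≤ (|A| + 2 * D) / |z.im| := by
      rw [hH z hzS]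
      refine (norm_sub_le _ _).trans ((add_le_add (hF z h1 h2 hzT) hP).trans ?_)
      rw [add_div]
      gcongr
      · exact le_abs_self _
      · apply le_of_eq; ring
    calc ‖H z‖ * (1 + |z.im|) ≤ (|A| + 2 * D) / |z.im| * (2 * |z.im|) := by
          gcongr; linarith
      _ = 2 * (|A| + 2 * D) := by field_simp

open Classical in
/-- The poles of `(I - Lμ(z))⁻¹ / z` in the half-plane `Re z ≥ θ`. -/
def poles (Λ : Finset ℂ) (θ : ℝ) : Finset ℂ := if θ ≤ 0 then insert 0 Λ else Λ

open Classical in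
/-- The orders of the poles of `(I - Lμ(z))⁻¹ / z`. -/
def orders (μ : MeasureMatrix p) (a : ℂ) : ℕ := poleOrder μ a + if a = 0 then 1 else 0

theorem subset_poles (Λ : Finset ℂ) (θ : ℝ) : Λ ⊆ poles Λ θ := by
  unfold poles
  split_ifs
  · exact Finset.subset_insert _ _
  · exact subset_rfl

/-- If `Re z ≥ θ` and `z` is not one of the roots to the right of `θ`, then the characteristic
determinant does not vanish at `z`. -/
theorem det_ne_zero_of_notMem {μ : MeasureMatrix p} {θ σ : ℝ} (hσθ : σ ≤ θ)
    (hσ : ∀ i j, Integrable (fun x : ℝ≥0 => Real.exp (-(σ * (x : ℝ)))) (μ i j))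
    (hsup : ResolventBoundedOn μ θ) {z : ℂ} (hz : θ ≤ z.re) (hzΛ : z ∉ rootsRight μ θ) :
    (1 - laplace μ z).det ≠ 0 := by
  rcases hz.eq_or_lt with h | h
  · have := hsup.1 z.im
    have e : (θ : ℂ) + z.im * Complex.I = z := by
      rw [h]; exact Complex.re_add_im z
    rw [e] at this
    exact this.ne_zero
  · intro h0
    exact hzΛ ⟨⟨mem_laplaceDomain hσ (hσθ.trans hz), h0⟩, h⟩

/-- Three cases: at a nonzero root, 1/z is analytic; at a root equal to 0, it adds one to the order;
at 0 when it is not a root, the resolvent is analytic and the pole is simple. -/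
theorem exists_pole_extension {μ : MeasureMatrix p} {θ σ : ℝ} (hσθ : σ < θ)
    (hσ : ∀ i j, Integrable (fun x : ℝ≥0 => Real.exp (-(σ * (x : ℝ)))) (μ i j))
    (hsup : ResolventBoundedOn μ θ) (hfin : (rootsRight μ θ).Finite) (i j : Fin p)
    {s : ℂ} (hs : s ∈ poles hfin.toFinset θ) :
    ∃ h : ℂ → ℂ, AnalyticAt ℂ h s ∧
      ∀ᶠ z in 𝓝[≠] s, (z - s) ^ orders μ s * ((1 - laplace μ z)⁻¹ i j / z) = h z := by
  classical
  by_cases hsΛ : s ∈ rootsRight μ θ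
  · have hiso : ∀ᶠ z in 𝓝[≠] s, (1 - laplace μ z).det ≠ 0 := by
      have e1 : ∀ᶠ z : ℂ in 𝓝 s, θ < z.re :=
        Complex.continuous_re.continuousAt.eventually (lt_mem_nhds hsΛ.2)
      have e2 : ∀ᶠ z : ℂ in 𝓝 s, z ∉ hfin.toFinset.erase s :=
        (hfin.toFinset.erase s).finite_toSet.isClosed.isOpen_compl.mem_nhds
          (Finset.notMem_erase s _)
      filter_upwards [e1.filter_mono nhdsWithin_le_nhds, e2.filter_mono nhdsWithin_le_nhds,
        self_mem_nhdsWithin] with z h1 h2 h3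
      refine det_ne_zero_of_notMem hσθ.le hσ hsup h1.le fun hz => h2 ?_
      exact Finset.mem_erase.2 ⟨h3, hfin.mem_toFinset.2 hz⟩
    obtain ⟨h, hh, he⟩ := poleOrder_spec hσ hsΛ.1 (hσθ.trans hsΛ.2) hiso i j
    by_cases hs0 : s = 0
    · refine ⟨h, hh, ?_⟩
      filter_upwards [he, self_mem_nhdsWithin] with z hz hzs
      have hz0 : z ≠ 0 := by rw [hs0] at hzs; exact hzs
      rw [← hz, orders, if_pos hs0, hs0, sub_zero]
      field_simp
      ring
    · refine ⟨fun z => h z / z, hh.div analyticAt_id hs0, ?_⟩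
      filter_upwards [he] with z hz
      rw [← hz, orders, if_neg hs0, add_zero, mul_div_assoc]
  · have hθ0 : θ ≤ 0 ∧ s = 0 := by
      unfold poles at hs
      split_ifs at hs with hθ
      · rcases Finset.mem_insert.1 hs with h | h
        · exact ⟨hθ, h⟩
        · exact absurd (hfin.mem_toFinset.1 h) hsΛ
      · exact absurd (hfin.mem_toFinset.1 hs) hsΛ
    obtain ⟨hθ0, rfl⟩ := hθ0
    have hdet := det_ne_zero_of_notMem hσθ.le hσ hsup (z := 0) (by simpa using hθ0) hsΛ
    have hpo : poleOrder μ 0 = 0 := by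
      rw [poleOrder, if_neg]
      exact fun h => hdet h.2
    have hnear : ∀ᶠ z : ℂ in 𝓝 0, σ < z.re :=
      Complex.continuous_re.continuousAt.eventually (lt_mem_nhds (by simpa using hσθ.trans_le hθ0))
    refine ⟨fun z => ((1 - laplace μ z).det)⁻¹ * (1 - laplace μ z).adjugate i j, ?_, ?_⟩
    · refine AnalyticAt.mul (AnalyticAt.inv ?_ hdet) ?_ <;>
        rw [Complex.analyticAt_iff_eventually_differentiableAt]
      · filter_upwards [hnear] with z hz
        exact differentiableAt_det fun i j => differentiableAt_one_sub_laplace hσ hz i j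
      · filter_upwards [hnear] with z hz
        exact differentiableAt_adjugate
          (fun i j => differentiableAt_one_sub_laplace hσ hz i j) i j
    · filter_upwards [self_mem_nhdsWithin] with z hz
      have hz0 : z ≠ 0 := hz
      rw [orders, if_pos rfl, hpo, ← inv_apply_eq]
      simp only [sub_zero, zero_add, pow_one]
      field_simp

/-- The entries of the renewal function are exponential polynomials up to `O(t e^{θ t})`. -/
theorem renewalMeasure_expansion {μ : MeasureMatrix p} {θ : ℝ}
    (hA1 : (θ : ℂ) ∈ interior (laplaceDomain μ)) (hA2 : spectralRadius ℂ (massAtZero μ) < 1)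
    (hsup : ResolventBoundedOn μ θ) (hfin : (rootsRight μ θ).Finite) :
    (∀ i j, IsLocallyFiniteMeasure (renewalMeasure μ i j)) ∧
    ∀ i j, ∃ c : ℂ → ℕ → ℂ,
      (fun t : ℝ => (distFun (renewalMeasure μ i j) t : ℂ) -
        expPoly (poles hfin.toFinset θ) (orders μ) c t)
        =O[atTop] fun t : ℝ => t * Real.exp (θ * t) := by
  obtain ⟨δ, hδ, hσ⟩ := exists_integrable_of_mem_interior hA1
  set σ := θ - δ with hσdef
  have hσθ : σ < θ := by linarith
  set S := poles hfin.toFinset θ with hS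
  -- choose `B` far to the right
  have hdetlim : Tendsto (fun z => (1 - laplace μ z).det) (comap Complex.re atTop)
      (𝓝 (1 - massAtZero μ).det) :=
    ((continuous_id.matrix_det).tendsto _).comp (tendsto_const_nhds.sub (tendsto_laplace hσ))
  have hm0 := norm_pos_iff.2 (isUnit_det_one_sub_massAtZero hA2)
  have hright : ∀ᶠ z in comap Complex.re atTop,
      ‖(1 - massAtZero μ).det‖ / 2 ≤ ‖(1 - laplace μ z).det‖ :=
    (hdetlim.norm.eventually (lt_mem_nhds (half_lt_self hm0))).mono fun z hz => hz.le
  have hbdd := eventually_exists_bound_sum_pow_laplace hσ hA2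
  obtain ⟨B₀, hB₀⟩ := eventually_atTop.1 (eventually_comap.1 (hright.and hbdd))
  obtain ⟨B, hBB₀, hB0, hBθ, hBS⟩ : ∃ B : ℝ, B₀ ≤ B ∧ 0 < B ∧ θ < B ∧ ∀ s ∈ S, s.re < B := by
    have h1 : ∀ᶠ B : ℝ in atTop, ∀ s ∈ S, s.re < B :=
      (Finset.eventually_all S).2 fun s _ => eventually_gt_atTop _
    obtain ⟨B, hB⟩ := ((eventually_ge_atTop B₀).and ((eventually_gt_atTop 0).and
      ((eventually_gt_atTop θ).and h1))).exists
    exact ⟨B, hB⟩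
  have hBint : ∀ i j, Integrable (fun x : ℝ≥0 => Real.exp (-(B * (x : ℝ)))) (μ i j) := fun i j =>
    integrable_exp_mono (hσθ.trans hBθ).le (hσ i j)
  have hU := integrable_renewalMeasure hBint (hB₀ B hBB₀ (B : ℂ) (by simp)).2
  refine ⟨fun i j => isLocallyFiniteMeasure_of_integrable (hU i j), fun i j => ?_⟩
  have := isLocallyFiniteMeasure_of_integrable (hU i j)
  -- lower bound for the determinant
  obtain ⟨K, hK⟩ := exists_norm_one_sub_laplace_le hσ
  obtain ⟨M, hM⟩ := exists_bound_of_entries (p := p) (f := fun A => A.det) (by fun_prop) K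
  obtain ⟨M', hM'⟩ := exists_bound_of_entries (p := p) (f := fun A => A.adjugate i j)
    (continuous_id.matrix_adjugate.matrix_elem i j) K
  obtain ⟨c₀, hc₀, hline⟩ := exists_le_norm_det_of_resolventBoundedOn hsup
  -- The sum of all |Im s| is a height that no root to the right of θ exceeds.
  obtain ⟨c', -, T', hc', -, -, -, hlow⟩ := exists_lower_bound_halfPlane
    (h := fun z => (1 - laplace μ z).det) (θ := θ) (δ := δ) (M := M)
    (c := min c₀ (‖(1 - massAtZero μ).det‖ / 2)) (B := B₀)
    (T := ∑ s ∈ S, |s.im|) hδ (by positivity)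
    (fun z hz => differentiableAt_det fun i j => differentiableAt_one_sub_laplace hσ hz i j)
    (fun z hz => hM _ (hK z hz.le))
    (fun η => (min_le_left _ _).trans (hline η))
    (fun z hz => (min_le_right _ _).trans (hB₀ z.re hz z rfl).1)
    (fun z hz hT => det_ne_zero_of_notMem hσθ.le hσ hsup hz.le fun hzΛ => by
      have hzS : z ∈ S := subset_poles _ _ (hfin.mem_toFinset.2 hzΛ)
      have := Finset.single_le_sum (f := fun s : ℂ => |s.im|) (fun _ _ => abs_nonneg _) hzS
      linarith)
  -- remove the principal parts
  obtain ⟨c, H, hHd, hH⟩ := exists_principalPart (F := fun z => (1 - laplace μ z)⁻¹ i j / z)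
    (S := S) (U := {z | θ ≤ z.re}) (n := orders μ)
    (fun z hz hzS => by
      have hz0 : z ≠ 0 := by
        rintro rfl
        have : θ ≤ 0 := hz
        exact hzS (by rw [hS, poles, if_pos this]; exact Finset.mem_insert_self _ _)
      have hdet := det_ne_zero_of_notMem hσθ.le hσ hsup hz fun hzΛ =>
        hzS (subset_poles _ _ (hfin.mem_toFinset.2 hzΛ))
      have hzσ : σ < z.re := hσθ.trans_le hz
      simp only [inv_apply_eq]
      exact (((differentiableAt_det fun i j => differentiableAt_one_sub_laplace hσ hzσ i j).inv
        hdet).mul (differentiableAt_adjugate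
          (fun i j => differentiableAt_one_sub_laplace hσ hzσ i j) i j)).div differentiableAt_id hz0)
    (fun s hs => exists_pole_extension hσθ hσ hsup hfin i j hs)
  -- At large heights the adjugate is bounded and the determinant bounded below, so the resolvent is
  -- bounded and 1/z gives the decay.
  obtain ⟨K', hK'⟩ := exists_strip_bound (θ := θ) (B := B) (T := max T' 0) (A := c'⁻¹ * M')
    (fun z h1 _ => hHd z h1) hH (fun z h1 _ hT => by
      have hT0 : 0 < |z.im| := (le_max_right _ _).trans_lt hT
      have h3 := hlow z h1 ((le_max_left _ _).trans_lt hT)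
      have h4 := hM' _ (hK z (hσθ.le.trans h1))
      rw [norm_div, inv_apply_eq, norm_mul, norm_inv]
      have hM'0 : 0 ≤ M' := (norm_nonneg _).trans h4
      refine div_le_div₀ (by positivity) ?_ hT0 (Complex.abs_im_le_norm z)
      gcongr)
  refine ⟨c, isBigO_sub_expPoly (f := distFun (renewalMeasure μ i j)) (H := H) (B := B) (K := K')
    (fun t ht => distFun_of_neg _ ht)
    (monotone_distFun _) hBθ hBS ?_ (fun z h1 _ => hHd z h1) hK' (fun z hz => ?_)⟩
  · have := (integral_cexp_mul_distFun hB0 (hU i j) (z := (B : ℂ)) (by simp)).1.re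
    refine this.congr (ae_of_all _ fun t => ?_)
    simp only [RCLike.re_to_complex]
    rw [← Complex.ofReal_mul, ← Complex.ofReal_neg, ← Complex.ofReal_exp, ← Complex.ofReal_mul,
      Complex.ofReal_re]
  · have hzS : z ∉ S := fun h => by
      have := hBS z h
      linarith
    rw [(integral_cexp_mul_distFun hB0 (hU i j) hz).2, hH z hzS, sub_add_cancel]
    congr 1
    have := congrFun (congrFun (laplace_renewalMeasure hBint hU hz.ge) i) j
    rw [← this]
    rfl


/-! ### Form and symmetry of the leading term -/

/-- The exponential polynomial of the expansion, for a single entry. -/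
def leadingTerm (μ : MeasureMatrix p) (Λ : Finset ℂ) (C : ℂ → ℕ → ℂ) (t : ℝ) : ℂ :=
  ∑ a ∈ Λ, Complex.exp (a * (t : ℂ)) * ∑ k ∈ Finset.range (poleOrder μ a), (t : ℂ) ^ k * C a k
    + (t : ℂ) ^ poleOrder μ 0 * C 0 (poleOrder μ 0)

open Classical in
/-- The coefficients of the expansion, read off from the principal parts at the poles in `S`. -/
def coeffOf (S : Finset ℂ) (c : ℂ → ℕ → ℂ) (a : ℂ) (k : ℕ) : ℂ :=
  if a ∈ S then c a k / k.factorial else 0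

/-- Both sides can differ only at 0. There the extra order contributes exactly t^{k(0)}, without
exponential factor; if 0 is not among the poles, the default value 0 of `coeffOf` removes this term.
-/
theorem leadingTerm_coeffOf {μ : MeasureMatrix p} {θ : ℝ} (hsup : ResolventBoundedOn μ θ)
    (hfin : (rootsRight μ θ).Finite) (c : ℂ → ℕ → ℂ) (t : ℝ) :
    leadingTerm μ hfin.toFinset (coeffOf (poles hfin.toFinset θ) c) t =
      expPoly (poles hfin.toFinset θ) (orders μ) c t := by
  classical
  set Λ := hfin.toFinset with hΛ
  set S := poles Λ θ with hS
  set g : ℂ → ℕ → ℂ := fun a k => (c a k / k.factorial) * ((t : ℂ) ^ k * Complex.exp (a * t))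
    with hg
  have h1 : ∀ a ∈ S, ∑ k ∈ Finset.range (orders μ a), g a k =
      ∑ k ∈ Finset.range (poleOrder μ a), g a k + if a = 0 then g 0 (poleOrder μ 0) else 0 := by
    intro a _
    unfold orders
    split_ifs with h
    · rw [Finset.sum_range_succ, h]
    · simp
  have h2 : ∑ a ∈ Λ, ∑ k ∈ Finset.range (poleOrder μ a), g a k =
      ∑ a ∈ S, ∑ k ∈ Finset.range (poleOrder μ a), g a k := by
    refine Finset.sum_subset (subset_poles _ _) fun a haS haΛ => ?_
    have hθa : θ ≤ 0 ∧ a = 0 := by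
      rw [hS] at haS
      unfold poles at haS
      split_ifs at haS with hθ
      · rcases Finset.mem_insert.1 haS with h | h
        · exact ⟨hθ, h⟩
        · exact absurd h haΛ
      · exact absurd haS haΛ
    obtain ⟨hθ, rfl⟩ := hθa
    have : poleOrder μ 0 = 0 := by
      rw [poleOrder, if_neg]
      intro h0
      -- For θ < 0 a root at 0 would belong to Λ; for θ = 0 it would lie on the line where I - Lμ is
      -- invertible.
      rcases hθ.lt_or_eq with hθ | hθ
      · exact haΛ (hfin.mem_toFinset.2 ⟨h0, by simpa using hθ⟩)
      · have := hsup.1 0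
        rw [hθ] at this
        simp only [Complex.ofReal_zero, zero_mul, add_zero] at this
        exact this.ne_zero h0.2
    rw [this]
    simp
  have h3 : ∀ a ∈ Λ, Complex.exp (a * (t : ℂ)) *
      ∑ k ∈ Finset.range (poleOrder μ a), (t : ℂ) ^ k * coeffOf S c a k =
      ∑ k ∈ Finset.range (poleOrder μ a), g a k := by
    intro a ha
    rw [Finset.mul_sum]
    refine Finset.sum_congr rfl fun k _ => ?_
    rw [coeffOf, if_pos (subset_poles _ _ ha), hg]
    ring
  rw [leadingTerm, Finset.sum_congr rfl h3, h2, expPoly]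
  have h4 : ∑ s ∈ S, ∑ k ∈ Finset.range (orders μ s),
      c s k / k.factorial * ((t : ℂ) ^ k * Complex.exp (s * t)) =
      ∑ s ∈ S, ∑ k ∈ Finset.range (orders μ s), g s k := rfl
  rw [h4, Finset.sum_congr rfl h1, Finset.sum_add_distrib, Finset.sum_ite_eq']
  congr 1
  rw [coeffOf, hg]
  split_ifs <;> simp [mul_comm]

/-- Replacing `C_{a,k}` by `(C_{a,k} + conj C_{ā,k}) / 2` takes the real part of the expansion. -/
theorem leadingTerm_symm {μ : MeasureMatrix p} {θ : ℝ} (hfin : (rootsRight μ θ).Finite)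
    (C : ℂ → ℕ → ℂ) (t : ℝ) :
    leadingTerm μ hfin.toFinset (fun a k => (C a k + starRingEnd ℂ (C (starRingEnd ℂ a) k)) / 2) t =
      (leadingTerm μ hfin.toFinset C t + starRingEnd ℂ (leadingTerm μ hfin.toFinset C t)) / 2 := by
  have h1 : starRingEnd ℂ (leadingTerm μ hfin.toFinset C t) =
      leadingTerm μ hfin.toFinset (fun a k => starRingEnd ℂ (C (starRingEnd ℂ a) k)) t := by
    unfold leadingTerm
    rw [map_add, map_sum]
    congr 1
    · refine Finset.sum_nbij' (starRingEnd ℂ) (starRingEnd ℂ) ?_ ?_ ?_ ?_ ?_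
      · intro a ha
        have ha := hfin.mem_toFinset.1 ha
        exact hfin.mem_toFinset.2 ⟨conj_mem_roots ha.1, by simpa using ha.2⟩
      · intro a ha
        have ha := hfin.mem_toFinset.1 ha
        exact hfin.mem_toFinset.2 ⟨conj_mem_roots ha.1, by simpa using ha.2⟩
      · intro a _; exact Complex.conj_conj a
      · intro a _; exact Complex.conj_conj a
      · intro a _
        rw [poleOrder_conj, map_mul, map_sum, ← Complex.exp_conj]
        simp
    · simp
  rw [h1]
  simp only [leadingTerm, add_div, mul_add, Finset.sum_add_distrib]
  simp only [mul_div_assoc', ← Finset.sum_div]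
  ring

/-- The expansion of the renewal function. -/
theorem renewalFunction_expansion {μ : MeasureMatrix p} {θ : ℝ}
    (hA1 : (θ : ℂ) ∈ interior (laplaceDomain μ)) (hA2 : spectralRadius ℂ (massAtZero μ) < 1)
    (hsup : ResolventBoundedOn μ θ) (hfin : (rootsRight μ θ).Finite) :
    (∀ (t : ℝ≥0) (i j : Fin p), renewalFunction μ t i j ≠ ⊤) ∧
    ∃ C : ℂ → ℕ → Matrix (Fin p) (Fin p) ℂ,
      (∀ (a : ℂ) (k : ℕ), C (starRingEnd ℂ a) k = (C a k).map (starRingEnd ℂ)) ∧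
      ∀ i j : Fin p,
        (fun t : ℝ≥0 => (((renewalFunction μ t i j).toReal : ℝ) : ℂ) -
          leadingTerm μ hfin.toFinset (fun a k => C a k i j) t)
          =O[atTop] fun t : ℝ≥0 => (t : ℝ) * Real.exp (θ * (t : ℝ)) := by
  obtain ⟨hloc, hexp⟩ := renewalMeasure_expansion hA1 hA2 hsup hfin
  refine ⟨fun t i j => ?_, ?_⟩
  · rw [renewalFunction_eq]
    exact (measure_Iic_lt_top t).ne
  choose c hc using hexp
  set D : Fin p → Fin p → ℂ → ℕ → ℂ := fun i j => coeffOf (poles hfin.toFinset θ) (c i j) with hD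
  refine ⟨fun a k => Matrix.of fun i j =>
    (D i j a k + starRingEnd ℂ (D i j (starRingEnd ℂ a) k)) / 2, fun a k => ?_, fun i j => ?_⟩
  · ext i j
    have h2 : starRingEnd ℂ 2 = 2 := Complex.conj_ofReal 2
    simp [add_comm, h2]
  · simp only [Matrix.of_apply]
    have h1 : (fun t : ℝ => (distFun (renewalMeasure μ i j) t : ℂ) -
        leadingTerm μ hfin.toFinset (D i j) t) =O[atTop] fun t : ℝ => t * Real.exp (θ * t) := by
      refine (hc i j).congr_left fun t => ?_
      rw [hD, leadingTerm_coeffOf hsup hfin]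
    have h2 : (fun t : ℝ => (distFun (renewalMeasure μ i j) t : ℂ) -
        leadingTerm μ hfin.toFinset
          (fun a k => (D i j a k + starRingEnd ℂ (D i j (starRingEnd ℂ a) k)) / 2) t)
        =O[atTop] fun t : ℝ => t * Real.exp (θ * t) := by
      refine IsBigO.trans ?_ h1
      refine IsBigO.of_bound 1 (Eventually.of_forall fun t => ?_)
      rw [leadingTerm_symm]
      set x : ℂ := (distFun (renewalMeasure μ i j) t : ℂ) with hx
      set y := leadingTerm μ hfin.toFinset (D i j) t
      -- As x is real, replacing y by its real part does not increase the distance to x.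
      have e : x - (y + starRingEnd ℂ y) / 2 = ((x - y) + starRingEnd ℂ (x - y)) / 2 := by
        rw [map_sub, hx, Complex.conj_ofReal]
        ring
      rw [e, norm_div, Complex.norm_ofNat, one_mul, div_le_iff₀ (by norm_num)]
      refine (norm_add_le _ _).trans (le_of_eq ?_)
      rw [Complex.norm_conj]
      ring
    have h3 := h2.comp_tendsto (NNReal.tendsto_coe_atTop.2 tendsto_id)
    refine h3.congr_left fun t => ?_
    simp only [Function.comp_apply, id]
    rw [distFun_coe, renewalFunction_eq]
    rfl


/-! ### Enumeration of the points of point measures -/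

/-- Infinitely many unit masses in the set would sum to ∞; a finite mass is therefore a number of
atoms. -/
theorem IsPointMeasure.exists_nat {m : Measure ℝ≥0} (hm : IsPointMeasure m) {A : Set ℝ≥0}
    (hA : MeasurableSet A) (hfin : m A ≠ ⊤) : ∃ n : ℕ, m A = n := by
  classical
  obtain ⟨-, I, x, rfl⟩ := hm
  rw [Measure.sum_apply _ hA] at hfin ⊢
  have hF := ENNReal.finite_const_le_of_tsum_ne_top hfin one_ne_zero
  have h01 : ∀ k : I, k ∉ hF.toFinset → Measure.dirac (x k) A = 0 := by
    intro k hk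
    rw [hF.mem_toFinset, Set.mem_ofPred_eq, Measure.dirac_apply' _ hA] at hk
    rw [Measure.dirac_apply' _ hA]
    by_cases h : x k ∈ A
    · simp [h] at hk
    · simp [h]
  have h11 : ∀ k ∈ hF.toFinset, Measure.dirac (x k) A = 1 := by
    intro k hk
    rw [hF.mem_toFinset, Set.mem_ofPred_eq, Measure.dirac_apply' _ hA] at hk
    rw [Measure.dirac_apply' _ hA]
    by_cases h : x k ∈ A
    · simp [h]
    · simp [h] at hk
  refine ⟨hF.toFinset.card, ?_⟩
  rw [tsum_eq_sum h01, Finset.sum_congr rfl h11]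
  simp

open Classical in
theorem IsPointMeasure.tsum_singleton {m : Measure ℝ≥0} (hm : IsPointMeasure m) (s : ℝ≥0) :
    ∑' x : ℝ≥0, (if x ≤ s then m {x} else 0) = m (Set.Iic s) := by
  obtain ⟨-, I, y, rfl⟩ := hm
  rw [Measure.sum_apply _ measurableSet_Iic]
  have h1 : ∀ x : ℝ≥0, (if x ≤ s then (Measure.sum fun k : I => Measure.dirac (y k)) {x} else 0) =
      ∑' k : I, if x ≤ s then Measure.dirac (y k) {x} else 0 := by
    intro x
    rw [Measure.sum_apply _ (measurableSet_singleton x)]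
    split_ifs <;> simp
  simp_rw [h1]
  rw [ENNReal.tsum_comm]
  refine tsum_congr fun k => ?_
  rw [tsum_eq_single (y k)]
  · simp [Set.indicator]
  · intro x hx
    have : y k ∉ ({x} : Set ℝ≥0) := fun h => hx (Set.mem_singleton_iff.1 h).symm
    simp [Measure.dirac_apply' _ (measurableSet_singleton x), this]

section

variable {ν : Fin p → Measure ℝ≥0}

/-- Right-continuity of the counting function, from local finiteness, means that the infimum
defining `childTime` is attained. -/
theorem childTime_le_iff (hν : ∀ j, IsLocallyFiniteMeasure (ν j)) (k : ℕ) (x : ℝ≥0) :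
    childTime ν k ≤ x ↔ ((k + 1 : ℕ) : ℝ≥0∞) ≤ ∑ j, ν j (Set.Iic x) := by
  refine ⟨fun h => ?_, fun h => iInf₂_le x h⟩
  have h1 : ∀ y : ℝ≥0, x < y → ((k + 1 : ℕ) : ℝ≥0∞) ≤ ∑ j, ν j (Set.Iic y) := by
    intro y hy
    have h2 : childTime ν k < y := h.trans_lt (by exact_mod_cast hy)
    simp only [childTime, iInf_lt_iff] at h2
    obtain ⟨t, ht, hty⟩ := h2
    refine ht.trans (Finset.sum_le_sum fun j _ => measure_mono (Set.Iic_subset_Iic.2 ?_))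
    exact_mod_cast hty.le
  obtain ⟨u, hu1, hu2, hu3⟩ := exists_seq_strictAnti_tendsto x
  have h3 : Tendsto (fun n => ∑ j, ν j (Set.Iic (u n))) atTop (𝓝 (∑ j, ν j (Set.Iic x))) := by
    refine tendsto_finsetSum _ fun j _ => ?_
    have e : Set.Iic x = ⋂ n, Set.Iic (u n) := by
      ext y
      simp only [Set.mem_Iic, Set.mem_iInter]
      exact ⟨fun h n => h.trans (hu2 n).le, fun h => ge_of_tendsto' hu3 h⟩
    rw [e]
    exact tendsto_measure_iInter_atTop (fun n => measurableSet_Iic.nullMeasurableSet)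
      (fun a b hab => Set.Iic_subset_Iic.2 (hu1.antitone hab)) ⟨0, (measure_Iic_lt_top _).ne⟩
  exact ge_of_tendsto' h3 fun n => h1 _ (hu2 n)

theorem exists_nat_sum (hν : ∀ j, IsPointMeasure (ν j)) (T : Finset (Fin p)) {A : Set ℝ≥0}
    (hA : MeasurableSet A) {x : ℝ≥0} (hAx : A ⊆ Set.Iic x) :
    ∃ n : ℕ, ∑ l ∈ T, ν l A = n := by
  have h : ∀ l, ∃ n : ℕ, ν l A = n := fun l => by
    have := (hν l).1
    exact (hν l).exists_nat hA (ne_of_lt ((measure_mono hAx).trans_lt (measure_Iic_lt_top x)))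
  choose n hn using h
  refine ⟨∑ l ∈ T, n l, ?_⟩
  simp [hn]

/-- Counts are integers, so fewer than k + 1 means at most k; letting y increase to x turns closed
intervals into the half-open one. -/
theorem le_childTime_iff (hν : ∀ j, IsPointMeasure (ν j)) (k : ℕ) (x : ℝ≥0) :
    (x : ℝ≥0∞) ≤ childTime ν k ↔ ∑ j, ν j (Set.Iio x) ≤ k := by
  have hloc := fun j => (hν j).1
  have h0 : (x : ℝ≥0∞) ≤ childTime ν k ↔ ∀ y < x, ∑ j, ν j (Set.Iic y) ≤ k := by
    have e : ∀ y : ℝ≥0, ∑ j, ν j (Set.Iic y) ≤ k ↔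
        ¬ ((k + 1 : ℕ) : ℝ≥0∞) ≤ ∑ j, ν j (Set.Iic y) := by
      intro y
      obtain ⟨n, hn⟩ := exists_nat_sum hν Finset.univ measurableSet_Iic (le_refl (Set.Iic y))
      rw [hn]
      norm_cast
      omega
    simp_rw [e, ← childTime_le_iff hloc]
    refine ⟨fun h y hy h' => ?_, fun h => ?_⟩
    · exact absurd (h.trans h') (not_le.2 (by exact_mod_cast hy))
    · by_contra hcon
      push Not at hcon
      obtain ⟨y, hy⟩ : ∃ y : ℝ≥0, (y : ℝ≥0∞) = childTime ν k :=
        ⟨_, ENNReal.coe_toNNReal (ne_top_of_lt hcon)⟩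
      rw [← hy] at hcon
      exact h y (by exact_mod_cast hcon) hy.ge
  rw [h0]
  refine ⟨fun h => ?_, fun h y hy => le_trans (Finset.sum_le_sum fun j _ =>
    measure_mono (Set.Iic_subset_Iio.2 hy)) h⟩
  rcases eq_or_ne x 0 with rfl | hx
  · simp
  · obtain ⟨u, hu1, hu2, hu3⟩ := exists_seq_strictMono_tendsto' (pos_iff_ne_zero.2 hx)
    have h3 : Tendsto (fun n => ∑ j, ν j (Set.Iic (u n))) atTop (𝓝 (∑ j, ν j (Set.Iio x))) := by
      refine tendsto_finsetSum _ fun j _ => ?_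
      have e : Set.Iio x = ⋃ n, Set.Iic (u n) := by
        ext y
        simp only [Set.mem_Iio, Set.mem_iUnion, Set.mem_Iic]
        refine ⟨fun h => ?_, fun ⟨n, hn⟩ => hn.trans_lt (hu2 n).2⟩
        obtain ⟨n, hn⟩ := (hu3.eventually (lt_mem_nhds h)).exists
        exact ⟨n, hn.le⟩
      rw [e]
      exact tendsto_measure_iUnion_atTop fun a b hab => Set.Iic_subset_Iic.2 (hu1.monotone hab)
    exact le_of_tendsto' h3 fun n => h _ (hu2 n).2

/-- The children of type j born at x occupy a block of consecutive numbers. It begins after all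
earlier births and the simultaneous births of smaller type, and its length is the mass of ν j at x.
-/
theorem childTime_eq_and_childType_eq_iff (hν : ∀ j, IsPointMeasure (ν j)) (i₀ j : Fin p) (k : ℕ)
    (x : ℝ≥0) :
    (childTime ν k = x ∧ childType ν i₀ k = j) ↔
      ∑ l, ν l (Set.Iio x) + ∑ l ∈ Finset.Iio j, ν l {x} ≤ k ∧
      ((k + 1 : ℕ) : ℝ≥0∞) ≤ ∑ l, ν l (Set.Iio x) + ∑ l ∈ Finset.Iic j, ν l {x} := by
  classical
  have hloc := fun j => (hν j).1
  obtain ⟨N', hN'⟩ := exists_nat_sum hν Finset.univ measurableSet_Iio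
    (Set.Iio_subset_Iic_self (a := x))
  have hT : ∀ T : Finset (Fin p), ∃ n : ℕ, ∑ l ∈ T, ν l {x} = n := fun T =>
    exists_nat_sum hν T (measurableSet_singleton x)
      (Set.singleton_subset_iff.2 (Set.mem_Iic.2 (le_refl x)))
  choose s hs using hT
  have hN : ∑ l, ν l (Set.Iic x) = ((N' + s Finset.univ : ℕ) : ℝ≥0∞) := by
    push_cast
    rw [← hN', ← hs, ← Finset.sum_add_distrib]
    refine Finset.sum_congr rfl fun l _ => ?_
    rw [← Set.Iio_union_right, measure_union (by simp) (measurableSet_singleton x)]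
  have hmono : ∀ T T' : Finset (Fin p), T ⊆ T' → s T ≤ s T' := by
    intro T T' h
    have := Finset.sum_le_sum_of_subset (f := fun l => ν l {x}) h
    rw [hs, hs] at this
    exact_mod_cast this
  have htime : childTime ν k = x ↔ N' ≤ k ∧ k + 1 ≤ N' + s Finset.univ := by
    rw [le_antisymm_iff, childTime_le_iff hloc, le_childTime_iff hν, hN', hN, and_comm]
    norm_cast
  have hset : childTime ν k = x → ∀ j, j ∈ (Finset.univ.filter fun j : Fin p =>
      ((k + 1 : ℕ) : ℝ≥0∞) ≤ ∑ l, ν l (Set.Iio (childTime ν k).toNNReal) +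
        ∑ l ∈ Finset.Iic j, ν l {(childTime ν k).toNNReal}) ↔ k + 1 ≤ N' + s (Finset.Iic j) := by
    intro h j
    rw [Finset.mem_filter, h, ENNReal.toNNReal_coe, hN', hs]
    simp only [Finset.mem_univ, true_and]
    norm_cast
  rw [hN', hs, hs]
  norm_cast
  constructor
  · rintro ⟨h1, h2⟩
    have hmem := hset h1
    have ht := htime.1 h1
    have hne : (Finset.univ.filter fun j : Fin p =>
      ((k + 1 : ℕ) : ℝ≥0∞) ≤ ∑ l, ν l (Set.Iio (childTime ν k).toNNReal) +
        ∑ l ∈ Finset.Iic j, ν l {(childTime ν k).toNNReal}).Nonempty := by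
      have hu : (Finset.univ : Finset (Fin p)).Nonempty := ⟨j, Finset.mem_univ j⟩
      refine ⟨Finset.univ.max' hu, (hmem _).2 ?_⟩
      have : Finset.Iic (Finset.univ.max' hu) = Finset.univ := by
        ext l; simp [Finset.le_max' _ l (Finset.mem_univ l)]
      rw [this]
      exact ht.2
    rw [childType, dif_pos hne] at h2
    have hj := (hmem j).1 (h2 ▸ Finset.min'_mem _ hne)
    refine ⟨?_, hj⟩
    -- Otherwise the type preceding j would already qualify, against the minimality of j.
    by_contra hcon
    push Not at hcon
    have hIio : (Finset.Iio j).Nonempty := by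
      rw [Finset.nonempty_iff_ne_empty]
      intro h
      have : s ∅ = 0 := by
        have := hs ∅
        simp only [Finset.sum_empty] at this
        exact_mod_cast this.symm
      rw [h, this] at hcon
      omega
    set j' := (Finset.Iio j).max' hIio
    have hj'j : j' < j := Finset.mem_Iio.1 (Finset.max'_mem _ hIio)
    have he : Finset.Iio j = Finset.Iic j' := by
      ext l
      rw [Finset.mem_Iio, Finset.mem_Iic]
      exact ⟨fun h => Finset.le_max' _ l (Finset.mem_Iio.2 h), fun h => h.trans_lt hj'j⟩
    rw [he] at hcon
    have h5 := Finset.min'_le _ j' ((hmem j').2 (by omega))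
    rw [h2] at h5
    exact absurd hj'j (not_lt.2 h5)
  · rintro ⟨h1, h2⟩
    have h1' : childTime ν k = x := htime.2 ⟨by omega, h2.trans (by
      have := hmono _ _ (Finset.subset_univ (Finset.Iic j)); omega)⟩
    have hmem := hset h1'
    refine ⟨h1', ?_⟩
    have hjm := (hmem j).2 h2
    rw [childType, dif_pos ⟨j, hjm⟩]
    refine le_antisymm (Finset.min'_le _ _ hjm) (Finset.le_min' _ _ _ fun l hl => ?_)
    by_contra hlj
    push Not at hlj
    have h3 := (hmem l).1 hl
    have h4 := hmono (Finset.Iic l) (Finset.Iio j) fun y hy =>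
      Finset.mem_Iio.2 ((Finset.mem_Iic.1 hy).trans_lt hlj)
    omega

open Classical in
/-- Counting the children of type `j` born up to age `s`. -/
theorem tsum_childTime_childType (hν : ∀ j, IsPointMeasure (ν j)) (i₀ j : Fin p) (s : ℝ≥0) :
    ∑' k : ℕ, (if childTime ν k ≤ s ∧ childType ν i₀ k = j then (1 : ℝ≥0∞) else 0) =
      ν j (Set.Iic s) := by
  -- Each child is sorted by its exact time of birth; after exchanging the sums, every time
  -- contributes the length of one block.
  have h1 : ∀ k : ℕ, (if childTime ν k ≤ s ∧ childType ν i₀ k = j then (1 : ℝ≥0∞) else 0) =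
      ∑' x : ℝ≥0, if x ≤ s then
        (if childTime ν k = x ∧ childType ν i₀ k = j then (1 : ℝ≥0∞) else 0) else 0 := by
    intro k
    by_cases h : childTime ν k = ⊤
    · simp [h]
    · obtain ⟨y, hy⟩ : ∃ y : ℝ≥0, (y : ℝ≥0∞) = childTime ν k := ⟨_, ENNReal.coe_toNNReal h⟩
      rw [tsum_eq_single y]
      · rw [← hy]
        simp only [ENNReal.coe_le_coe, true_and]
        split_ifs <;> simp_all
      · intro x hx
        rw [← hy]
        have : ¬ ((y : ℝ≥0∞) = x) := fun h => hx (by exact_mod_cast h.symm)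
        simp [this]
  simp_rw [h1]
  rw [ENNReal.tsum_comm, ← (hν j).tsum_singleton s]
  refine tsum_congr fun x => ?_
  split_ifs
  swap
  · simp
  simp_rw [childTime_eq_and_childType_eq_iff hν i₀ j]
  obtain ⟨N', hN'⟩ := exists_nat_sum hν Finset.univ measurableSet_Iio
    (Set.Iio_subset_Iic_self (a := x))
  have hT : ∀ T : Finset (Fin p), ∃ n : ℕ, ∑ l ∈ T, ν l {x} = n := fun T =>
    exists_nat_sum hν T (measurableSet_singleton x)
      (Set.singleton_subset_iff.2 (Set.mem_Iic.2 (le_refl x)))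
  obtain ⟨a, ha⟩ := hT (Finset.Iio j)
  obtain ⟨b, hb⟩ := hT {j}
  have hc : ∑ l ∈ Finset.Iic j, ν l {x} = ((a + b : ℕ) : ℝ≥0∞) := by
    rw [← Finset.Iio_insert, Finset.sum_insert (by simp), ha]
    rw [Finset.sum_singleton] at hb
    rw [hb]
    push_cast
    ring
  rw [Finset.sum_singleton] at hb
  rw [hN', ha, hc, hb]
  have h2 : ∀ k : ℕ, (if (N' : ℝ≥0∞) + a ≤ k ∧ ((k + 1 : ℕ) : ℝ≥0∞) ≤ N' + ((a + b : ℕ) : ℝ≥0∞)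
      then (1 : ℝ≥0∞) else 0) = if k ∈ Finset.Ico (N' + a) (N' + a + b) then 1 else 0 := by
    intro k
    congr 1
    rw [Finset.mem_Ico]
    norm_cast
    rw [eq_iff_iff]
    omega
  simp_rw [h2]
  rw [tsum_eq_sum (s := Finset.Ico (N' + a) (N' + a + b)) (fun k hk => if_neg hk)]
  rw [Finset.sum_congr rfl fun k hk => if_pos hk]
  simp

end


/-! ### Measurability of the enumeration -/

-- Monotonicity of the counts in t allows the uncountable infimum to be taken over a dense sequence.
open Classical in
theorem measurable_childTime (k : ℕ) :
    Measurable fun ν : Fin p → Measure ℝ≥0 => childTime ν k := by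
  let q := TopologicalSpace.denseSeq ℝ≥0
  have h : ∀ ν : Fin p → Measure ℝ≥0, childTime ν k =
      ⨅ n, if ((k + 1 : ℕ) : ℝ≥0∞) ≤ ∑ j, ν j (Set.Iic (q n)) then (q n : ℝ≥0∞) else ⊤ := by
    intro ν
    refine le_antisymm (le_iInf fun n => ?_) (le_iInf₂ fun t ht => ?_)
    · split_ifs with h
      · exact iInf₂_le (q n) h
      · exact le_top
    · refine ENNReal.le_of_forall_pos_le_add fun ε hε _ => ?_
      obtain ⟨_, ⟨n, rfl⟩, h1, h2⟩ := (TopologicalSpace.denseRange_denseSeq ℝ≥0).exists_between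
        (lt_add_of_pos_right t hε)
      refine (iInf_le _ n).trans ?_
      rw [if_pos (ht.trans (Finset.sum_le_sum fun j _ =>
        measure_mono (Set.Iic_subset_Iic.2 h1.le)))]
      exact_mod_cast h2.le
  simp_rw [h]
  refine Measurable.iInf fun n => Measurable.ite (measurableSet_le measurable_const ?_)
    measurable_const measurable_const
  exact Finset.measurable_fun_sum _ fun j _ =>
    (Measure.measurable_coe measurableSet_Iic).comp (measurable_pi_apply j)

open Classical in
/-- A jointly measurable version of `m [0, x)`. -/
def massBelow (m : Measure ℝ≥0) (x : ℝ≥0) : ℝ≥0∞ :=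
  ⨆ n, if TopologicalSpace.denseSeq ℝ≥0 n < x then
    m (Set.Iic (TopologicalSpace.denseSeq ℝ≥0 n)) else 0

open Classical in
/-- A jointly measurable function which agrees with `m [0, x]` for locally finite `m`. -/
def massUpTo (m : Measure ℝ≥0) (x : ℝ≥0) : ℝ≥0∞ :=
  ⨅ n, if x < TopologicalSpace.denseSeq ℝ≥0 n then
    m (Set.Iic (TopologicalSpace.denseSeq ℝ≥0 n)) else ⊤

theorem measurable_massBelow : Measurable fun q : Measure ℝ≥0 × ℝ≥0 => massBelow q.1 q.2 := by
  refine Measurable.iSup fun n => Measurable.ite (measurableSet_lt measurable_const measurable_snd)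
    ((Measure.measurable_coe measurableSet_Iic).comp measurable_fst) measurable_const

theorem measurable_massUpTo : Measurable fun q : Measure ℝ≥0 × ℝ≥0 => massUpTo q.1 q.2 := by
  refine Measurable.iInf fun n => Measurable.ite (measurableSet_lt measurable_snd measurable_const)
    ((Measure.measurable_coe measurableSet_Iic).comp measurable_fst) measurable_const

theorem massBelow_eq (m : Measure ℝ≥0) (x : ℝ≥0) : massBelow m x = m (Set.Iio x) := by
  refine le_antisymm (iSup_le fun n => ?_) ?_
  · split_ifs with h
    · exact measure_mono (Set.Iic_subset_Iio.2 h)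
    · exact zero_le
  · rcases eq_or_ne x 0 with rfl | hx
    · simp
    · obtain ⟨u, hu1, hu2, hu3⟩ := exists_seq_strictMono_tendsto' (pos_iff_ne_zero.2 hx)
      have e : Set.Iio x = ⋃ n, Set.Iic (u n) := by
        ext y
        simp only [Set.mem_Iio, Set.mem_iUnion, Set.mem_Iic]
        refine ⟨fun h => ?_, fun ⟨n, hn⟩ => hn.trans_lt (hu2 n).2⟩
        obtain ⟨n, hn⟩ := (hu3.eventually (lt_mem_nhds h)).exists
        exact ⟨n, hn.le⟩
      have h3 : Tendsto (fun n => m (Set.Iic (u n))) atTop (𝓝 (m (Set.Iio x))) := by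
        rw [e]
        exact tendsto_measure_iUnion_atTop fun a b hab => Set.Iic_subset_Iic.2 (hu1.monotone hab)
      refine le_of_tendsto' h3 fun n => ?_
      obtain ⟨_, ⟨l, rfl⟩, h1, h2⟩ := (TopologicalSpace.denseRange_denseSeq ℝ≥0).exists_between
        (hu2 n).2
      refine le_trans ?_ (le_iSup _ l)
      rw [if_pos h2]
      exact measure_mono (Set.Iic_subset_Iic.2 h1.le)

theorem massUpTo_eq (m : Measure ℝ≥0) [IsLocallyFiniteMeasure m] (x : ℝ≥0) :
    massUpTo m x = m (Set.Iic x) := by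
  refine le_antisymm ?_ (le_iInf fun n => ?_)
  · obtain ⟨u, hu1, hu2, hu3⟩ := exists_seq_strictAnti_tendsto x
    have h3 : Tendsto (fun n => m (Set.Iic (u n))) atTop (𝓝 (m (Set.Iic x))) := by
      have e : Set.Iic x = ⋂ n, Set.Iic (u n) := by
        ext y
        simp only [Set.mem_Iic, Set.mem_iInter]
        exact ⟨fun h n => h.trans (hu2 n).le, fun h => ge_of_tendsto' hu3 h⟩
      rw [e]
      exact tendsto_measure_iInter_atTop (fun n => measurableSet_Iic.nullMeasurableSet)
        (fun a b hab => Set.Iic_subset_Iic.2 (hu1.antitone hab)) ⟨0, (measure_Iic_lt_top _).ne⟩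
    refine ge_of_tendsto' h3 fun n => ?_
    obtain ⟨_, ⟨l, rfl⟩, h1, h2⟩ := (TopologicalSpace.denseRange_denseSeq ℝ≥0).exists_between
      (hu2 n)
    refine (iInf_le _ l).trans ?_
    rw [if_pos h1]
    exact measure_mono (Set.Iic_subset_Iic.2 h2.le)
  · split_ifs with h
    · exact measure_mono (Set.Iic_subset_Iic.2 h.le)
    · exact le_top

open Classical in
/-- A measurable function which agrees with `childType` on vectors of locally finite measures. -/
def childTypeMeas (ν : Fin p → Measure ℝ≥0) (i₀ : Fin p) (k : ℕ) : Fin p :=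
  if h : (Finset.univ.filter fun j : Fin p =>
      ((k + 1 : ℕ) : ℝ≥0∞) ≤ ∑ l, massBelow (ν l) (childTime ν k).toNNReal +
        ∑ l ∈ Finset.Iic j, (massUpTo (ν l) (childTime ν k).toNNReal -
          massBelow (ν l) (childTime ν k).toNNReal)).Nonempty
  then Finset.min' _ h else i₀

/-- The atom at x is recovered as the mass of [0, x] minus that of [0, x); local finiteness makes
the subtraction valid. -/
theorem childTypeMeas_eq {ν : Fin p → Measure ℝ≥0} (hν : ∀ j, IsLocallyFiniteMeasure (ν j))
    (i₀ : Fin p) (k : ℕ) : childTypeMeas ν i₀ k = childType ν i₀ k := by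
  have h : ∀ l (x : ℝ≥0), massUpTo (ν l) x - ν l (Set.Iio x) = ν l {x} := by
    intro l x
    have h1 : ν l (Set.Iio x) ≠ ⊤ :=
      ((measure_mono Set.Iio_subset_Iic_self).trans_lt (measure_Iic_lt_top x)).ne
    rw [massUpTo_eq, ← Set.Iio_union_right,
      measure_union (by simp) (measurableSet_singleton x), ENNReal.add_sub_cancel_left h1]
  unfold childTypeMeas childType
  simp only [massBelow_eq, h]

open Classical in
theorem measurable_childTypeMeas (i₀ : Fin p) (k : ℕ) :
    Measurable fun ν : Fin p → Measure ℝ≥0 => childTypeMeas ν i₀ k := by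
  -- The set of qualifying types takes finitely many values, so measurability of each membership
  -- event suffices and taking the minimum is automatically measurable.
  let _ : MeasurableSpace (Finset (Fin p)) := ⊤
  have hx : Measurable fun ν : Fin p → Measure ℝ≥0 => (childTime ν k).toNNReal :=
    (measurable_childTime k).ennreal_toNNReal
  have hb : ∀ l, Measurable fun ν : Fin p → Measure ℝ≥0 =>
      massBelow (ν l) (childTime ν k).toNNReal := fun l =>
    measurable_massBelow.comp ((measurable_pi_apply l).prodMk hx)
  have hu : ∀ l, Measurable fun ν : Fin p → Measure ℝ≥0 =>
      massUpTo (ν l) (childTime ν k).toNNReal := fun l =>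
    measurable_massUpTo.comp ((measurable_pi_apply l).prodMk hx)
  have hset : ∀ j : Fin p, MeasurableSet {ν : Fin p → Measure ℝ≥0 | ((k + 1 : ℕ) : ℝ≥0∞) ≤
      ∑ l, massBelow (ν l) (childTime ν k).toNNReal + ∑ l ∈ Finset.Iic j,
        (massUpTo (ν l) (childTime ν k).toNNReal -
          massBelow (ν l) (childTime ν k).toNNReal)} := fun j =>
    measurableSet_le measurable_const ((Finset.measurable_fun_sum _ fun l _ => hb l).add
      (Finset.measurable_fun_sum _ fun l _ => (hu l).sub (hb l)))
  have hF : Measurable fun ν : Fin p → Measure ℝ≥0 => Finset.univ.filter fun j : Fin p =>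
      ((k + 1 : ℕ) : ℝ≥0∞) ≤ ∑ l, massBelow (ν l) (childTime ν k).toNNReal +
        ∑ l ∈ Finset.Iic j, (massUpTo (ν l) (childTime ν k).toNNReal -
          massBelow (ν l) (childTime ν k).toNNReal) := by
    refine measurable_to_countable' fun T => ?_
    have e : (fun ν : Fin p → Measure ℝ≥0 => Finset.univ.filter fun j : Fin p =>
      ((k + 1 : ℕ) : ℝ≥0∞) ≤ ∑ l, massBelow (ν l) (childTime ν k).toNNReal +
        ∑ l ∈ Finset.Iic j, (massUpTo (ν l) (childTime ν k).toNNReal -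
          massBelow (ν l) (childTime ν k).toNNReal)) ⁻¹' {T} =
      ⋂ j : Fin p, {ν : Fin p → Measure ℝ≥0 | ((k + 1 : ℕ) : ℝ≥0∞) ≤
      ∑ l, massBelow (ν l) (childTime ν k).toNNReal + ∑ l ∈ Finset.Iic j,
        (massUpTo (ν l) (childTime ν k).toNNReal -
          massBelow (ν l) (childTime ν k).toNNReal) ↔ j ∈ T} := by
      ext ν
      simp only [Set.mem_preimage, Set.mem_singleton_iff, Set.mem_iInter, Finset.ext_iff,
        Finset.mem_filter, Finset.mem_univ, true_and]
      rfl
    rw [e]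
    refine MeasurableSet.iInter fun j => ?_
    by_cases hj : j ∈ T
    · simpa [hj] using hset j
    · simp only [hj, iff_false]
      exact (hset j).compl
  exact (measurable_from_top
    (f := fun T : Finset (Fin p) => if h : T.Nonempty then T.min' h else i₀)).comp hF

/-- Evaluating a random vector at a random index. -/
theorem measurable_eval_index {α β : Type*} [MeasurableSpace α] [MeasurableSpace β]
    {f : α → Fin p → β} {Y : α → Fin p} (hf : ∀ i, Measurable fun a => f a i) (hY : Measurable Y) :
    Measurable fun a => f a (Y a) := by
  intro B hB
  have e : (fun a => f a (Y a)) ⁻¹' B = ⋃ i, Y ⁻¹' {i} ∩ (fun a => f a i) ⁻¹' B := by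
    ext a
    simp
  rw [e]
  exact MeasurableSet.iUnion fun i => (hY (measurableSet_singleton i)).inter (hf i hB)

theorem measurable_childType {α : Type*} [MeasurableSpace α] {ν : α → Fin p → Measure ℝ≥0}
    (hν : Measurable ν) (hloc : ∀ a j, IsLocallyFiniteMeasure (ν a j)) (i₀ : Fin p) (k : ℕ) :
    Measurable fun a => childType (ν a) i₀ k := by
  have : (fun a => childType (ν a) i₀ k) = fun a => childTypeMeas (ν a) i₀ k :=
    funext fun a => (childTypeMeas_eq (hloc a) i₀ k).symm
  rw [this]
  exact (measurable_childTypeMeas i₀ k).comp hν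


/-! ### Laws of extended random times restricted to events -/

section

variable {Ω : Type*}

/-- The law of the random time `X` on the event that `X` is finite and `A` occurs. -/
def subLaw [MeasurableSpace Ω] (P : Measure Ω) (X : Ω → ℝ≥0∞) (A : Set Ω) : Measure ℝ≥0 :=
  (P.restrict ({ω | X ω ≠ ⊤} ∩ A)).map fun ω => (X ω).toNNReal

theorem subLaw_apply [MeasurableSpace Ω] (P : Measure Ω) {X : Ω → ℝ≥0∞} (hX : Measurable X)
    (A : Set Ω) {s : Set ℝ≥0} (hs : MeasurableSet s) :
    subLaw P X A s = P ({ω | X ω ≠ ⊤ ∧ (X ω).toNNReal ∈ s} ∩ A) := by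
  rw [subLaw, Measure.map_apply hX.ennreal_toNNReal hs,
    Measure.restrict_apply (hX.ennreal_toNNReal hs)]
  congr 1
  ext ω
  simp only [Set.mem_inter_iff, Set.mem_preimage, Set.mem_ofPred_eq]
  tauto

theorem subLaw_Iic [MeasurableSpace Ω] (P : Measure Ω) {X : Ω → ℝ≥0∞} (hX : Measurable X)
    (A : Set Ω) (t : ℝ≥0) : subLaw P X A (Set.Iic t) = P ({ω | X ω ≤ t} ∩ A) := by
  rw [subLaw_apply P hX A measurableSet_Iic]
  congr 2
  ext ω
  simp only [Set.mem_ofPred_eq, Set.mem_Iic]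
  refine ⟨fun h => ?_, fun h => ?_⟩
  · rw [← ENNReal.coe_toNNReal h.1]
    exact_mod_cast h.2
  · have h1 : X ω ≠ ⊤ := ne_top_of_le_ne_top ENNReal.coe_ne_top h
    exact ⟨h1, by rwa [← ENNReal.coe_le_coe, ENNReal.coe_toNNReal h1]⟩

instance [MeasurableSpace Ω] (P : Measure Ω) [IsFiniteMeasure P] (X : Ω → ℝ≥0∞) (A : Set Ω) :
    IsFiniteMeasure (subLaw P X A) := by
  unfold subLaw
  infer_instance

theorem subLaw_congr [MeasurableSpace Ω] (P : Measure Ω) {X X' : Ω → ℝ≥0∞} (hX : Measurable X)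
    (hX' : Measurable X') {A A' : Set Ω} (hA : A = A') (h : ∀ ω ∈ A, X ω = X' ω) :
    subLaw P X A = subLaw P X' A' := by
  subst hA
  ext s hs
  rw [subLaw_apply P hX _ hs, subLaw_apply P hX' _ hs]
  congr 1
  ext ω
  simp only [Set.mem_inter_iff, Set.mem_ofPred_eq]
  exact and_congr_left fun hω => by rw [h ω hω]

theorem subLaw_eq_sum [MeasurableSpace Ω] (P : Measure Ω) {X : Ω → ℝ≥0∞} (hX : Measurable X)
    (A : Set Ω) {Y : Ω → Fin p} (hY : Measurable Y) :
    subLaw P X A = ∑ l, subLaw P X ({ω | Y ω = l} ∩ A) := by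
  ext s hs
  rw [Measure.finsetSum_apply]
  simp_rw [subLaw_apply P hX _ hs]
  have h := sum_measure_preimage_singleton
    (μ := P.restrict ({ω | X ω ≠ ⊤ ∧ (X ω).toNNReal ∈ s} ∩ A)) (Finset.univ : Finset (Fin p))
    fun l _ => hY (measurableSet_singleton l)
  rw [Finset.coe_univ, Set.preimage_univ, Measure.restrict_apply_univ] at h
  rw [← h]
  refine Finset.sum_congr rfl fun l _ => ?_
  rw [Measure.restrict_apply (hY (measurableSet_singleton l)), Set.inter_left_comm]
  rfl

/-- The law of a sum of independent random times is the convolution of the laws. -/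
theorem subLaw_add {m₁ m₂ : MeasurableSpace Ω} [m : MeasurableSpace Ω] (P : Measure Ω)
    [IsFiniteMeasure P] (hm₁ : m₁ ≤ m) (hm₂ : m₂ ≤ m) (hind : Indep m₁ m₂ P)
    {X Y : Ω → ℝ≥0∞} (hX : Measurable[m₁] X) (hY : Measurable[m₂] Y) {A B : Set Ω}
    (hA : MeasurableSet[m₁] A) (hB : MeasurableSet[m₂] B) :
    subLaw P (fun ω => X ω + Y ω) (A ∩ B) = Measure.conv (subLaw P X A) (subLaw P Y B) := by
  have hX' := hX.mono hm₁ le_rfl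
  have hY' := hY.mono hm₂ le_rfl
  -- A product of finite measures is determined by rectangles, and there the identity is
  -- independence.
  have hprod : (subLaw P X A).prod (subLaw P Y B) =
      (P.restrict (({ω | X ω ≠ ⊤} ∩ A) ∩ ({ω | Y ω ≠ ⊤} ∩ B))).map
        fun ω => ((X ω).toNNReal, (Y ω).toNNReal) := by
    refine Measure.prod_eq fun s t hs ht => ?_
    rw [Measure.map_apply (hX'.ennreal_toNNReal.prodMk hY'.ennreal_toNNReal) (hs.prod ht),
      Measure.restrict_apply
        ((hX'.ennreal_toNNReal.prodMk hY'.ennreal_toNNReal) (hs.prod ht)),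
      subLaw_apply P hX' A hs, subLaw_apply P hY' B ht,
      ← Indep_iff _ _ _ |>.1 hind _ _ ?_ ?_]
    · congr 1
      ext ω
      simp only [Set.mem_inter_iff, Set.mem_preimage, Set.mem_ofPred_eq, Set.mem_prod]
      tauto
    · exact (((measurableSet_singleton ⊤).compl.preimage hX).inter
        (hX.ennreal_toNNReal hs)).inter hA
    · exact (((measurableSet_singleton ⊤).compl.preimage hY).inter
        (hY.ennreal_toNNReal ht)).inter hB
  rw [Measure.conv, hprod, Measure.map_map (by fun_prop)
    (hX'.ennreal_toNNReal.prodMk hY'.ennreal_toNNReal)]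
  have e : {ω | X ω + Y ω ≠ ⊤} ∩ (A ∩ B) = ({ω | X ω ≠ ⊤} ∩ A) ∩ ({ω | Y ω ≠ ⊤} ∩ B) := by
    ext ω
    simp only [Set.mem_inter_iff, Set.mem_ofPred_eq, ENNReal.add_ne_top]
    tauto
  rw [subLaw, e]
  refine Measure.map_congr ?_
  have hS : MeasurableSet (({ω | X ω ≠ ⊤} ∩ A) ∩ ({ω | Y ω ≠ ⊤} ∩ B)) :=
    ((((measurableSet_singleton ⊤).compl.preimage hX').inter (hm₁ _ hA))).inter
      (((measurableSet_singleton ⊤).compl.preimage hY').inter (hm₂ _ hB))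
  filter_upwards [ae_restrict_mem hS] with ω hω
  exact ENNReal.toNNReal_add hω.1.1 hω.2.1

end


/-! ### The branching recursion -/

/-- The σ-algebra is arbitrary and only strictly shorter words are required to be measurable, so the
result also applies to `history`. -/
theorem measurable_birthTime_indType {α : Type*} [MeasurableSpace α]
    {ξ : List ℕ → α → MeasureMatrix p} (hξ : ∀ u a i j, IsPointMeasure (ξ u a i j)) (i : Fin p) :
    ∀ u : List ℕ, (∀ v : List ℕ, v.length < u.length → Measurable (ξ v)) →
      (Measurable fun a => birthTime (fun v => ξ v a) i u) ∧
        Measurable fun a => indType (fun v => ξ v a) i u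
  | [], _ => ⟨measurable_const, measurable_const⟩
  | k :: u, h => by
    obtain ⟨h1, h2⟩ := measurable_birthTime_indType hξ i u fun v hv =>
      h v (hv.trans (Nat.lt_succ_self _))
    have h3 : ∀ l, Measurable fun a => ξ u a l := fun l =>
      (measurable_pi_apply l).comp (h u (Nat.lt_succ_self _))
    refine ⟨h1.add ?_, ?_⟩
    · exact measurable_eval_index (f := fun a l => childTime (ξ u a l) k)
        (fun l => (measurable_childTime k).comp (h3 l)) h2
    · exact measurable_eval_index (f := fun a l => childType (ξ u a l) l k)
        (fun l => measurable_childType (h3 l) (fun a j => (hξ u a l j).1) l k) h2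

section

variable {Ω : Type*} [MeasurableSpace Ω]

/-- The events determined by the reproduction of the individuals in the first `n` generations. -/
abbrev history (ξ : List ℕ → Ω → MeasureMatrix p) (n : ℕ) : MeasurableSpace Ω :=
  ⨆ v ∈ {v : List ℕ | v.length < n}, MeasurableSpace.comap (ξ v) inferInstance

/-- The law of the time of birth of the individual `u` on the event that it has type `j`. -/
def birthLaw (P : Measure Ω) (ξ : List ℕ → Ω → MeasureMatrix p) (u : List ℕ) : MeasureMatrix p :=
  fun i j => subLaw P (fun ω => birthTime (fun v => ξ v ω) i u)
    {ω | indType (fun v => ξ v ω) i u = j}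

/-- The law of the age at which the ancestor gives birth to its child number `k`, on the event
that this child has type `j`. -/
def childLaw (P : Measure Ω) (ξ : List ℕ → Ω → MeasureMatrix p) (k : ℕ) : MeasureMatrix p :=
  fun i j => subLaw P (fun ω => childTime (ξ [] ω i) k) {ω | childType (ξ [] ω i) i k = j}

instance (P : Measure Ω) [IsFiniteMeasure P] (ξ : List ℕ → Ω → MeasureMatrix p) (u : List ℕ)
    (i j : Fin p) : IsFiniteMeasure (birthLaw P ξ u i j) := by
  unfold birthLaw
  infer_instance

instance (P : Measure Ω) [IsFiniteMeasure P] (ξ : List ℕ → Ω → MeasureMatrix p) (k : ℕ)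
    (i j : Fin p) : IsFiniteMeasure (childLaw P ξ k i j) := by
  unfold childLaw
  infer_instance

namespace IsReproduction

variable {P : Measure Ω} {ξ : List ℕ → Ω → MeasureMatrix p}

theorem measurable_row (hξ : IsReproduction P ξ) (u : List ℕ) (l : Fin p) :
    Measurable fun ω => ξ u ω l :=
  (measurable_pi_apply l).comp (hξ.measurable u)

theorem history_le (hξ : IsReproduction P ξ) (n : ℕ) : history ξ n ≤ ‹MeasurableSpace Ω› :=
  iSup₂_le fun v _ => (hξ.measurable v).comap_le

theorem indep_history (hξ : IsReproduction P ξ) (u : List ℕ) :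
    Indep (history ξ u.length) (MeasurableSpace.comap (ξ u) inferInstance) P := by
  have h := indep_iSup_of_disjoint (fun v => (hξ.measurable v).comap_le) hξ.indep
    (S := {v : List ℕ | v.length < u.length}) (T := {u})
    (Set.disjoint_singleton_right.2 (lt_irrefl u.length))
  rwa [iSup_singleton] at h

theorem measurable_birthTime (hξ : IsReproduction P ξ) (i : Fin p) (u : List ℕ) :
    Measurable fun ω => birthTime (fun v => ξ v ω) i u :=
  (measurable_birthTime_indType hξ.isPointMeasure i u fun v _ => hξ.measurable v).1

theorem measurable_indType (hξ : IsReproduction P ξ) (i : Fin p) (u : List ℕ) :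
    Measurable fun ω => indType (fun v => ξ v ω) i u :=
  (measurable_birthTime_indType hξ.isPointMeasure i u fun v _ => hξ.measurable v).2

theorem measurable_history (hξ : IsReproduction P ξ) (i : Fin p) (u : List ℕ) :
    (Measurable[history ξ u.length] fun ω => birthTime (fun v => ξ v ω) i u) ∧
      Measurable[history ξ u.length] fun ω => indType (fun v => ξ v ω) i u :=
  @measurable_birthTime_indType p Ω (history ξ u.length) ξ hξ.isPointMeasure i u fun v hv =>
    Measurable.of_comap_le (le_iSup₂_of_le v hv le_rfl)

/-- All individuals have children with the same laws. -/
theorem subLaw_child (hξ : IsReproduction P ξ) (u : List ℕ) (k : ℕ) (l j : Fin p) :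
    subLaw P (fun ω => childTime (ξ u ω l) k) {ω | childType (ξ u ω l) l k = j} =
      childLaw P ξ k l j := by
  ext s hs
  have hX : ∀ v, Measurable fun ω => childTime (ξ v ω l) k := fun v =>
    (measurable_childTime k).comp (hξ.measurable_row v l)
  rw [childLaw, subLaw_apply P (hX u) _ hs, subLaw_apply P (hX []) _ hs]
  -- Equality in law needs a measurable set of matrices, which is why `childTypeMeas` replaces
  -- `childType` here.
  have hB : MeasurableSet {ν : MeasureMatrix p | (childTime (ν l) k ≠ ⊤ ∧
      (childTime (ν l) k).toNNReal ∈ s) ∧ childTypeMeas (ν l) l k = j} := by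
    have h1 : Measurable fun ν : MeasureMatrix p => childTime (ν l) k :=
      (measurable_childTime k).comp (measurable_pi_apply l)
    have h2 : Measurable fun ν : MeasureMatrix p => childTypeMeas (ν l) l k :=
      (measurable_childTypeMeas l k).comp (measurable_pi_apply l)
    exact (((measurableSet_singleton ⊤).compl.preimage h1).inter (h1.ennreal_toNNReal hs)).inter
      (h2 (measurableSet_singleton j))
  have he : ∀ v, {ω | childTime (ξ v ω l) k ≠ ⊤ ∧ (childTime (ξ v ω l) k).toNNReal ∈ s} ∩
      {ω | childType (ξ v ω l) l k = j} = ξ v ⁻¹' {ν : MeasureMatrix p | (childTime (ν l) k ≠ ⊤ ∧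
      (childTime (ν l) k).toNNReal ∈ s) ∧ childTypeMeas (ν l) l k = j} := by
    intro v
    ext ω
    simp only [Set.mem_inter_iff, Set.mem_ofPred_eq, Set.mem_preimage,
      childTypeMeas_eq fun j => (hξ.isPointMeasure v ω l j).1]
  rw [he, he]
  exact (hξ.identDistrib u).measure_mem_eq hB

/-- Decompose by the type l of the parent. On that event the birth time is a history-measurable time
plus a time read from row l of `ξ u`; independence of the two gives the convolution. -/
theorem birthLaw_cons [IsFiniteMeasure P] (hξ : IsReproduction P ξ) (k : ℕ) (u : List ℕ) :
    birthLaw P ξ (k :: u) = matConv (birthLaw P ξ u) (childLaw P ξ k) := by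
  funext i j
  have hT : ∀ l, Measurable fun ω => childTime (ξ u ω l) k := fun l =>
    (measurable_childTime k).comp (hξ.measurable_row u l)
  rw [birthLaw, subLaw_eq_sum P (hξ.measurable_birthTime i _) _ (hξ.measurable_indType i u),
    matConv]
  refine Finset.sum_congr rfl fun l _ => ?_
  rw [← hξ.subLaw_child u k l j, birthLaw]
  obtain ⟨hB, hI⟩ := hξ.measurable_history i u
  have hrow : Measurable[MeasurableSpace.comap (ξ u) inferInstance] fun ω => ξ u ω l :=
    (measurable_pi_apply l).comp (comap_measurable (ξ u))
  refine Eq.trans ?_ (subLaw_add P (hξ.history_le _) (hξ.measurable u).comap_le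
    (hξ.indep_history u) hB ((measurable_childTime k).comp hrow) (hI (measurableSet_singleton l))
    (@measurable_childType p Ω (MeasurableSpace.comap (ξ u) inferInstance) _ hrow
      (fun ω j => (hξ.isPointMeasure u ω l j).1) l k _ (measurableSet_singleton j)))
  refine subLaw_congr P (hξ.measurable_birthTime i _)
    ((hξ.measurable_birthTime i u).add (hT l)) ?_ ?_
  · ext ω
    simp only [Set.mem_inter_iff, Set.mem_ofPred_eq, indType]
    exact and_congr_right fun h => by rw [h]
  · rintro ω ⟨h, -⟩
    rw [Set.mem_ofPred_eq] at h
    rw [birthTime, h]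
    rfl

theorem birthLaw_nil [IsProbabilityMeasure P] (ξ : List ℕ → Ω → MeasureMatrix p) :
    birthLaw P ξ [] = fun i j => if i = j then Measure.dirac 0 else 0 := by
  funext i j
  ext s hs
  rw [birthLaw, subLaw_apply P (X := fun ω => birthTime (fun v => ξ v ω) i [])
    measurable_const _ hs]
  by_cases h : i = j
  · by_cases h0 : (0 : ℝ≥0) ∈ s <;> simp [h, h0, birthTime, indType, Measure.dirac_apply' _ hs]
  · simp [h, birthTime, indType]

-- Taking expectations in `tsum_childTime_childType` gives equality on all [0, t], a π-system on
-- which the measures are finite.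
open Classical in
theorem sum_childLaw (hξ : IsReproduction P ξ) (i j : Fin p)
    (hloc : IsLocallyFiniteMeasure (intensity P ξ i j)) :
    (Measure.sum fun k => childLaw P ξ k i j) = intensity P ξ i j := by
  have hX : ∀ k, Measurable fun ω => childTime (ξ [] ω i) k := fun k =>
    (measurable_childTime k).comp (hξ.measurable_row [] i)
  have hm : ∀ k, Measurable fun ω => childType (ξ [] ω i) i k := fun k =>
    measurable_childType (hξ.measurable_row [] i) (fun ω j => (hξ.isPointMeasure [] ω i j).1) i k
  have hI : ∀ t : ℝ≥0, (Measure.sum fun k => childLaw P ξ k i j) (Set.Iic t) =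
      intensity P ξ i j (Set.Iic t) := by
    intro t
    rw [Measure.sum_apply _ measurableSet_Iic, intensity, Measure.bind_apply
      (f := fun ω => ξ [] ω i j) measurableSet_Iic
      ((measurable_pi_apply j).comp (hξ.measurable_row [] i)).aemeasurable]
    have hcount : ∀ ω, ξ [] ω i j (Set.Iic t) = ∑' k : ℕ,
        if childTime (ξ [] ω i) k ≤ t ∧ childType (ξ [] ω i) i k = j then (1 : ℝ≥0∞) else 0 :=
      fun ω => (tsum_childTime_childType (hξ.isPointMeasure [] ω i) i j t).symm
    simp_rw [hcount]
    have hA : ∀ k, MeasurableSet ({ω | childTime (ξ [] ω i) k ≤ t} ∩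
        {ω | childType (ξ [] ω i) i k = j}) := fun k =>
      (measurableSet_le (hX k) measurable_const).inter (hm k (measurableSet_singleton j))
    have hf : ∀ k, Measurable fun ω => if childTime (ξ [] ω i) k ≤ t ∧
        childType (ξ [] ω i) i k = j then (1 : ℝ≥0∞) else 0 := fun k =>
      Measurable.ite (hA k) measurable_const measurable_const
    rw [lintegral_tsum fun k => (hf k).aemeasurable]
    refine tsum_congr fun k => ?_
    rw [childLaw, subLaw_Iic P (hX k), ← lintegral_indicator_one (hA k)]
    exact lintegral_congr fun ω => by simp [Set.indicator]
  refine (Measure.ext_of_generateFrom_of_iUnion (Set.range Set.Iic) (fun n : ℕ => Set.Iic (n : ℝ≥0))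
    (BorelSpace.measurable_eq.trans (borel_eq_generateFrom_Iic ℝ≥0)) isPiSystem_Iic ?_ ?_ ?_ ?_)
  · refine Set.eq_univ_of_forall fun x => ?_
    obtain ⟨n, hn⟩ := exists_nat_ge x
    exact Set.mem_iUnion.2 ⟨n, hn⟩
  · exact fun n => ⟨_, rfl⟩
  · intro n
    rw [hI]
    exact (measure_Iic_lt_top _).ne
  · rintro _ ⟨t, rfl⟩
    exact hI t

end IsReproduction

end


/-! ### Generations -/

theorem conv_sum_left {ι : Type*} (m : ι → Measure ℝ≥0) (ν : Measure ℝ≥0) [SFinite ν] :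
    Measure.conv (Measure.sum m) ν = Measure.sum fun n => Measure.conv (m n) ν := by
  unfold Measure.conv
  rw [Measure.prod_sum_left, Measure.map_sum (by fun_prop)]

theorem conv_sum_sum {ι κ : Type*} [Countable κ] (m : ι → Measure ℝ≥0) (ν : κ → Measure ℝ≥0)
    [∀ n, SFinite (ν n)] :
    Measure.conv (Measure.sum m) (Measure.sum ν) =
      Measure.sum fun q : ι × κ => Measure.conv (m q.1) (ν q.2) := by
  unfold Measure.conv
  rw [Measure.prod_sum, Measure.map_sum (by fun_prop)]

theorem matConv_assoc {a b c : MeasureMatrix p} (hb : ∀ i j, SFinite (b i j))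
    (hc : ∀ i j, SFinite (c i j)) : matConv (matConv a b) c = matConv a (matConv b c) := by
  funext i j
  simp only [matConv]
  have h1 : ∀ k, (∑ l, Measure.conv (a i l) (b l k)).conv (c k j) =
      ∑ l, Measure.conv (a i l) (Measure.conv (b l k) (c k j)) := by
    intro k
    have := hc k j
    rw [← Measure.sum_fintype, conv_sum_left, Measure.sum_fintype]
    refine Finset.sum_congr rfl fun l _ => ?_
    have := hb l k
    exact Measure.conv_assoc _ _ _
  have h2 : ∀ l, (a i l).conv (∑ k, Measure.conv (b l k) (c k j)) =
      ∑ k, Measure.conv (a i l) (Measure.conv (b l k) (c k j)) := by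
    intro l
    have := hb l
    have := fun k => hc k j
    rw [← Measure.sum_fintype, conv_sum_right, Measure.sum_fintype]
  simp_rw [h1, h2]
  exact Finset.sum_comm

theorem convPow_zero_matConv {a : MeasureMatrix p} (ha : ∀ i j, SFinite (a i j))
    (μ : MeasureMatrix p) :
    matConv (convPow μ 0) a = a := by
  funext i j
  rw [matConv, Finset.sum_eq_single i]
  · have := ha i j
    simp [convPow]
  · intro k _ hk
    simp [convPow, hk.symm]
  · simp

theorem matConv_convPow_zero {a : MeasureMatrix p} (ha : ∀ i j, SFinite (a i j))
    (μ : MeasureMatrix p) :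
    matConv a (convPow μ 0) = a := by
  funext i j
  rw [matConv, Finset.sum_eq_single j]
  · have := ha i j
    simp [convPow]
  · intro k _ hk
    simp [convPow, hk]
  · simp

/-- `convPow` multiplies on the left, by the first generation, whereas `k :: u` adds the latest
generation on the right. -/
theorem convPow_succ' {μ : MeasureMatrix p} (h : ∀ i j, SFinite (μ i j)) (n : ℕ) :
    convPow μ (n + 1) = matConv (convPow μ n) μ := by
  induction n with
  | zero =>
    change matConv μ (convPow μ 0) = matConv (convPow μ 0) μ
    rw [matConv_convPow_zero h, convPow_zero_matConv h]
  | succ n ih =>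
    change matConv μ (convPow μ (n + 1)) = matConv (matConv μ (convPow μ n)) μ
    rw [ih, matConv_assoc (sFinite_convPow h n) h]

section

variable {Ω : Type*} [MeasurableSpace Ω]

/-- Words of length `n + 1` consist of a letter and a word of length `n`. -/
def consLengthEquiv (n : ℕ) : {u : List ℕ // u.length = n} × ℕ ≃
    {u : List ℕ // u.length = n + 1} where
  toFun q := ⟨q.2 :: q.1.1, by simp [q.1.2]⟩
  invFun u := (⟨u.1.tail, by simp [u.2]⟩, u.1.head (by rintro h; simpa [h] using u.2))
  left_inv q := by simp
  right_inv u := by simp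

namespace IsReproduction

variable {P : Measure Ω} {ξ : List ℕ → Ω → MeasureMatrix p}

/-- Induction on the generation: a word of length n + 1 is a pair of a parent and a child number,
and convolution distributes over both sums. -/
theorem sum_birthLaw [IsProbabilityMeasure P] (hξ : IsReproduction P ξ)
    (hloc : ∀ i j, IsLocallyFiniteMeasure (intensity P ξ i j)) (n : ℕ) (i j : Fin p) :
    (Measure.sum fun u : {u : List ℕ // u.length = n} => birthLaw P ξ u i j) =
      convPow (intensity P ξ) n i j := by
  induction n generalizing i j with
  | zero =>
    have : Unique {u : List ℕ // u.length = 0} :=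
      ⟨⟨⟨[], rfl⟩⟩, fun u => Subtype.ext (List.length_eq_zero_iff.1 u.2)⟩
    ext s hs
    rw [Measure.sum_apply _ hs, tsum_eq_single ⟨[], rfl⟩ fun u hu => absurd (Subsingleton.elim u _) hu,
      birthLaw_nil]
    rfl
  | succ n ih =>
    rw [convPow_succ' (fun i j => inferInstance), matConv]
    simp_rw [← ih, ← hξ.sum_childLaw _ j (hloc _ j), conv_sum_sum]
    ext s hs
    rw [Measure.sum_apply _ hs, Measure.finsetSum_apply, ← (consLengthEquiv n).tsum_eq]
    simp_rw [Measure.sum_apply _ hs]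
    rw [← Summable.tsum_finsetSum fun _ _ => ENNReal.summable]
    refine tsum_congr fun q => ?_
    rw [consLengthEquiv, Equiv.coe_fn_mk, hξ.birthLaw_cons, matConv, Measure.finsetSum_apply]

open Classical in
theorem meanBorn_eq [IsProbabilityMeasure P] (hξ : IsReproduction P ξ)
    (hloc : ∀ i j, IsLocallyFiniteMeasure (intensity P ξ i j)) (t : ℝ≥0) (i j : Fin p) :
    meanBorn P ξ t i j = renewalFunction (intensity P ξ) t i j := by
  have hA : ∀ u, MeasurableSet ({ω | birthTime (fun v => ξ v ω) i u ≤ t} ∩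
      {ω | indType (fun v => ξ v ω) i u = j}) := fun u =>
    (measurableSet_le (hξ.measurable_birthTime i u) measurable_const).inter
      (hξ.measurable_indType i u (measurableSet_singleton j))
  have h1 : meanBorn P ξ t i j = ∑' u : List ℕ, birthLaw P ξ u i j (Set.Iic t) := by
    unfold meanBorn numBorn
    have hf : ∀ u, Measurable fun ω => if birthTime (fun v => ξ v ω) i u ≤ t ∧
        indType (fun v => ξ v ω) i u = j then (1 : ℝ≥0∞) else 0 := fun u =>
      Measurable.ite (hA u) measurable_const measurable_const
    rw [lintegral_tsum fun u => (hf u).aemeasurable]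
    refine tsum_congr fun u => ?_
    rw [birthLaw, subLaw_Iic P (hξ.measurable_birthTime i u), ← lintegral_indicator_one (hA u)]
    exact lintegral_congr fun ω => by simp [Set.indicator]
  -- Words are grouped by length, that is, by generation.
  rw [h1, ← (Equiv.sigmaFiberEquiv (List.length (α := ℕ))).tsum_eq, ENNReal.tsum_sigma',
    renewalFunction]
  refine tsum_congr fun n => ?_
  rw [← hξ.sum_birthLaw hloc, Measure.sum_apply _ measurableSet_Iic]
  rfl

end IsReproduction

end

end CMJ

end

/-! ### The main theorem -/

theorem mainTheorem8 {Ω : Type*} [MeasurableSpace Ω] (P : Measure Ω) [IsProbabilityMeasure P]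
    (p : ℕ) (ξ : List ℕ → Ω → CMJ.MeasureMatrix p) (hξ : CMJ.IsReproduction P ξ)
    (μ : CMJ.MeasureMatrix p) (hμ : μ = CMJ.intensity P ξ)
    (θ : ℝ) (hA1 : (θ : ℂ) ∈ interior (CMJ.laplaceDomain μ))
    (hA2 : spectralRadius ℂ (CMJ.massAtZero μ) < 1)
    (hsup : CMJ.ResolventBoundedOn μ θ)
    (hfin : (CMJ.rootsRight μ θ).Finite) :
    (∀ (t : ℝ≥0) (i j : Fin p), CMJ.meanBorn P ξ t i j ≠ ⊤ ∧
      CMJ.meanBorn P ξ t i j = CMJ.renewalFunction μ t i j) ∧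
    ∃ C : ℂ → ℕ → Matrix (Fin p) (Fin p) ℂ,
      (∀ (a : ℂ) (k : ℕ), C (starRingEnd ℂ a) k = (C a k).map (starRingEnd ℂ)) ∧
      ∀ i j : Fin p,
        (fun t : ℝ≥0 =>
          (((CMJ.meanBorn P ξ t i j).toReal : ℝ) : ℂ)
            - (∑ a ∈ hfin.toFinset, Complex.exp (a * ((t : ℝ) : ℂ)) *
                  ∑ k ∈ Finset.range (CMJ.poleOrder μ a), ((t : ℝ) : ℂ) ^ k * C a k i j
                + ((t : ℝ) : ℂ) ^ (CMJ.poleOrder μ 0) * C 0 (CMJ.poleOrder μ 0) i j))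
          =O[atTop] fun t : ℝ≥0 => (t : ℝ) * Real.exp (θ * (t : ℝ)) := by
  subst hμ
  obtain ⟨δ, -, hδ⟩ := CMJ.exists_integrable_of_mem_interior hA1
  have hmean := hξ.meanBorn_eq fun i j => CMJ.isLocallyFiniteMeasure_of_integrable (hδ i j)
  obtain ⟨htop, C, hC, hexp⟩ := CMJ.renewalFunction_expansion hA1 hA2 hsup hfin
  simp_rw [hmean]
  exact ⟨fun t i j => ⟨htop t i j, trivial⟩, C, hC, hexp⟩
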